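/- **Setting.** For a measure $\nu$ on $\mathbb R_+^d$, $\mathcal G_d(\nu)$ denotes the probability law on $\mathbb R_+^d$ with cumulant generating function $K(t)=\ln\mathbb E\,e^{\langle t,X\rangle}=-\int\ln(1-\langle t,s\rangle)\,\nu(ds)$ for $t\in\mathbb C^d$ with $\mathrm{Re}\,t_j\le 0$, and $f_\nu$ its Lebesgue density. The measure $\nu$ is *well-behaved* if $\nu=\sum_{i=1}^n\alpha_i\delta_{s_i}$ with $\alpha_i>0$, $s_i\in\mathbb R_+^d\setminus\{0\}$, $\sum_i\alpha_i\ge1$ and, writing $S(s)$ for the ray from $0$ through $s$, for every $J\subseteq\{1,\dots,n\}$ with $\nu(\bigcup_{i\in J}S(s_i))>\nu(\bigcup_{i\notin J}S(s_i))$ the only $v\in\mathbb R^d$ with $\langle s_i,v\rangle=0$ for all $i\in J$ is $v=0$. Fix $m\in\mathbb N$. Let $A\in\mathbb R^{(m+1)\times(m+1)}$, $A_{k,j}=\sqrt2\binom kj\frac{(-2)^j}{j!}$, and let $B$ be the map $(\tau_k)_{k\le m}\mapsto(\mu_k)_{k\le m}$ given by $\sum_k\frac{\mu_k}{k!}u^k=\exp\big(\tau_0+\sum_{k\ge1}\frac{\tau_k}{k}u^k\big)$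 (up to order $m$), which is a bijection onto $\{\mu_0>0\}$. For a univariate sample $x=(x_1,\dots,x_N)$ put $\hat\mu_k(x)=\frac1N\sum_i x_i^ke^{-x_i}$, $\hat\tau(x)=B^{-1}(\hat\mu(x))$, and let $\nabla(x)$ be the Jacobian of $\tau\mapsto AB(\tau)$ at $\hat\tau(x)$. For a measure $\nu$ on $\mathbb R_+$ put $\tau_0(\nu)=K(-1)$ and $\tau_k(\nu)=K^{(k)}(-1)/(k-1)!$ for $1\le k\le m$, with $K$ the cumulant generating function of $\mathcal G_1(\nu)$. For a sample $\mathcal X=(X_1,\dots,X_N)$ in $\mathbb R_+^d$ and a well-behaved $\nu$, let $\nu_{\langle c\rangle}$ be the image of $\nu$ under $s\mapsto\langle c,s\rangle$ and $$\widetilde{\mathcal L}_m(\mathcal X,\nu)=\int_{[0,1]^d}\big\|\nabla(\langle c,\mathcal X\rangle)\big(\hat\tau(\langle c,\mathcal X\rangle)-\tau(\nu_{\langle c\rangle})\big)\big\|_2^2\,dc .$$ **Theorem (consistency of $\widetilde{\mathcal L}$).** Let $\nu_0$ be well-behaved, let $f=f_{\nu_0}$ be square integrable, and let $X_1,X_2,\dots$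 be i.i.d. with density $f$; write $\mathcal X_N=(X_1,\dots,X_N)$. Then any global minimizer $$\tilde\nu_{m,N}\in\operatorname*{argmin}_{\nu\text{ well-behaved}}\widetilde{\mathcal L}_m(\mathcal X_N,\nu)$$ satisfies $\|f-f_{\tilde\nu_{m,N}}\|_2^2\to0$ almost surely as $N\to\infty$ and then $m\to\infty$. That is: almost surely, for every $\varepsilon>0$, for all sufficiently large $m$ and then for all sufficiently large $N$ (depending on $m$), every global minimizer $\tilde\nu$ of $\widetilde{\mathcal L}_m(\mathcal X_N,\cdot)$ over the well-behaved measures is such that $\mathcal G_d(\tilde\nu)$ has a density $f_{\tilde\nu}$ with $\|f-f_{\tilde\nu}\|_2^2\le\varepsilon$. -/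

import Mathlib

open MeasureTheory ProbabilityTheory Filter Topology
open scoped ENNReal Matrix

noncomputable section

namespace GammaConv

/-! ### Multivariate Gamma convolutions -/

/-- `law` is the `d`-dimensional generalized Gamma convolution with Thorin measure `ν`: a probability
measure on the nonnegative orthant whose cumulant generating function is
`K(t) = - ∫ log (1 - ⟨t, s⟩) ν(ds)` for complex `t` with nonpositive real parts (there
`1 - ⟨t, s⟩` has real part at least `1`, so that the principal logarithm is the right branch).
The identity for `K` is written after exponentiation. -/
structure IsGGC {d : ℕ} (law ν : Measure (Fin d → ℝ)) : Prop where
  isProb : IsProbabilityMeasure law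
  law_orthant : ∀ᵐ x ∂law, 0 ≤ x
  thorin_orthant : ∀ᵐ s ∂ν, 0 ≤ s
  integrable : ∀ t : Fin d → ℂ, (∀ j, (t j).re ≤ 0) →
    Integrable (fun s : Fin d → ℝ => Complex.log (1 - ∑ j, t j * (s j : ℂ))) ν
  mgf_eq : ∀ t : Fin d → ℂ, (∀ j, (t j).re ≤ 0) →
    ∫ x, Complex.exp (∑ j, t j * (x j : ℂ)) ∂law =
      Complex.exp (-∫ s, Complex.log (1 - ∑ j, t j * (s j : ℂ)) ∂ν)

/-- The measure on `ℝ^d` with density `f` with respect to Lebesgue measure. -/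
def lawOfDensity {d : ℕ} (f : (Fin d → ℝ) → ℝ) : Measure (Fin d → ℝ) :=
  (volume : Measure (Fin d → ℝ)).withDensity fun x => ENNReal.ofReal (f x)

/-- `f` is the (almost everywhere unique) Lebesgue density of the generalized Gamma convolution with
Thorin measure `ν`. -/
structure IsGGCDensity {d : ℕ} (ν : Measure (Fin d → ℝ)) (f : (Fin d → ℝ) → ℝ) : Prop where
  aemeasurable : AEMeasurable f (volume : Measure (Fin d → ℝ))
  nonneg : ∀ᵐ x ∂(volume : Measure (Fin d → ℝ)), 0 ≤ f x
  isGGC : IsGGC (lawOfDensity f) ν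

/-- The ray from the origin through `s`. -/
def ray {d : ℕ} (s : Fin d → ℝ) : Set (Fin d → ℝ) := {x | ∃ r : ℝ, 0 ≤ r ∧ x = r • s}

/-- Well-behaved Thorin measures: finitely atomic, `ν = ∑ i, α i • δ_{s i}`, on the nonnegative
orthant without the origin, of total mass at least `1`, and such that the `s i`, `i ∈ J`, have trivial
common kernel whenever the rays through them carry more mass than the rays through the other atoms. -/
def WellBehaved {d : ℕ} (ν : Measure (Fin d → ℝ)) : Prop :=
  ∃ (n : ℕ) (α : Fin n → ℝ) (s : Fin n → Fin d → ℝ),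
    (∀ i, 0 < α i) ∧ (∀ i, 0 ≤ s i) ∧ (∀ i, s i ≠ 0) ∧
    ν = ∑ i, ENNReal.ofReal (α i) • Measure.dirac (s i) ∧
    1 ≤ ∑ i, α i ∧
    ∀ J : Finset (Fin n), ν (⋃ i ∈ Jᶜ, ray (s i)) < ν (⋃ i ∈ J, ray (s i)) →
      ∀ v : Fin d → ℝ, (∀ i ∈ J, s i ⬝ᵥ v = 0) → v = 0

/-! ### Shifted moments and Thorin moments in dimension one

The Thorin moments are `τ k = K^(k)(-1) / (k-1)!` (with `τ 0 = K(-1)`, which is what `0 - 1 = 0` in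
`ℕ` gives), the shifted moments are `μ k = M^(k)(-1)`, where `M = exp ∘ K`. -/

/-- The function `B`, `μ = B(τ)`: the recursion that `M' = K' M` gives for the derivatives at `-1`.
See `iteratedDeriv_exp_comp`. -/
def bell (τ : ℕ → ℝ) : ℕ → ℝ
  | 0 => Real.exp (τ 0)
  | k + 1 => ∑ l : Fin (k + 1),
      (k.choose l : ℝ) * (((k - l).factorial : ℝ) * τ (k + 1 - l)) * bell τ l

/-- The inverse function `B⁻¹`, `τ = B⁻¹(μ)`, for `μ 0 > 0`; see `bell_bellInv`, `bellInv_bell`. -/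
def bellInv (μ : ℕ → ℝ) : ℕ → ℝ
  | 0 => Real.log (μ 0)
  | k + 1 => (μ (k + 1) - ∑ l : Fin k,
      (k.choose (l + 1) : ℝ) * (((k - (l + 1)).factorial : ℝ) * bellInv μ (k - l)) * μ (l + 1)) /
        ((k.factorial : ℝ) * μ 0)

theorem bell_pos_zero (τ : ℕ → ℝ) : 0 < bell τ 0 := by
  rw [bell]; exact Real.exp_pos _

theorem bell_succ_eq (τ : ℕ → ℝ) (k : ℕ) : bell τ (k + 1) =
    (k.factorial : ℝ) * τ (k + 1) * bell τ 0 + ∑ l : Fin k,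
      (k.choose (l + 1) : ℝ) * (((k - (l + 1)).factorial : ℝ) * τ (k - l)) * bell τ (l + 1) := by
  conv_lhs => rw [bell, Fin.sum_univ_succ]
  simp

theorem bell_bellInv (μ : ℕ → ℝ) (h : 0 < μ 0) : bell (bellInv μ) = μ := by
  funext k
  induction k using Nat.strong_induction_on with
  | _ k ih =>
    cases k with
    | zero => rw [bell, bellInv, Real.exp_log h]
    | succ k =>
      rw [bell_succ_eq, ih 0 (Nat.succ_pos k)]
      have h1 : ∀ l : Fin k, bell (bellInv μ) (l + 1) = μ (l + 1) := fun l => ih _ (by omega)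
      simp only [h1]
      rw [bellInv]
      have h2 : (k.factorial : ℝ) ≠ 0 := by exact_mod_cast k.factorial_ne_zero
      field_simp
      ring

theorem bellInv_bell (τ : ℕ → ℝ) : bellInv (bell τ) = τ := by
  funext k
  induction k using Nat.strong_induction_on with
  | _ k ih =>
    cases k with
    | zero => rw [bellInv, bell, Real.log_exp]
    | succ k =>
      rw [bellInv, bell_succ_eq]
      have h1 : ∀ l : Fin k, bellInv (bell τ) (k - l) = τ (k - l) := fun l => ih _ (by omega)
      simp only [h1]
      have h2 : (k.factorial : ℝ) ≠ 0 := by exact_mod_cast k.factorial_ne_zero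
      have h3 := (bell_pos_zero τ).ne'
      field_simp
      ring

/-- `B` sends the Thorin moments of `K` to the derivatives of `M = exp ∘ K` at the same point. -/
theorem iteratedDeriv_exp_comp {K : ℝ → ℝ} {a : ℝ} (hK : ContDiffAt ℝ (⊤ : ℕ∞) K a) (k : ℕ) :
    iteratedDeriv k (fun t => Real.exp (K t)) a =
      bell (fun j => iteratedDeriv j K a / ((j - 1).factorial : ℝ)) k := by
  have hE : ContDiffAt ℝ (⊤ : ℕ∞) (fun t => Real.exp (K t)) a := hK.exp
  have hK' : ContDiffAt ℝ (⊤ : ℕ∞) (deriv K) a :=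
    ((hK.fderiv_right (m := (⊤ : ℕ∞)) (by simp)).clm_apply contDiffAt_const :
      ContDiffAt ℝ (⊤ : ℕ∞) (fun t => fderiv ℝ K t 1) a)
  have hder : deriv (fun t => Real.exp (K t)) =ᶠ[𝓝 a]
      fun t => Real.exp (K t) * deriv K t := by
    have h1 : ContDiffAt ℝ 1 K a := hK.of_le (by exact_mod_cast le_top)
    filter_upwards [h1.eventually (by simp)] with t ht
    exact (ht.differentiableAt (by simp)).hasDerivAt.exp.deriv
  induction k using Nat.strong_induction_on with
  | _ k ih =>
    cases k with
    | zero => simp [bell]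
    | succ k =>
      rw [iteratedDeriv_succ', hder.iteratedDeriv_eq,
        iteratedDeriv_fun_mul (hE.of_le (by exact_mod_cast le_top))
          (hK'.of_le (by exact_mod_cast le_top)), bell, Finset.sum_range]
      refine Finset.sum_congr rfl fun l _ => ?_
      have hl : (l : ℕ) < k + 1 := l.2
      have e1 : k + 1 - (l : ℕ) = (k - l) + 1 := by omega
      have h2 : ((k - (l : ℕ)).factorial : ℝ) ≠ 0 := by
        exact_mod_cast (k - (l : ℕ)).factorial_ne_zero
      rw [ih l hl, e1, ← iteratedDeriv_succ', Nat.add_sub_cancel]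
      field_simp

/-- The `k`-th Thorin moment `K^(k)(-1) / (k-1)!` of the one-dimensional generalized Gamma convolution
with Thorin measure `ν`. -/
def thorinMoment (ν : Measure ℝ) (k : ℕ) : ℝ :=
  iteratedDeriv k (fun t : ℝ => -∫ s, Real.log (1 - t * s) ∂ν) (-1) / ((k - 1).factorial : ℝ)

/-- Monte-Carlo estimator of the `k`-th shifted moment from the sample `x 0, …, x (N-1)`. -/
def empShiftedMoment (N : ℕ) (x : ℕ → ℝ) (k : ℕ) : ℝ :=
  (1 / (N : ℝ)) * ∑ i ∈ Finset.range N, x i ^ k * Real.exp (-x i)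

/-- Monte-Carlo estimator `B⁻¹` of the empirical shifted moments, of the `k`-th Thorin moment. -/
def empThorinMoment (N : ℕ) (x : ℕ → ℝ) : ℕ → ℝ := bellInv (empShiftedMoment N x)

/-! ### The losses -/

/-- The matrix `A` that sends the shifted moments of order at most `m` to the first `m + 1` coefficients
in the Laguerre basis `φ_k(x) = √2 ∑_{j ≤ k} binom(k,j) (-2x)^j / j! e^{-x}`. -/
def laguerreMatrix (m : ℕ) : Matrix (Fin (m + 1)) (Fin (m + 1)) ℝ :=
  Matrix.of fun k j =>
    √2 * ((k : ℕ).choose j : ℝ) * (-2) ^ (j : ℕ) / ((j : ℕ).factorial : ℝ)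

/-- Extension of a finite family by zero. -/
def extendZero {m : ℕ} (τ : Fin (m + 1) → ℝ) (j : ℕ) : ℝ :=
  if h : j < m + 1 then τ ⟨j, h⟩ else 0

/-- The function `τ ↦ A B(τ)`; `bell τ k` only involves `τ 0, …, τ k`. -/
def laguerreOfThorin (m : ℕ) (τ : Fin (m + 1) → ℝ) : Fin (m + 1) → ℝ :=
  laguerreMatrix m *ᵥ fun k => bell (extendZero τ) k

/-- The univariate linearized Laguerre loss `‖∇ (τ̂ - τ(ν))‖²`, with the Jacobian `∇` of `A B` at `τ̂`. -/
def linearizedLoss (m N : ℕ) (x : ℕ → ℝ) (ν : Measure ℝ) : ℝ :=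
  let τhat : Fin (m + 1) → ℝ := fun k => empThorinMoment N x k
  ∑ k, (fderiv ℝ (laguerreOfThorin m) τhat (fun j => τhat j - thorinMoment ν j) k) ^ 2

/-- The random-projection loss, from the sample `x 0, …, x (N-1)` in `ℝ^d`. -/
def projectionLoss {d : ℕ} (m N : ℕ) (x : ℕ → Fin d → ℝ) (ν : Measure (Fin d → ℝ)) : ℝ :=
  ∫ c in Set.Icc (0 : Fin d → ℝ) 1,
    linearizedLoss m N (fun i => c ⬝ᵥ x i) (ν.map fun s => c ⬝ᵥ s)

/-- `ν` minimizes the random-projection loss over the well-behaved Thorin measures. -/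
def IsProjectionMinimizer {d : ℕ} (m N : ℕ) (x : ℕ → Fin d → ℝ) (ν : Measure (Fin d → ℝ)) : Prop :=
  WellBehaved ν ∧ ∀ ν' : Measure (Fin d → ℝ), WellBehaved ν' →
    projectionLoss m N x ν ≤ projectionLoss m N x ν'

end GammaConv

end

/-!
# Consistency of the random-projection Laguerre loss

Write `L_ν(c) = ∫ log (1 + ⟨c, s⟩) ν(ds)` for the negated cumulant generating function of the generalized
Gamma convolution at `-c`. The proof has three parts, and works for every order `m`.

*The loss controls `L_ν` on the cube.* The zeroth Laguerre coefficient is `√2 e ^ τ₀`, so that the first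
row of the Jacobian alone bounds the integrand of the loss from below by `2 μ̂₀² (log μ̂₀ + L_ν(c))²`
(`le_projLoss`). The empirical moments converge to the true ones simultaneously for all projections
(`ae_tendsto_empShiftedMoment`, the strong law in a space of continuous functions) and `B⁻¹` is continuous, so
that the loss of the true measure tends to zero (`tendsto_projectionLoss`). The loss of a minimizer `ν` is
no larger, whence `∫ (L_ν - L_ν₀)² → 0` over the unit cube (`integral_logLaplace_sub_sq_le`).

*Convergence of `L` implies convergence of the characteristic functions.* By monotonicity, almost everywhere
convergence of `L_{ν_j}` on the cube is convergence at every interior point `c`. Expanding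
`L(c + v) - L(c)` in powers of `v` shows that the moments of the images of the `ν_j` under the projective
map `s ↦ s / (1 + ⟨c, s⟩)` (`proj`) into a simplex converge; by the Stone-Weierstrass theorem those images
converge weakly away from the origin (`tendsto_sum_of_abs_le_sq`). Since
`log (1 + ⟨c, s⟩ - i⟨t, s⟩) = log (1 + ⟨c, s⟩) + log (1 - i⟨t, p⟩)` with `p = s / (1 + ⟨c, s⟩)`, and the
part of the last logarithm of first order in `p` is a moment, the integrals of the left side converge; letting `c → 0`
gives the pointwise convergence of the characteristic exponents (`tendsto_charExponent`).

*Convergence of the characteristic functions in `L²`.* Since `f` is square integrable, so is its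
characteristic function, whose squared modulus is `∏ (1 + ⟨t, s_i⟩²) ^ (-α_i)`. Integrability forces, for every
proper subspace `V`, the mass of the atoms outside `V` to exceed half the codimension of `V`
(`codim_lt_of_lintegral_exp_ne_top`). Conversely, let this condition hold with a factor `κ > 1` to spare. For
each `t` a basis `b` of minimal total `log (1 + ⟨t, b k⟩²)` chosen among the atoms bounds the product by
`∏ (1 + ⟨t, b k⟩²) ^ (-κ / 2)` (`exists_linearIndependent_mul_sum_le`), and there are only finitely many bases,
each giving an integrable function. This is stable under spreading the atoms over small neighbourhoods, and bounds
the tails uniformly over all measures with nearly as much mass near the atoms of `ν₀`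
(`exists_nhds_lintegral_exp_le`). As no mass near those atoms is lost in the limit
(`eventually_le_sum_indicator`), the tails are uniformly small, and the densities converge in `L²` by Plancherel's theorem (`tendsto_eLpNorm_sub_density`).
-/

noncomputable section

namespace GammaConv

/-! ### Finitely atomic Thorin measures -/

/-- A finitely atomic measure `∑ i, α i • δ_{s i}` on the closed nonnegative orthant, recorded by its
atoms (repetitions and the origin are allowed). -/
structure Atoms (d : ℕ) where
  n : ℕ
  α : Fin n → ℝ
  s : Fin n → Fin d → ℝ
  α_pos : ∀ i, 0 < α i
  s_nonneg : ∀ i, 0 ≤ s i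

namespace Atoms

variable {d : ℕ} {E : Type*} [NormedAddCommGroup E] [NormedSpace ℝ E]

/-- The integral of `F` against the atomic measure. -/
def sum (ν : Atoms d) (F : (Fin d → ℝ) → E) : E := ∑ i, ν.α i • F (ν.s i)

/-- The measure with the given atoms. -/
def toMeasure (ν : Atoms d) : Measure (Fin d → ℝ) :=
  ∑ i, ENNReal.ofReal (ν.α i) • Measure.dirac (ν.s i)

theorem integrable_toMeasure {E : Type*} [NormedAddCommGroup E] (ν : Atoms d)
    (F : (Fin d → ℝ) → E) : Integrable F ν.toMeasure := by
  rw [toMeasure, integrable_finsetSum_measure]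
  intro i _
  exact (integrable_dirac (by simp)).smul_measure ENNReal.ofReal_ne_top

theorem integral_toMeasure [CompleteSpace E] (ν : Atoms d) (F : (Fin d → ℝ) → E) :
    ∫ x, F x ∂ν.toMeasure = ν.sum F := by
  rw [toMeasure, integral_finsetSum_measure]
  · refine Finset.sum_congr rfl fun i _ => ?_
    rw [integral_smul_measure, integral_dirac, ENNReal.toReal_ofReal (ν.α_pos i).le]
  · intro i _
    exact (integrable_dirac (by simp)).smul_measure ENNReal.ofReal_ne_top

theorem sum_add (ν : Atoms d) (F G : (Fin d → ℝ) → E) :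
    ν.sum (fun x => F x + G x) = ν.sum F + ν.sum G := by
  simp [sum, Finset.sum_add_distrib]

theorem sum_sub (ν : Atoms d) (F G : (Fin d → ℝ) → E) :
    ν.sum (fun x => F x - G x) = ν.sum F - ν.sum G := by
  simp [sum, Finset.sum_sub_distrib, smul_sub]

theorem sum_mul_left (ν : Atoms d) (r : ℝ) (F : (Fin d → ℝ) → ℝ) :
    ν.sum (fun x => r * F x) = r * ν.sum F := by
  simp only [sum, smul_eq_mul, Finset.mul_sum]
  exact Finset.sum_congr rfl fun i _ => by ring

theorem sum_congr (ν : Atoms d) {F G : (Fin d → ℝ) → E} (h : ∀ x, 0 ≤ x → F x = G x) :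
    ν.sum F = ν.sum G :=
  Finset.sum_congr rfl fun i _ => by rw [h _ (ν.s_nonneg i)]

theorem sum_mono (ν : Atoms d) {F G : (Fin d → ℝ) → ℝ} (h : ∀ x, 0 ≤ x → F x ≤ G x) :
    ν.sum F ≤ ν.sum G :=
  Finset.sum_le_sum fun i _ => mul_le_mul_of_nonneg_left (h _ (ν.s_nonneg i)) (ν.α_pos i).le

theorem sum_nonneg (ν : Atoms d) {F : (Fin d → ℝ) → ℝ} (h : ∀ x, 0 ≤ x → 0 ≤ F x) :
    0 ≤ ν.sum F :=
  Finset.sum_nonneg fun i _ => mul_nonneg (ν.α_pos i).le (h _ (ν.s_nonneg i))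

theorem norm_sum_le (ν : Atoms d) (F : (Fin d → ℝ) → E) :
    ‖ν.sum F‖ ≤ ν.sum fun x => ‖F x‖ := by
  refine (_root_.norm_sum_le _ _).trans_eq (Finset.sum_congr rfl fun i _ => ?_)
  rw [norm_smul, Real.norm_of_nonneg (ν.α_pos i).le, smul_eq_mul]

theorem hasSum_sum (ν : Atoms d) {F : ℕ → (Fin d → ℝ) → E} {G : (Fin d → ℝ) → E}
    (h : ∀ x, 0 ≤ x → HasSum (fun k => F k x) (G x)) :
    HasSum (fun k => ν.sum (F k)) (ν.sum G) :=
  _root_.hasSum_sum fun i _ => (h _ (ν.s_nonneg i)).const_smul (ν.α i)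

/-- The negated cumulant generating function on the negative orthant:
`logLaplace ν c = -K(-c) = ∫ log (1 + ⟨c, s⟩) ν(ds)`. -/
def logLaplace (ν : Atoms d) (c : Fin d → ℝ) : ℝ := ν.sum fun s => Real.log (1 + c ⬝ᵥ s)

/-- The negated logarithm `-K(it) = ∫ log (1 - i⟨t, s⟩) ν(ds)` of the characteristic function. -/
def charExponent (ν : Atoms d) (t : Fin d → ℝ) : ℂ :=
  ν.sum fun s => Complex.log (1 - Complex.I * (t ⬝ᵥ s : ℝ))

end Atoms

/-- Of the last condition in the definition of well-behaved measures only the case of all atoms is kept: they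
span the space. -/
theorem WellBehaved.exists_atoms {d : ℕ} {ν : Measure (Fin d → ℝ)} (h : WellBehaved ν) :
    ∃ a : Atoms d, ν = a.toMeasure ∧ (∀ i, a.s i ≠ 0) ∧ Submodule.span ℝ (Set.range a.s) = ⊤ := by
  obtain ⟨n, α, s, hα, hs, hs0, hν, h1, hJ⟩ := h
  refine ⟨⟨n, α, s, hα, hs⟩, hν, hs0, ?_⟩
  have hpos : 0 < ν (⋃ i, ray (s i)) := by
    have hn : 0 < n := by
      rcases Nat.eq_zero_or_pos n with rfl | hn
      · simp at h1; linarith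
      · exact hn
    have : ν (⋃ i, ray (s i)) ≥ ENNReal.ofReal (α ⟨0, hn⟩) := by
      rw [hν, Measure.finsetSum_apply]
      have h2 : s ⟨0, hn⟩ ∈ ⋃ i, ray (s i) := Set.mem_iUnion.2 ⟨⟨0, hn⟩, 1, zero_le_one, by simp⟩
      calc ENNReal.ofReal (α ⟨0, hn⟩)
          = (ENNReal.ofReal (α ⟨0, hn⟩) • Measure.dirac (s ⟨0, hn⟩)) (⋃ i, ray (s i)) := by
            simp [Measure.dirac_apply_of_mem h2]
        _ ≤ _ := Finset.single_le_sum (f := fun i =>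
            (ENNReal.ofReal (α i) • Measure.dirac (s i)) (⋃ i, ray (s i)))
              (fun _ _ => zero_le) (Finset.mem_univ _)
    exact (ENNReal.ofReal_pos.2 (hα _)).trans_le this
  have hker := hJ Finset.univ (by simpa using hpos)
  by_contra hne
  obtain ⟨g, hg, hg0⟩ := Submodule.exists_le_ker_of_lt_top _ (lt_top_iff_ne_top.2 hne)
  let v : Fin d → ℝ := fun j => g fun i => if j = i then 1 else 0
  have hv : ∀ x : Fin d → ℝ, x ⬝ᵥ v = g x := by
    intro x
    rw [LinearMap.pi_apply_eq_sum_univ g x]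
    rfl
  have : v = 0 := hker v fun i _ => by
    rw [hv]
    exact hg0 (Submodule.subset_span ⟨i, rfl⟩)
  refine hg (LinearMap.ext fun x => ?_)
  rw [← hv x, this]; simp

/-! ### Convergence of Laplace exponents almost everywhere and everywhere -/

/-- If power series with uniformly bounded coefficients converge pointwise near `0+`, then so does each
coefficient. -/
theorem tendsto_coeff_of_tendsto_tsum {a : ℕ → ℕ → ℝ} {a₀ : ℕ → ℝ} {C : ℝ}
    (ha : ∀ j k, |a j k| ≤ C) (ha₀ : ∀ k, |a₀ k| ≤ C)
    (h : ∀ᶠ r : ℝ in 𝓝[>] 0, Tendsto (fun j => ∑' k, a j k * r ^ k) atTop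
      (𝓝 (∑' k, a₀ k * r ^ k))) (k : ℕ) :
    Tendsto (fun j => a j k) atTop (𝓝 (a₀ k)) := by
  have hC : 0 ≤ C := (abs_nonneg _).trans (ha₀ 0)
  have hb : ∀ j k, |a j k - a₀ k| ≤ 2 * C := fun j k =>
    (abs_sub _ _).trans (by linarith [ha j k, ha₀ k])
  suffices H : ∀ k, Tendsto (fun j => a j k - a₀ k) atTop (𝓝 0) by
    simpa using (H k).add_const (a₀ k)
  intro k
  induction k using Nat.strong_induction_on with
  | _ k ih =>
    rw [Metric.tendsto_atTop]
    intro ε hε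
    -- after division by `r ^ k`, the terms of order above `k` contribute at most `4 C r`
    have h1 : ∀ᶠ r : ℝ in 𝓝[>] 0, 4 * C * r < ε / 2 := by
      have : Tendsto (fun r : ℝ => 4 * C * r) (𝓝[>] 0) (𝓝 0) :=
        (Continuous.tendsto' (by fun_prop) _ _ (by simp)).mono_left nhdsWithin_le_nhds
      exact this.eventually_lt_const (by positivity)
    have h2 : ∀ᶠ r : ℝ in 𝓝[>] 0, r < 1 / 2 :=
      (tendsto_id.mono_left nhdsWithin_le_nhds).eventually_lt_const (by norm_num)
    obtain ⟨r, hr, hr1, hr2, hr0⟩ := (h.and (h1.and (h2.and self_mem_nhdsWithin))).exists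
    have hr0 : 0 < r := hr0
    have hgeo : Summable fun i : ℕ => r ^ i :=
      summable_geometric_of_lt_one hr0.le (by linarith)
    have hs : ∀ {c : ℕ → ℝ} {K : ℝ}, (∀ i, |c i| ≤ K) → Summable fun i => c i * r ^ i := by
      intro c K hc
      refine Summable.of_norm_bounded (hgeo.mul_left K) fun i => ?_
      rw [norm_mul, Real.norm_eq_abs, norm_pow, Real.norm_of_nonneg hr0.le]
      exact mul_le_mul_of_nonneg_right (hc i) (by positivity)
    have hT : Tendsto (fun j => (∑' i, (a j i - a₀ i) * r ^ i)
        - ∑ i ∈ Finset.range k, (a j i - a₀ i) * r ^ i) atTop (𝓝 0) := by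
      have e1 : (fun j => ∑' i, (a j i - a₀ i) * r ^ i) =
          fun j => (∑' i, a j i * r ^ i) - ∑' i, a₀ i * r ^ i := by
        funext j
        rw [← (hs (ha j)).tsum_sub (hs ha₀)]
        exact tsum_congr fun i => by ring
      have t1 : Tendsto (fun j => ∑' i, (a j i - a₀ i) * r ^ i) atTop (𝓝 0) := by
        rw [e1]; simpa using hr.sub_const (∑' i, a₀ i * r ^ i)
      have t2 : Tendsto (fun j => ∑ i ∈ Finset.range k, (a j i - a₀ i) * r ^ i) atTop (𝓝 0) := by
        have := tendsto_finsetSum (Finset.range k)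
          fun i hi => (ih i (Finset.mem_range.1 hi)).mul_const (r ^ i)
        simpa using this
      simpa using t1.sub t2
    rw [Metric.tendsto_atTop] at hT
    obtain ⟨N, hN⟩ := hT (ε / 2 * r ^ k) (by positivity)
    refine ⟨N, fun j hj => ?_⟩
    have h3 := hN j hj
    rw [Real.dist_0_eq_abs, ← (hs (hb j)).sum_add_tsum_nat_add k, add_sub_cancel_left,
      ((summable_nat_add_iff k).2 (hs (hb j))).tsum_eq_zero_add] at h3
    simp only [zero_add] at h3
    have h4 : |∑' i, (a j (i + 1 + k) - a₀ (i + 1 + k)) * r ^ (i + 1 + k)| ≤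
        2 * C * r ^ (k + 1) * 2 := by
      have hg : HasSum (fun i : ℕ => 2 * C * r ^ (k + 1) * r ^ i)
          (2 * C * r ^ (k + 1) * (1 - r)⁻¹) :=
        (hasSum_geometric_of_lt_one hr0.le (by linarith)).mul_left _
      have := tsum_of_norm_bounded hg (f := fun i => (a j (i + 1 + k) - a₀ (i + 1 + k)) *
        r ^ (i + 1 + k)) fun i => by
          rw [norm_mul, Real.norm_eq_abs, norm_pow, Real.norm_of_nonneg hr0.le]
          calc _ ≤ 2 * C * r ^ (i + 1 + k) := mul_le_mul_of_nonneg_right (hb _ _) (by positivity)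
            _ = _ := by ring
      refine this.trans (mul_le_mul_of_nonneg_left ?_ (by positivity))
      rw [inv_le_comm₀ (by linarith) (by norm_num)]
      linarith
    rw [Real.dist_0_eq_abs]
    have h5 : |a j k - a₀ k| * r ^ k < ε * r ^ k := by
      rw [← abs_of_pos (pow_pos hr0 k), ← abs_mul, abs_of_pos (pow_pos hr0 k)]
      set T := ∑' i, (a j (i + 1 + k) - a₀ (i + 1 + k)) * r ^ (i + 1 + k)
      have h6 : 2 * C * r ^ (k + 1) * 2 ≤ ε / 2 * r ^ k := by
        have : 2 * C * r ^ (k + 1) * 2 = 4 * C * r * r ^ k := by ring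
        rw [this]; exact mul_le_mul_of_nonneg_right hr1.le (by positivity)
      have h7 := abs_sub ((a j k - a₀ k) * r ^ k + T) T
      rw [add_sub_cancel_right] at h7
      linarith
    exact lt_of_mul_lt_mul_right h5 (by positivity)

variable {d : ℕ}

theorem one_add_dotProduct_pos {c s : Fin d → ℝ} (hc : 0 ≤ c) (hs : 0 ≤ s) : 0 < 1 + c ⬝ᵥ s := by
  have := dotProduct_nonneg_of_nonneg hc hs
  linarith

namespace Atoms

theorem logLaplace_mono (ν : Atoms d) {c c' : Fin d → ℝ} (hc : 0 ≤ c) (h : c ≤ c') :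
    ν.logLaplace c ≤ ν.logLaplace c' :=
  ν.sum_mono fun _ hs => Real.log_le_log (one_add_dotProduct_pos hc hs)
    (by linarith [dotProduct_le_dotProduct_of_nonneg_right h hs])

theorem continuousOn_logLaplace (ν : Atoms d) : ContinuousOn ν.logLaplace (Set.Ici 0) := by
  unfold logLaplace sum
  refine continuousOn_finsetSum _ fun i _ => ?_
  simp only [smul_eq_mul]
  refine continuousOn_const.mul (ContinuousOn.log ?_ ?_)
  · exact (Continuous.add continuous_const
      (Continuous.dotProduct continuous_id continuous_const)).continuousOn
  · exact fun c hc => (one_add_dotProduct_pos hc (ν.s_nonneg i)).ne'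

/-- Almost everywhere convergence on the unit cube improves to convergence everywhere inside, the
functions being monotone and the limit continuous. -/
theorem tendsto_logLaplace_of_ae {ν : ℕ → Atoms d} {ν₀ : Atoms d}
    (h : ∀ᵐ c ∂(volume.restrict (Set.Icc (0 : Fin d → ℝ) 1)),
      Tendsto (fun j => (ν j).logLaplace c) atTop (𝓝 (ν₀.logLaplace c)))
    {c : Fin d → ℝ} (hc0 : ∀ i, 0 < c i) (hc1 : ∀ i, c i < 1) :
    Tendsto (fun j => (ν j).logLaplace c) atTop (𝓝 (ν₀.logLaplace c)) := by
  have hcont : ContinuousAt ν₀.logLaplace c :=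
    ν₀.continuousOn_logLaplace.continuousAt (by
      have : Set.Ici (0 : Fin d → ℝ) = Set.univ.pi fun _ => Set.Ici 0 := (Set.pi_univ_Ici 0).symm
      rw [this]
      exact set_pi_mem_nhds Set.finite_univ fun i _ => Ici_mem_nhds (hc0 i))
  -- a nonempty open set has positive volume, hence contains a point of convergence
  have key : ∀ O : Set (Fin d → ℝ), IsOpen O → O.Nonempty → O ⊆ Set.Icc 0 1 →
      ∃ x ∈ O, Tendsto (fun j => (ν j).logLaplace x) atTop (𝓝 (ν₀.logLaplace x)) := by
    intro O hO hne hsub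
    by_contra! hcon
    have h1 : ∀ᵐ x ∂(volume.restrict O), False := by
      filter_upwards [ae_restrict_of_ae_restrict_of_subset hsub h,
        ae_restrict_mem hO.measurableSet] with x hx hxO using hcon x hxO hx
    rw [ae_iff] at h1
    simp only [not_false_eq_true, Set.ofPred_true, Measure.restrict_apply_univ] at h1
    exact (hO.measure_pos volume hne).ne' h1
  have box : ∀ U ∈ 𝓝 c, ∃ η > 0, (∀ i, η < c i) ∧ (∀ i, c i + η < 1) ∧
      ∀ x : Fin d → ℝ, (∀ i, |x i - c i| < η) → x ∈ U := by
    intro U hU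
    obtain ⟨η, hη, hball⟩ := Metric.mem_nhds_iff.1 hU
    have e1 : ∀ᶠ t : ℝ in 𝓝[>] 0, ∀ i, t < c i := eventually_all.2 fun i =>
      (tendsto_id.mono_left nhdsWithin_le_nhds).eventually_lt_const (hc0 i)
    have e2 : ∀ᶠ t : ℝ in 𝓝[>] 0, ∀ i, t < 1 - c i := eventually_all.2 fun i =>
      (tendsto_id.mono_left nhdsWithin_le_nhds).eventually_lt_const (by linarith [hc1 i])
    have e3 : ∀ᶠ t : ℝ in 𝓝[>] 0, t < η :=
      (tendsto_id.mono_left nhdsWithin_le_nhds).eventually_lt_const hη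
    obtain ⟨t, h1, h2, h3, h0⟩ := (e1.and (e2.and (e3.and self_mem_nhdsWithin))).exists
    refine ⟨t, h0, h1, fun i => by linarith [h2 i], fun x hx => hball ?_⟩
    rw [Metric.mem_ball, dist_pi_lt_iff hη]
    exact fun i => (Real.dist_eq _ _).trans_lt ((hx i).trans h3)
  -- compare with points of convergence just below and just above `c`
  refine tendsto_order.2 ⟨fun a ha => ?_, fun a ha => ?_⟩
  · obtain ⟨η, hη, h1, h2, hU⟩ := box _ (hcont.eventually_const_lt ha)
    obtain ⟨x, hx, hxt⟩ := key (Set.univ.pi fun i => Set.Ioo (c i - η) (c i))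
      (isOpen_set_pi Set.finite_univ fun _ _ => isOpen_Ioo)
      (Set.univ_pi_nonempty_iff.2 fun i => Set.nonempty_Ioo.2 (by linarith))
      (fun x hx => ⟨fun i => by
        have := hx i trivial; have := h1 i; simp at *; linarith, fun i => by
        have := hx i trivial; have := hc1 i; simp at *; linarith⟩)
    have hx' : ∀ i, c i - η < x i ∧ x i < c i := fun i => hx i trivial
    have hxa : a < ν₀.logLaplace x := hU x fun i => by
      rw [abs_lt]; constructor <;> linarith [hx' i]
    filter_upwards [hxt.eventually_const_lt hxa] with j hj
    exact hj.trans_le ((ν j).logLaplace_mono (fun i => by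
      have := h1 i; have := hx' i; simp; linarith) fun i => (hx' i).2.le)
  · obtain ⟨η, hη, h1, h2, hU⟩ := box _ (hcont.eventually_lt_const ha)
    obtain ⟨x, hx, hxt⟩ := key (Set.univ.pi fun i => Set.Ioo (c i) (c i + η))
      (isOpen_set_pi Set.finite_univ fun _ _ => isOpen_Ioo)
      (Set.univ_pi_nonempty_iff.2 fun i => Set.nonempty_Ioo.2 (by linarith))
      (fun x hx => ⟨fun i => by
        have := hx i trivial; have := hc0 i; simp at *; linarith, fun i => by
        have := hx i trivial; have := h2 i; simp at *; linarith⟩)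
    have hx' : ∀ i, c i < x i ∧ x i < c i + η := fun i => hx i trivial
    have hxa : ν₀.logLaplace x < a := hU x fun i => by
      rw [abs_lt]; constructor <;> linarith [hx' i]
    filter_upwards [hxt.eventually_lt_const hxa] with j hj
    exact ((ν j).logLaplace_mono (fun i => (hc0 i).le) fun i => (hx' i).1.le).trans_lt hj

end Atoms

/-! ### Convergence of moments in projective coordinates -/

/-- The projective change of coordinates `s ↦ s / (1 + ⟨c, s⟩)`, which maps the orthant into the
compact simplex `{p ≥ 0, ⟨c, p⟩ ≤ 1}`. -/
def proj (c s : Fin d → ℝ) : Fin d → ℝ := (1 + c ⬝ᵥ s)⁻¹ • s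

/-- The compact simplex `{p ≥ 0, ⟨c, p⟩ ≤ 1}`. -/
def simplex (c : Fin d → ℝ) : Set (Fin d → ℝ) := {p | 0 ≤ p ∧ c ⬝ᵥ p ≤ 1}

theorem dotProduct_proj (v c s : Fin d → ℝ) : v ⬝ᵥ proj c s = (v ⬝ᵥ s) / (1 + c ⬝ᵥ s) := by
  rw [proj, dotProduct_smul, smul_eq_mul, inv_mul_eq_div]

theorem proj_mem_simplex {c s : Fin d → ℝ} (hc : 0 ≤ c) (hs : 0 ≤ s) : proj c s ∈ simplex c := by
  have h := one_add_dotProduct_pos hc hs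
  refine ⟨smul_nonneg (inv_nonneg.2 h.le) hs, ?_⟩
  rw [dotProduct_proj, div_le_one h]
  linarith

theorem isCompact_simplex {c : Fin d → ℝ} (hc : ∀ i, 0 < c i) : IsCompact (simplex c) := by
  refine Metric.isCompact_of_isClosed_isBounded ?_ ?_
  · exact isClosed_Ici.inter (isClosed_le
      (Continuous.dotProduct continuous_const continuous_id) continuous_const)
  · refine (Metric.isBounded_Icc (0 : Fin d → ℝ) fun i => (c i)⁻¹).subset fun p hp => ⟨hp.1, fun i => ?_⟩
    have h1 : c i * p i ≤ c ⬝ᵥ p := Finset.single_le_sum (f := fun i => c i * p i)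
      (fun i _ => mul_nonneg (hc i).le (hp.1 i)) (Finset.mem_univ i)
    change p i ≤ (c i)⁻¹
    rw [← one_div, le_div_iff₀' (hc i)]
    exact h1.trans hp.2

/-- Every linear form is dominated by a multiple of `⟨c, ·⟩` on the orthant. -/
theorem exists_abs_dotProduct_le {c : Fin d → ℝ} (hc : ∀ i, 0 < c i) (v : Fin d → ℝ) :
    ∃ K : ℝ, 0 < K ∧ (∀ i, |v i| ≤ K * c i) ∧ ∀ p : Fin d → ℝ, 0 ≤ p → |v ⬝ᵥ p| ≤ K * (c ⬝ᵥ p) := by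
  have h1 : ∀ i, |v i| ≤ (1 + ∑ j, |v j| / c j) * c i := by
    intro i
    have h2 : |v i| / c i ≤ ∑ j, |v j| / c j := Finset.single_le_sum
      (f := fun j => |v j| / c j) (fun j _ => div_nonneg (abs_nonneg _) (hc j).le) (Finset.mem_univ i)
    rw [div_le_iff₀ (hc i)] at h2
    nlinarith [hc i]
  refine ⟨1 + ∑ j, |v j| / c j, ?_, h1, fun p hp => ?_⟩
  · have : 0 ≤ ∑ j, |v j| / c j := Finset.sum_nonneg fun j _ => div_nonneg (abs_nonneg _) (hc j).le
    linarith
  · rw [dotProduct, dotProduct, Finset.mul_sum]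
    refine (Finset.abs_sum_le_sum_abs _ _).trans (Finset.sum_le_sum fun i _ => ?_)
    rw [abs_mul, abs_of_nonneg (hp i), ← mul_assoc]
    exact mul_le_mul_of_nonneg_right (h1 i) (hp i)

namespace Atoms

variable {ν : ℕ → Atoms d} {ν₀ : Atoms d}

theorem sum_dotProduct_proj_le (μ : Atoms d) {c : Fin d → ℝ} (hc : 0 ≤ c) :
    μ.sum (fun s => c ⬝ᵥ proj c s) ≤ μ.logLaplace c := by
  refine μ.sum_mono fun s hs => ?_
  have h := one_add_dotProduct_pos hc hs
  rw [dotProduct_proj]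
  have := Real.one_sub_inv_le_log_of_pos h
  refine le_trans (le_of_eq ?_) this
  field_simp
  ring

theorem exists_sum_dotProduct_proj_le {c : Fin d → ℝ} (hc : 0 ≤ c)
    (h : Tendsto (fun j => (ν j).logLaplace c) atTop (𝓝 (ν₀.logLaplace c))) :
    ∃ C : ℝ, (∀ j, (ν j).sum (fun s => c ⬝ᵥ proj c s) ≤ C) ∧
      ν₀.sum (fun s => c ⬝ᵥ proj c s) ≤ C := by
  obtain ⟨C, hC⟩ := h.bddAbove_range
  refine ⟨max C (ν₀.logLaplace c), fun j => ?_, ?_⟩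
  · exact ((ν j).sum_dotProduct_proj_le hc).trans ((hC ⟨j, rfl⟩).trans (le_max_left _ _))
  · exact (ν₀.sum_dotProduct_proj_le hc).trans (le_max_right _ _)

/-- The integrals of the powers `⟨v, p⟩ ^ k`, `k ≥ 1`, of a linear form in the coordinates `p = proj c s` are,
up to constants, the Taylor coefficients of the Laplace exponent at `c` in the direction `v`, because
`1 + ⟨c + r v, s⟩ = (1 + ⟨c, s⟩) (1 + r ⟨v, p⟩)`. -/
theorem tendsto_sum_pow_of_abs_le {c v : Fin d → ℝ} (hc0 : ∀ i, 0 < c i) (hc1 : ∀ i, c i < 1)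
    (hv : ∀ i, |v i| ≤ c i)
    (h : ∀ c : Fin d → ℝ, (∀ i, 0 < c i) → (∀ i, c i < 1) →
      Tendsto (fun j => (ν j).logLaplace c) atTop (𝓝 (ν₀.logLaplace c))) (k : ℕ) :
    Tendsto (fun j => (ν j).sum fun s => (v ⬝ᵥ proj c s) ^ (k + 1)) atTop
      (𝓝 (ν₀.sum fun s => (v ⬝ᵥ proj c s) ^ (k + 1))) := by
  have hc : 0 ≤ c := fun i => (hc0 i).le
  have hvp : ∀ s : Fin d → ℝ, 0 ≤ s → |v ⬝ᵥ proj c s| ≤ c ⬝ᵥ proj c s := by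
    intro s hs
    rw [dotProduct, dotProduct]
    refine (Finset.abs_sum_le_sum_abs _ _).trans (Finset.sum_le_sum fun i _ => ?_)
    rw [abs_mul, abs_of_nonneg ((proj_mem_simplex hc hs).1 i)]
    exact mul_le_mul_of_nonneg_right (hv i) ((proj_mem_simplex hc hs).1 i)
  have hvp1 : ∀ s : Fin d → ℝ, 0 ≤ s → |v ⬝ᵥ proj c s| ≤ 1 := fun s hs =>
    (hvp s hs).trans (proj_mem_simplex hc hs).2
  obtain ⟨C, hC, hC₀⟩ := exists_sum_dotProduct_proj_le hc (h c hc0 hc1)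
  let a : Atoms d → ℕ → ℝ := fun μ k =>
    μ.sum fun s => (-1) ^ k / ((k : ℝ) + 1) * (v ⬝ᵥ proj c s) ^ (k + 1)
  have ha : ∀ (μ : Atoms d) (k), |a μ k| ≤ μ.sum fun s => c ⬝ᵥ proj c s := by
    intro μ k
    refine (μ.norm_sum_le (E := ℝ) _).trans (μ.sum_mono fun s hs => ?_)
    rw [norm_mul, norm_div, norm_pow, norm_neg, norm_one, one_pow, Real.norm_eq_abs, Real.norm_eq_abs,
      abs_pow, abs_of_nonneg (by positivity : (0 : ℝ) ≤ (k : ℝ) + 1), pow_succ]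
    have h1 : 1 / ((k : ℝ) + 1) ≤ 1 := by
      rw [div_le_one (by positivity)]; linarith [(Nat.cast_nonneg k : (0 : ℝ) ≤ k)]
    have h2 : |v ⬝ᵥ proj c s| ^ k ≤ 1 := pow_le_one₀ (abs_nonneg _) (hvp1 s hs)
    calc _ ≤ 1 * (1 * |v ⬝ᵥ proj c s|) := by gcongr
      _ ≤ _ := by simpa using hvp s hs
  have hexp : ∀ (μ : Atoms d) (r : ℝ), 0 < r → r < 1 →
      ∑' k, a μ k * r ^ k = (μ.logLaplace (c + r • v) - μ.logLaplace c) / r := by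
    intro μ r hr0 hr1
    have h1 : ∀ s : Fin d → ℝ, 0 ≤ s → HasSum
        (fun k : ℕ => (-1) ^ k / ((k : ℝ) + 1) * (v ⬝ᵥ proj c s) ^ (k + 1) * r ^ (k + 1))
        (Real.log (1 + (c + r • v) ⬝ᵥ s) - Real.log (1 + c ⬝ᵥ s)) := by
      intro s hs
      have hp := one_add_dotProduct_pos hc hs
      have hlt : |-(r * (v ⬝ᵥ proj c s))| < 1 := by
        rw [abs_neg, abs_mul, abs_of_pos hr0]
        calc r * |v ⬝ᵥ proj c s| ≤ r * 1 := mul_le_mul_of_nonneg_left (hvp1 s hs) hr0.le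
          _ < 1 := by linarith
      have h2 := (Real.hasSum_pow_div_log_of_abs_lt_one hlt).neg
      have e1 : Real.log (1 + (c + r • v) ⬝ᵥ s) - Real.log (1 + c ⬝ᵥ s) =
          - -Real.log (1 - -(r * (v ⬝ᵥ proj c s))) := by
        have h3 : 0 < 1 + r * (v ⬝ᵥ proj c s) := by
          have := (abs_lt.1 hlt).2; linarith
        have h4 : 1 + (c + r • v) ⬝ᵥ s = (1 + c ⬝ᵥ s) * (1 + r * (v ⬝ᵥ proj c s)) := by
          rw [dotProduct_proj, add_dotProduct, smul_dotProduct, smul_eq_mul]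
          field_simp
          ring
        rw [h4, Real.log_mul hp.ne' h3.ne']
        ring_nf
      rw [e1]
      refine h2.congr_fun ?_
      intro k
      rw [neg_pow (r * (v ⬝ᵥ proj c s)), pow_succ (-1 : ℝ) k, mul_pow]
      ring
    have h2 := μ.hasSum_sum h1
    have h3 : ∀ k : ℕ, (μ.sum fun s => (-1) ^ k / ((k : ℝ) + 1) * (v ⬝ᵥ proj c s) ^ (k + 1)
        * r ^ (k + 1)) / r = a μ k * r ^ k := by
      intro k
      have : (μ.sum fun s => (-1) ^ k / ((k : ℝ) + 1) * (v ⬝ᵥ proj c s) ^ (k + 1) * r ^ (k + 1)) =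
          r ^ (k + 1) * a μ k := by
        rw [← μ.sum_mul_left]
        congr 1; funext s; ring
      rw [this, pow_succ]
      field_simp
    have h4 := h2.div_const r
    simp only [h3] at h4
    rw [h4.tsum_eq]
    congr 1
    exact μ.sum_sub _ _
  have hlim := tendsto_coeff_of_tendsto_tsum (a := fun j => a (ν j)) (a₀ := a ν₀) (C := C)
    (fun j k => (ha _ k).trans (hC j)) (fun k => (ha _ k).trans hC₀) ?_ k
  · have h1 := hlim.const_mul ((-1) ^ k * ((k : ℝ) + 1))
    have h2 : ∀ μ : Atoms d, (-1) ^ k * ((k : ℝ) + 1) * a μ k =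
        μ.sum fun s => (v ⬝ᵥ proj c s) ^ (k + 1) := by
      intro μ
      rw [← μ.sum_mul_left]
      congr 1; funext s
      have h3 : ((-1 : ℝ) ^ k) * (-1) ^ k = 1 := by rw [← mul_pow]; simp
      have h4 : (k : ℝ) + 1 ≠ 0 := by positivity
      calc _ = ((-1 : ℝ) ^ k * (-1) ^ k) * (((k : ℝ) + 1) / (k + 1)) * (v ⬝ᵥ proj c s) ^ (k + 1) := by
            ring
        _ = _ := by rw [h3, div_self h4]; ring
    simpa only [h2] using h1
  · have e1 : ∀ᶠ r : ℝ in 𝓝[>] 0, r < 1 :=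
      (tendsto_id.mono_left nhdsWithin_le_nhds).eventually_lt_const (by norm_num)
    have e2 : ∀ᶠ r : ℝ in 𝓝[>] 0, ∀ i, c i + r * v i < 1 := eventually_all.2 fun i => by
      have : Tendsto (fun r : ℝ => c i + r * v i) (𝓝[>] 0) (𝓝 (c i)) :=
        (Continuous.tendsto' (by fun_prop) _ _ (by simp)).mono_left nhdsWithin_le_nhds
      exact this.eventually_lt_const (hc1 i)
    filter_upwards [e1, e2, self_mem_nhdsWithin] with r hr1 hr2 hr0
    have hr0 : 0 < r := hr0
    simp only [hexp _ r hr0 hr1]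
    refine ((h _ (fun i => ?_) fun i => ?_).sub (h c hc0 hc1)).div_const r
    · have h1 := (abs_le.1 (hv i)).1
      simp only [Pi.add_apply, Pi.smul_apply, smul_eq_mul]
      nlinarith [hc0 i, mul_le_mul_of_nonneg_left h1 hr0.le]
    · simpa using hr2 i

theorem tendsto_sum_pow {c : Fin d → ℝ} (hc0 : ∀ i, 0 < c i) (hc1 : ∀ i, c i < 1)
    (h : ∀ c : Fin d → ℝ, (∀ i, 0 < c i) → (∀ i, c i < 1) →
      Tendsto (fun j => (ν j).logLaplace c) atTop (𝓝 (ν₀.logLaplace c))) (v : Fin d → ℝ) (k : ℕ) :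
    Tendsto (fun j => (ν j).sum fun s => (v ⬝ᵥ proj c s) ^ (k + 1)) atTop
      (𝓝 (ν₀.sum fun s => (v ⬝ᵥ proj c s) ^ (k + 1))) := by
  obtain ⟨K, hK, hKv, -⟩ := exists_abs_dotProduct_le hc0 v
  have h1 := (tendsto_sum_pow_of_abs_le (v := K⁻¹ • v) hc0 hc1 (fun i => by
    rw [Pi.smul_apply, smul_eq_mul, abs_mul, abs_of_pos (inv_pos.2 hK), inv_mul_le_iff₀ hK]
    exact hKv i) h k).const_mul (K ^ (k + 1))
  have h2 : ∀ μ : Atoms d, K ^ (k + 1) * (μ.sum fun s => ((K⁻¹ • v) ⬝ᵥ proj c s) ^ (k + 1)) =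
      μ.sum fun s => (v ⬝ᵥ proj c s) ^ (k + 1) := by
    intro μ
    rw [← μ.sum_mul_left]
    congr 1; funext s
    rw [smul_dotProduct, smul_eq_mul, ← mul_pow, ← mul_assoc, mul_inv_cancel₀ hK.ne', one_mul]
  simpa only [h2] using h1

theorem tendsto_sum_exp_sub_one {c : Fin d → ℝ} (hc0 : ∀ i, 0 < c i) (hc1 : ∀ i, c i < 1)
    (h : ∀ c : Fin d → ℝ, (∀ i, 0 < c i) → (∀ i, c i < 1) →
      Tendsto (fun j => (ν j).logLaplace c) atTop (𝓝 (ν₀.logLaplace c))) (v : Fin d → ℝ) :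
    Tendsto (fun j => (ν j).sum fun s => Real.exp (v ⬝ᵥ proj c s) - 1) atTop
      (𝓝 (ν₀.sum fun s => Real.exp (v ⬝ᵥ proj c s) - 1)) := by
  have hc : 0 ≤ c := fun i => (hc0 i).le
  obtain ⟨K, hK, hKv, hKp⟩ := exists_abs_dotProduct_le hc0 v
  obtain ⟨C, hC, hC₀⟩ := exists_sum_dotProduct_proj_le hc (h c hc0 hc1)
  have hser : ∀ x : ℝ, HasSum (fun k : ℕ => ((k + 1).factorial : ℝ)⁻¹ * x ^ (k + 1))
      (Real.exp x - 1) := by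
    intro x
    have h1 : HasSum (fun k : ℕ => x ^ k / (k.factorial : ℝ)) (Real.exp x) := by
      rw [Real.exp_eq_exp_ℝ]; exact NormedSpace.expSeries_div_hasSum_exp x
    have h2 := (hasSum_nat_add_iff' 1).2 h1
    simp only [Finset.sum_range_one, pow_zero, Nat.factorial_zero, Nat.cast_one, div_one] at h2
    refine h2.congr_fun ?_
    intro k; rw [div_eq_inv_mul]
  have hμ : ∀ μ : Atoms d, (μ.sum fun s => Real.exp (v ⬝ᵥ proj c s) - 1) =
      ∑' k : ℕ, ((k + 1).factorial : ℝ)⁻¹ * μ.sum fun s => (v ⬝ᵥ proj c s) ^ (k + 1) := by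
    intro μ
    rw [← (μ.hasSum_sum fun s _ => hser (v ⬝ᵥ proj c s)).tsum_eq]
    exact tsum_congr fun k => μ.sum_mul_left _ _
  simp only [hμ]
  refine tendsto_tsum_of_dominated_convergence
    (bound := fun k : ℕ => (((k + 1).factorial : ℝ)⁻¹ * K ^ (k + 1)) * C)
    ((hser K).summable.mul_right C)
    (fun k => (tendsto_sum_pow hc0 hc1 h v k).const_mul _) (Eventually.of_forall fun j k => ?_)
  rw [norm_mul, Real.norm_of_nonneg (by positivity), mul_assoc]
  refine mul_le_mul_of_nonneg_left ?_ (by positivity)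
  calc _ ≤ (ν j).sum (fun s => ‖(v ⬝ᵥ proj c s) ^ (k + 1)‖) := (ν j).norm_sum_le _
    _ ≤ (ν j).sum (fun s => K ^ (k + 1) * (c ⬝ᵥ proj c s)) := by
        refine (ν j).sum_mono fun s hs => ?_
        have hp := proj_mem_simplex hc hs
        have h0 : 0 ≤ c ⬝ᵥ proj c s := dotProduct_nonneg_of_nonneg hc hp.1
        rw [norm_pow, Real.norm_eq_abs]
        calc |v ⬝ᵥ proj c s| ^ (k + 1) ≤ (K * (c ⬝ᵥ proj c s)) ^ (k + 1) := by
              gcongr; exact hKp _ hp.1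
          _ = K ^ (k + 1) * ((c ⬝ᵥ proj c s) ^ k * (c ⬝ᵥ proj c s)) := by ring
          _ ≤ K ^ (k + 1) * (1 * (c ⬝ᵥ proj c s)) := by
              gcongr; exact pow_le_one₀ h0 hp.2
          _ = _ := by ring
    _ = K ^ (k + 1) * (ν j).sum (fun s => c ⬝ᵥ proj c s) := (ν j).sum_mul_left _ _
    _ ≤ _ := mul_le_mul_of_nonneg_left (hC j) (by positivity)

end Atoms

/-! ### Weak convergence in projective coordinates -/

/-- The restriction of `p ↦ exp ⟨v, p⟩` to the simplex. -/
def expMap (c v : Fin d → ℝ) : C(simplex c, ℝ) :=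
  ⟨fun p => Real.exp (v ⬝ᵥ p.1), by
    exact Real.continuous_exp.comp
      (Continuous.dotProduct continuous_const continuous_subtype_val)⟩

/-- Exponentials `p ↦ exp ⟨v, p⟩` span a dense subspace of the continuous functions on the simplex. -/
theorem exists_span_expMap_norm_sub_lt {c : Fin d → ℝ} (hc : ∀ i, 0 < c i) (g : C(simplex c, ℝ))
    {ε : ℝ} (hε : 0 < ε) :
    ∃ f ∈ Submodule.span ℝ (Set.range (expMap c)), ∀ p, |f p - g p| < ε := by
  have : CompactSpace (simplex c) := isCompact_iff_compactSpace.1 (isCompact_simplex hc)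
  let S : Submonoid C(simplex c, ℝ) :=
    { carrier := Set.range (expMap c)
      mul_mem' := by
        rintro _ _ ⟨u, rfl⟩ ⟨v, rfl⟩
        refine ⟨u + v, ?_⟩
        ext p
        simp [expMap, add_dotProduct, Real.exp_add]
      one_mem' := ⟨0, by ext p; simp [expMap]⟩ }
  have hsep : (Algebra.adjoin ℝ (Set.range (expMap c))).SeparatesPoints := by
    intro p q hpq
    have : ∃ i, p.1 i ≠ q.1 i := by
      by_contra! hcon
      exact hpq (Subtype.ext (funext hcon))
    obtain ⟨i, hi⟩ := this
    refine ⟨expMap c (Pi.single i 1), ⟨_, Algebra.subset_adjoin ⟨_, rfl⟩, rfl⟩, ?_⟩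
    simpa [expMap] using hi
  obtain ⟨⟨f, hf⟩, hfg⟩ :=
    ContinuousMap.exists_mem_subalgebra_near_continuousMap_of_separatesPoints _ hsep g ε hε
  refine ⟨f, ?_, fun p => ?_⟩
  · have h1 : f ∈ Subalgebra.toSubmodule (Algebra.adjoin ℝ (Set.range (expMap c))) := hf
    rw [Algebra.adjoin_eq_span] at h1
    have h2 : (Submonoid.closure (Set.range (expMap c)) : Set C(simplex c, ℝ)) =
        Set.range (expMap c) := by
      have : Submonoid.closure (S : Set C(simplex c, ℝ)) = S := Submonoid.closure_eq S
      exact congrArg (fun T : Submonoid C(simplex c, ℝ) => (T : Set C(simplex c, ℝ))) this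
    rwa [h2] at h1
  · exact (ContinuousMap.norm_coe_le_norm (f - g) p).trans_lt hfg

namespace Atoms

variable {ν : ℕ → Atoms d} {ν₀ : Atoms d}

/-- Weak convergence, with the weight `1 - exp (-⟨c, p⟩)`, which makes the measures finite near `0`. -/
theorem tendsto_sum_continuous_mul {c : Fin d → ℝ} (hc0 : ∀ i, 0 < c i) (hc1 : ∀ i, c i < 1)
    (h : ∀ c : Fin d → ℝ, (∀ i, 0 < c i) → (∀ i, c i < 1) →
      Tendsto (fun j => (ν j).logLaplace c) atTop (𝓝 (ν₀.logLaplace c)))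
    {g : (Fin d → ℝ) → ℝ} (hg : ContinuousOn g (simplex c)) :
    Tendsto (fun j => (ν j).sum fun s => g (proj c s) * (1 - Real.exp (-(c ⬝ᵥ proj c s)))) atTop
      (𝓝 (ν₀.sum fun s => g (proj c s) * (1 - Real.exp (-(c ⬝ᵥ proj c s))))) := by
  have hc : 0 ≤ c := fun i => (hc0 i).le
  obtain ⟨C, hC, hC₀⟩ := exists_sum_dotProduct_proj_le hc (h c hc0 hc1)
  classical
  -- extension of functions on the simplex to the points `proj c s`
  let T : C(simplex c, ℝ) → (Fin d → ℝ) → ℝ := fun f s =>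
    if hs : 0 ≤ s then f ⟨proj c s, proj_mem_simplex hc hs⟩ else 0
  let q : (Fin d → ℝ) → ℝ := fun s => 1 - Real.exp (-(c ⬝ᵥ proj c s))
  have hq : ∀ s, 0 ≤ s → 0 ≤ q s ∧ q s ≤ c ⬝ᵥ proj c s := fun s hs => by
    have h0 := dotProduct_nonneg_of_nonneg hc (proj_mem_simplex hc hs).1
    have h1 := Real.add_one_le_exp (-(c ⬝ᵥ proj c s))
    have h2 : Real.exp (-(c ⬝ᵥ proj c s)) ≤ 1 := Real.exp_le_one_iff.2 (by linarith)
    constructor <;> simp only [q] <;> linarith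
  have hspan : ∀ f ∈ Submodule.span ℝ (Set.range (expMap c)),
      Tendsto (fun j => (ν j).sum fun s => T f s * q s) atTop (𝓝 (ν₀.sum fun s => T f s * q s)) := by
    intro f hf
    induction hf using Submodule.span_induction with
    | mem x hx =>
      obtain ⟨u, rfl⟩ := hx
      -- `exp ⟨u, p⟩ * (1 - exp (-⟨c, p⟩))` is a difference of two exponentials
      have h1 := (tendsto_sum_exp_sub_one hc0 hc1 h u).sub
        (tendsto_sum_exp_sub_one hc0 hc1 h (u - c))
      have h2 : ∀ μ : Atoms d, (μ.sum fun s => Real.exp (u ⬝ᵥ proj c s) - 1) -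
          (μ.sum fun s => Real.exp ((u - c) ⬝ᵥ proj c s) - 1) =
          μ.sum fun s => T (expMap c u) s * q s := by
        intro μ
        rw [← μ.sum_sub]
        refine μ.sum_congr fun s hs => ?_
        have h3 : Real.exp ((u - c) ⬝ᵥ proj c s) =
            Real.exp (u ⬝ᵥ proj c s) * Real.exp (-(c ⬝ᵥ proj c s)) := by
          rw [sub_dotProduct, sub_eq_add_neg, Real.exp_add]
        simp only [T, q, dif_pos hs, expMap, ContinuousMap.coe_mk, h3]
        ring
      simpa only [h2] using h1
    | zero => simp [T, sum]
    | add x y _ _ hx hy =>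
      have h2 : ∀ μ : Atoms d, (μ.sum fun s => T x s * q s) + (μ.sum fun s => T y s * q s) =
          μ.sum fun s => T (x + y) s * q s := by
        intro μ
        rw [← μ.sum_add]
        refine μ.sum_congr fun s hs => ?_
        simp only [T, dif_pos hs, ContinuousMap.add_apply]
        ring
      simpa only [h2] using hx.add hy
    | smul a x _ hx =>
      have h2 : ∀ μ : Atoms d, a * (μ.sum fun s => T x s * q s) =
          μ.sum fun s => T (a • x) s * q s := by
        intro μ
        rw [← μ.sum_mul_left]
        refine μ.sum_congr fun s hs => ?_
        simp only [T, dif_pos hs, ContinuousMap.smul_apply, smul_eq_mul]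
        ring
      simpa only [h2] using hx.const_mul a
  let G : C(simplex c, ℝ) := ⟨fun p => g p.1, hg.domRestrict⟩
  have hG : ∀ μ : Atoms d, (μ.sum fun s => g (proj c s) * (1 - Real.exp (-(c ⬝ᵥ proj c s)))) =
      μ.sum fun s => T G s * q s := fun μ => μ.sum_congr fun s hs => by
    simp only [T, dif_pos hs, q]
    rfl
  simp only [hG]
  rw [Metric.tendsto_atTop]
  intro ε hε
  have hCpos : 0 ≤ C := le_trans (ν₀.sum_nonneg fun s hs =>
    dotProduct_nonneg_of_nonneg hc (proj_mem_simplex hc hs).1) hC₀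
  obtain ⟨f, hf, hfG⟩ := exists_span_expMap_norm_sub_lt hc0 G
    (show 0 < ε / (3 * (C + 1)) by positivity)
  have hclose : ∀ μ : Atoms d, (μ.sum fun s => c ⬝ᵥ proj c s) ≤ C →
      |(μ.sum fun s => T f s * q s) - μ.sum fun s => T G s * q s| < ε / 3 := by
    intro μ hμ
    rw [← μ.sum_sub]
    calc |μ.sum fun s => T f s * q s - T G s * q s|
        ≤ μ.sum fun s => ‖T f s * q s - T G s * q s‖ := μ.norm_sum_le (E := ℝ) _
      _ ≤ μ.sum fun s => ε / (3 * (C + 1)) * (c ⬝ᵥ proj c s) := by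
          refine μ.sum_mono fun s hs => ?_
          rw [← sub_mul, norm_mul, Real.norm_eq_abs, Real.norm_of_nonneg (hq s hs).1]
          simp only [T, dif_pos hs]
          exact mul_le_mul (hfG _).le (hq s hs).2 (hq s hs).1 (by positivity)
      _ = ε / (3 * (C + 1)) * (μ.sum fun s => c ⬝ᵥ proj c s) := μ.sum_mul_left _ _
      _ ≤ ε / (3 * (C + 1)) * C := by gcongr
      _ < ε / 3 := by
          rw [div_mul_eq_mul_div, div_lt_div_iff₀ (by positivity) (by norm_num)]
          nlinarith
  obtain ⟨N, hN⟩ := Metric.tendsto_atTop.1 (hspan f hf) (ε / 3) (by positivity)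
  refine ⟨N, fun j hj => ?_⟩
  have h1 := hN j hj
  rw [Real.dist_eq] at h1 ⊢
  have h2 := hclose (ν j) (hC j)
  have h3 := hclose ν₀ hC₀
  rw [abs_lt] at *
  constructor <;> linarith [h1.1, h1.2, h2.1, h2.2, h3.1, h3.2]

/-- Weak convergence for continuous functions of the coordinates `p = proj c s` that vanish to second
order at the origin. -/
theorem tendsto_sum_of_abs_le_sq {c : Fin d → ℝ} (hc0 : ∀ i, 0 < c i) (hc1 : ∀ i, c i < 1)
    (h : ∀ c : Fin d → ℝ, (∀ i, 0 < c i) → (∀ i, c i < 1) →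
      Tendsto (fun j => (ν j).logLaplace c) atTop (𝓝 (ν₀.logLaplace c)))
    {G : (Fin d → ℝ) → ℝ} (hG : ContinuousOn G (simplex c)) {K : ℝ}
    (hK : ∀ p ∈ simplex c, |G p| ≤ K * (c ⬝ᵥ p) ^ 2) :
    Tendsto (fun j => (ν j).sum fun s => G (proj c s)) atTop (𝓝 (ν₀.sum fun s => G (proj c s))) := by
  have hc : 0 ≤ c := fun i => (hc0 i).le
  let q : (Fin d → ℝ) → ℝ := fun p => 1 - Real.exp (-(c ⬝ᵥ p))
  have hqc : Continuous q := continuous_const.sub (Real.continuous_exp.comp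
    (Continuous.dotProduct continuous_const continuous_id).neg)
  have hq : ∀ p ∈ simplex c, c ⬝ᵥ p / 2 ≤ q p := by
    intro p hp
    have h0 := dotProduct_nonneg_of_nonneg hc hp.1
    have h1 : Real.exp (-(c ⬝ᵥ p)) ≤ (1 + c ⬝ᵥ p)⁻¹ := by
      rw [Real.exp_neg]
      exact inv_anti₀ (by linarith) (by linarith [Real.add_one_le_exp (c ⬝ᵥ p)])
    have h2 : c ⬝ᵥ p / 2 ≤ 1 - (1 + c ⬝ᵥ p)⁻¹ := by
      have : 1 - (1 + c ⬝ᵥ p)⁻¹ = c ⬝ᵥ p / (1 + c ⬝ᵥ p) := by field_simp; ring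
      rw [this]
      exact div_le_div_of_nonneg_left h0 (by linarith) (by linarith [hp.2])
    simp only [q]; linarith
  have hK0 : ∀ p ∈ simplex c, c ⬝ᵥ p = 0 → G p = 0 := fun p hp h0 => by
    have := hK p hp
    rw [h0] at this
    simpa using this
  have hGq : ∀ p ∈ simplex c, G p / q p * q p = G p := by
    intro p hp
    rcases eq_or_ne (c ⬝ᵥ p) 0 with h0 | h0
    · rw [hK0 p hp h0]; simp
    · have : q p ≠ 0 := by
        have h1 := dotProduct_nonneg_of_nonneg hc hp.1
        have h2 := hq p hp
        have : 0 < c ⬝ᵥ p := lt_of_le_of_ne h1 h0.symm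
        exact (by linarith : 0 < q p).ne'
      field_simp
  -- at the origin, where `q` vanishes to first order only, the junk value `0 / 0 = 0` is the right one
  have hcont : ContinuousOn (fun p => G p / q p) (simplex c) := by
    intro p hp
    rcases eq_or_ne (c ⬝ᵥ p) 0 with h0 | h0
    · have hz : G p / q p = 0 := by rw [hK0 p hp h0]; simp
      rw [ContinuousWithinAt, hz]
      have hb : ∀ p' ∈ simplex c, |G p' / q p'| ≤ 2 * |K| * (c ⬝ᵥ p') := by
        intro p' hp'
        have h1 := dotProduct_nonneg_of_nonneg hc hp'.1
        rcases h1.eq_or_lt with h2 | h2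
        · rw [hK0 p' hp' h2.symm, ← h2]; simp
        · have h3 := hq p' hp'
          have h4 : 0 < q p' := by linarith
          rw [abs_div, abs_of_pos h4, div_le_iff₀ h4]
          calc |G p'| ≤ K * (c ⬝ᵥ p') ^ 2 := hK p' hp'
            _ ≤ |K| * (c ⬝ᵥ p') ^ 2 := by gcongr; exact le_abs_self K
            _ = 2 * |K| * (c ⬝ᵥ p') * (c ⬝ᵥ p' / 2) := by ring
            _ ≤ _ := by gcongr
      refine squeeze_zero_norm' (eventually_mem_nhdsWithin.mono hb) ?_
      have : Continuous fun p' : Fin d → ℝ => 2 * |K| * (c ⬝ᵥ p') :=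
        continuous_const.mul (Continuous.dotProduct continuous_const continuous_id)
      exact (this.tendsto' p 0 (by rw [h0]; simp)).mono_left nhdsWithin_le_nhds
    · refine (hG p hp).div hqc.continuousWithinAt ?_
      have h1 := dotProduct_nonneg_of_nonneg hc hp.1
      have h2 := hq p hp
      have : 0 < c ⬝ᵥ p := lt_of_le_of_ne h1 h0.symm
      exact (by linarith : 0 < q p).ne'
  have hlim := tendsto_sum_continuous_mul hc0 hc1 h hcont
  have h2 : ∀ μ : Atoms d, (μ.sum fun s => G (proj c s) / q (proj c s) *
      (1 - Real.exp (-(c ⬝ᵥ proj c s)))) = μ.sum fun s => G (proj c s) := fun μ =>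
    μ.sum_congr fun s hs => hGq _ (proj_mem_simplex hc hs)
  simpa only [h2] using hlim

/-- No mass is lost in the limit near an atom of the limit measure. -/
theorem eventually_le_sum_indicator {c : Fin d → ℝ} (hc0 : ∀ i, 0 < c i) (hc1 : ∀ i, c i < 1)
    (h : ∀ c : Fin d → ℝ, (∀ i, 0 < c i) → (∀ i, c i < 1) →
      Tendsto (fun j => (ν j).logLaplace c) atTop (𝓝 (ν₀.logLaplace c)))
    {x : Fin d → ℝ} (hx : 0 ≤ x) (hx0 : x ≠ 0) {U : Set (Fin d → ℝ)} (hU : U ∈ 𝓝 (proj c x))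
    {a : ℝ} (ha : a < ν₀.sum (Set.indicator {x} 1)) :
    ∀ᶠ j in atTop, a < (ν j).sum fun s => U.indicator 1 (proj c s) := by
  have hc : 0 ≤ c := fun i => (hc0 i).le
  have hpos : 0 < c ⬝ᵥ proj c x := by
    rw [dotProduct_proj]
    refine div_pos ?_ (one_add_dotProduct_pos hc hx)
    obtain ⟨i, hi⟩ : ∃ i, x i ≠ 0 := by
      by_contra! hcon; exact hx0 (funext hcon)
    exact Finset.sum_pos' (fun i _ => mul_nonneg (hc i) (hx i))
      ⟨i, Finset.mem_univ i, mul_pos (hc0 i) (lt_of_le_of_ne (hx i) hi.symm)⟩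
  set η := c ⬝ᵥ proj c x / 2 with hη
  have hη0 : 0 < η := by positivity
  have hcd : Continuous fun p : Fin d → ℝ => c ⬝ᵥ p :=
    Continuous.dotProduct continuous_const continuous_id
  have hV : {p | η < c ⬝ᵥ p} ∈ 𝓝 (proj c x) :=
    hcd.continuousAt.eventually_const_lt (by show η < c ⬝ᵥ proj c x; linarith)
  obtain ⟨ρ, hρ, hball⟩ := Metric.mem_nhds_iff.1 (inter_mem hU hV)
  -- a bump at `proj c x`, supported in `U` and away from the origin
  let G : (Fin d → ℝ) → ℝ := fun p => max 0 (1 - dist p (proj c x) / ρ)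
  have hG1 : ∀ p, G p ≤ 1 := fun p => max_le zero_le_one (by
    have : 0 ≤ dist p (proj c x) / ρ := by positivity
    linarith)
  have hG0 : ∀ p, 0 ≤ G p := fun p => le_max_left _ _
  have hGs : ∀ p, G p ≠ 0 → p ∈ U ∧ η < c ⬝ᵥ p := by
    intro p hp
    refine hball ?_
    by_contra hcon
    rw [Metric.mem_ball, not_lt] at hcon
    apply hp
    refine max_eq_left ?_
    have := (one_le_div hρ).2 hcon
    linarith
  have hlim := tendsto_sum_of_abs_le_sq hc0 hc1 h (G := G) (K := (η ^ 2)⁻¹)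
    (by fun_prop) (fun p hp => by
      rw [abs_of_nonneg (hG0 p)]
      by_cases hp0 : G p = 0
      · rw [hp0]; positivity
      · have h1 := (hGs p hp0).2
        rw [inv_mul_eq_div, le_div_iff₀ (by positivity)]
        calc G p * η ^ 2 ≤ 1 * η ^ 2 := by gcongr; exact hG1 p
          _ ≤ (c ⬝ᵥ p) ^ 2 := by rw [one_mul]; gcongr)
  have h1 : ν₀.sum (Set.indicator {x} 1) ≤ ν₀.sum fun s => G (proj c s) := by
    refine ν₀.sum_mono fun s hs => ?_
    by_cases hsx : s = x
    · subst hsx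
      simp [G]
    · simp [hsx, hG0]
  filter_upwards [hlim.eventually_const_lt (ha.trans_le h1)] with j hj
  refine hj.trans_le ((ν j).sum_mono fun s hs => ?_)
  by_cases hs0 : G (proj c s) = 0
  · rw [hs0]; exact Set.indicator_nonneg (fun _ _ => zero_le_one) _
  · rw [Set.indicator_of_mem (hGs _ hs0).1]; exact hG1 _

end Atoms

/-! ### Convergence of characteristic exponents -/

/-- Second-order Taylor bound for the logarithm along the imaginary direction. -/
theorem norm_log_one_sub_I_mul_add_le (y : ℝ) :
    ‖Complex.log (1 - Complex.I * y) + Complex.I * y‖ ≤ y ^ 2 := by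
  have hder : ∀ x ∈ Set.uIcc 0 y, HasDerivWithinAt
      (fun x : ℝ => Complex.log (1 - Complex.I * x) + Complex.I * x)
      (-Complex.I / (1 - Complex.I * x) + Complex.I) (Set.uIcc 0 y) x := by
    intro x _
    have h1 : HasDerivAt (fun x : ℝ => (1 : ℂ) - Complex.I * x) (-Complex.I) x := by
      simpa using ((hasDerivAt_id x).ofReal_comp.const_mul Complex.I).const_sub 1
    have h2 : HasDerivAt (fun x : ℝ => Complex.I * (x : ℂ)) Complex.I x := by
      simpa using ((hasDerivAt_id x).ofReal_comp.const_mul Complex.I)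
    have hs : (1 : ℂ) - Complex.I * x ∈ Complex.slitPlane := by
      left; simp
    exact ((h1.clog_real hs).add h2).hasDerivWithinAt
  have hb : ∀ x ∈ Set.uIcc 0 y, ‖-Complex.I / (1 - Complex.I * x) + Complex.I‖ ≤ |y| := by
    intro x hx
    have h0 : (1 : ℂ) - Complex.I * x ≠ 0 := fun h => by
      have := congrArg Complex.re h; simp at this
    have h1 : -Complex.I / (1 - Complex.I * x) + Complex.I = x / (1 - Complex.I * x) := by
      field_simp
      ring_nf
      simp
    rw [h1, norm_div, Complex.norm_real]
    have h2 : 1 ≤ ‖(1 : ℂ) - Complex.I * x‖ := by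
      have := Complex.abs_re_le_norm (1 - Complex.I * x : ℂ)
      simpa using this
    have h3 : |x| ≤ |y| := by
      have := Set.abs_sub_left_of_mem_uIcc hx
      simpa using this
    calc ‖x‖ / ‖(1 : ℂ) - Complex.I * x‖ ≤ ‖x‖ := div_le_self (norm_nonneg _) h2
      _ ≤ |y| := h3
  have := (convex_uIcc (𝕜 := ℝ) 0 y).norm_image_sub_le_of_norm_hasDerivWithin_le hder hb
    Set.left_mem_uIcc Set.right_mem_uIcc
  simp only [Complex.ofReal_zero, mul_zero, sub_zero, Complex.log_one, add_zero] at this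
  refine this.trans_eq ?_
  rw [Real.norm_eq_abs, ← pow_two, sq_abs]

/-- Shifting the argument of the logarithm by `x ≥ 0` in the half plane `re ≥ 1` costs at most
`log (1 + x)`, since `1/z` is bounded by `1/re z`. -/
theorem norm_log_add_sub_log_le {x : ℝ} (hx : 0 ≤ x) (y : ℝ) :
    ‖Complex.log (1 + x - Complex.I * y) - Complex.log (1 - Complex.I * y)‖ ≤ Real.log (1 + x) := by
  have hder : ∀ θ : ℝ, 0 ≤ θ → HasDerivAt
      (fun θ : ℝ => Complex.log (1 + θ - Complex.I * y) - Complex.log (1 - Complex.I * y))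
      (1 / (1 + θ - Complex.I * y)) θ := by
    intro θ hθ
    have h1 : HasDerivAt (fun θ : ℝ => (1 : ℂ) + θ - Complex.I * y) 1 θ := by
      simpa using ((hasDerivAt_id θ).ofReal_comp.const_add 1).sub_const (Complex.I * y)
    have hs : (1 : ℂ) + θ - Complex.I * y ∈ Complex.slitPlane := by
      left; simp; linarith
    exact (h1.clog_real hs).sub_const _
  have hB : ∀ θ : ℝ, 0 ≤ θ → HasDerivAt (fun θ : ℝ => Real.log (1 + θ)) (1 / (1 + θ)) θ := by
    intro θ hθ
    exact ((hasDerivAt_id θ).const_add 1).log (by simp; linarith)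
  refine image_norm_le_of_norm_deriv_right_le_deriv_boundary' (a := 0) (b := x)
    (f := fun θ : ℝ => Complex.log (1 + θ - Complex.I * y) - Complex.log (1 - Complex.I * y))
    (f' := fun θ : ℝ => 1 / (1 + θ - Complex.I * y))
    (B := fun θ : ℝ => Real.log (1 + θ)) (B' := fun θ => 1 / (1 + θ))
    (fun θ hθ => (hder θ hθ.1).continuousAt.continuousWithinAt)
    (fun θ hθ => (hder θ hθ.1).hasDerivWithinAt) (by simp)
    (fun θ hθ => (hB θ hθ.1).continuousAt.continuousWithinAt)
    (fun θ hθ => (hB θ hθ.1).hasDerivWithinAt) (fun θ hθ => ?_) ⟨hx, le_rfl⟩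
  have hθ0 := hθ.1
  rw [norm_div, norm_one]
  have h2 : 1 + θ ≤ ‖(1 : ℂ) + θ - Complex.I * y‖ := by
    have := Complex.abs_re_le_norm (1 + θ - Complex.I * y : ℂ)
    simp only [Complex.sub_re, Complex.add_re, Complex.one_re, Complex.ofReal_re, Complex.mul_re,
      Complex.I_re, zero_mul, Complex.I_im, Complex.ofReal_im, mul_zero, sub_zero] at this
    exact (le_abs_self _).trans this
  exact one_div_le_one_div_of_le (by linarith) h2

namespace Atoms

variable {ν : ℕ → Atoms d} {ν₀ : Atoms d}

theorem sum_re (μ : Atoms d) (F : (Fin d → ℝ) → ℂ) : (μ.sum F).re = μ.sum fun s => (F s).re := by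
  simp [sum, Complex.re_sum]

theorem sum_im (μ : Atoms d) (F : (Fin d → ℝ) → ℂ) : (μ.sum F).im = μ.sum fun s => (F s).im := by
  simp [sum, Complex.im_sum]

theorem tendsto_sum_log_proj {c : Fin d → ℝ} (hc0 : ∀ i, 0 < c i) (hc1 : ∀ i, c i < 1)
    (h : ∀ c : Fin d → ℝ, (∀ i, 0 < c i) → (∀ i, c i < 1) →
      Tendsto (fun j => (ν j).logLaplace c) atTop (𝓝 (ν₀.logLaplace c))) (t : Fin d → ℝ) :
    Tendsto (fun j => (ν j).sum fun s => Complex.log (1 - Complex.I * (t ⬝ᵥ proj c s : ℝ))) atTop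
      (𝓝 (ν₀.sum fun s => Complex.log (1 - Complex.I * (t ⬝ᵥ proj c s : ℝ)))) := by
  obtain ⟨K, hK, -, hKp⟩ := exists_abs_dotProduct_le hc0 t
  -- the logarithm without its part of first order, which is a moment
  let G : (Fin d → ℝ) → ℂ := fun p =>
    Complex.log (1 - Complex.I * (t ⬝ᵥ p : ℝ)) + Complex.I * (t ⬝ᵥ p : ℝ)
  have hGc : Continuous G := by
    have h1 : Continuous fun p : Fin d → ℝ => ((t ⬝ᵥ p : ℝ) : ℂ) := Complex.continuous_ofReal.comp
      (Continuous.dotProduct continuous_const continuous_id)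
    refine Continuous.add (Continuous.clog (by fun_prop) fun p => ?_) (by fun_prop)
    left; simp
  have hGb : ∀ p ∈ simplex c, ‖G p‖ ≤ K ^ 2 * (c ⬝ᵥ p) ^ 2 := by
    intro p hp
    refine (norm_log_one_sub_I_mul_add_le _).trans ?_
    rw [← mul_pow, ← sq_abs]
    gcongr
    exact hKp p hp.1
  have hre := tendsto_sum_of_abs_le_sq hc0 hc1 h (G := fun p => (G p).re)
    (Complex.continuous_re.comp hGc).continuousOn
    (fun p hp => (Complex.abs_re_le_norm _).trans (hGb p hp))
  have him := tendsto_sum_of_abs_le_sq hc0 hc1 h (G := fun p => (G p).im)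
    (Complex.continuous_im.comp hGc).continuousOn
    (fun p hp => (Complex.abs_im_le_norm _).trans (hGb p hp))
  have hlin := tendsto_sum_pow hc0 hc1 h t 0
  have h1 : ∀ μ : Atoms d, (μ.sum fun s => Complex.log (1 - Complex.I * (t ⬝ᵥ proj c s : ℝ))) =
      ((μ.sum fun s => (G (proj c s)).re : ℝ) : ℂ) + ((μ.sum fun s => (G (proj c s)).im : ℝ) : ℂ) *
        Complex.I - Complex.I * ((μ.sum fun s => (t ⬝ᵥ proj c s) ^ (0 + 1) : ℝ) : ℂ) := by
    intro μ
    rw [← sum_re, ← sum_im, Complex.re_add_im]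
    simp only [sum, G, zero_add, pow_one, smul_add, Finset.sum_add_distrib, Complex.ofReal_sum,
      Finset.mul_sum, smul_eq_mul, Complex.ofReal_mul, Complex.real_smul]
    rw [eq_sub_iff_add_eq]
    congr 1
    exact Finset.sum_congr rfl fun i _ => by ring
  simp only [h1]
  have e := Complex.continuous_ofReal
  exact (((e.tendsto _).comp hre).add (((e.tendsto _).comp him).mul_const _)).sub
    (((e.tendsto _).comp hlin).const_mul _)

/-- Convergence of the Laplace exponents inside the unit cube implies convergence of the characteristic
exponents: add a real part `δ` to the coordinates of the argument, where convergence follows from that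
of the Laplace exponents, and let `δ → 0`. -/
theorem tendsto_charExponent
    (h : ∀ c : Fin d → ℝ, (∀ i, 0 < c i) → (∀ i, c i < 1) →
      Tendsto (fun j => (ν j).logLaplace c) atTop (𝓝 (ν₀.logLaplace c))) (t : Fin d → ℝ) :
    Tendsto (fun j => (ν j).charExponent t) atTop (𝓝 (ν₀.charExponent t)) := by
  let F : Atoms d → (Fin d → ℝ) → ℂ := fun μ c =>
    μ.sum fun s => Complex.log (1 + (c ⬝ᵥ s : ℝ) - Complex.I * (t ⬝ᵥ s : ℝ))
  have hF : ∀ (μ : Atoms d) (c : Fin d → ℝ), 0 ≤ c → F μ c = (μ.logLaplace c : ℝ) +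
      μ.sum fun s => Complex.log (1 - Complex.I * (t ⬝ᵥ proj c s : ℝ)) := by
    intro μ c hc
    have : ((μ.logLaplace c : ℝ) : ℂ) = μ.sum fun s => ((Real.log (1 + c ⬝ᵥ s) : ℝ) : ℂ) := by
      simp [logLaplace, sum]
    rw [this, ← μ.sum_add]
    refine μ.sum_congr fun s hs => ?_
    have hp := one_add_dotProduct_pos hc hs
    have hne : (1 : ℂ) - Complex.I * (t ⬝ᵥ proj c s : ℝ) ≠ 0 := fun h => by
      have := congrArg Complex.re h; simp at this
    rw [← Complex.log_ofReal_mul hp hne, dotProduct_proj]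
    congr 1
    have : ((1 + c ⬝ᵥ s : ℝ) : ℂ) ≠ 0 := by exact_mod_cast hp.ne'
    push_cast at this ⊢
    field_simp
  have hdiff : ∀ (μ : Atoms d) (c : Fin d → ℝ), 0 ≤ c →
      ‖F μ c - μ.charExponent t‖ ≤ μ.logLaplace c := by
    intro μ c hc
    rw [charExponent, ← μ.sum_sub]
    exact (μ.norm_sum_le _).trans (μ.sum_mono fun s hs =>
      norm_log_add_sub_log_le (dotProduct_nonneg_of_nonneg hc hs) _)
  rw [Metric.tendsto_atTop]
  intro ε hε
  have hsmall : ∀ᶠ δ : ℝ in 𝓝[>] 0, ν₀.logLaplace (fun _ => δ) < ε / 4 := by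
    have h0 : ν₀.logLaplace 0 = 0 := by simp [logLaplace, sum]
    have h1 : Tendsto (fun δ : ℝ => (fun _ => δ : Fin d → ℝ)) (𝓝[>] 0) (𝓝[Set.Ici 0] 0) := by
      refine tendsto_nhdsWithin_iff.2 ⟨(Continuous.tendsto' (by fun_prop) _ _ rfl).mono_left
        nhdsWithin_le_nhds, ?_⟩
      filter_upwards [self_mem_nhdsWithin] with δ hδ i using (le_of_lt hδ : (0 : ℝ) ≤ δ)
    have h2 := (ν₀.continuousOn_logLaplace 0 Set.self_mem_Ici).tendsto.comp h1
    rw [h0] at h2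
    exact h2.eventually_lt_const (by positivity)
  have hlt1 : ∀ᶠ δ : ℝ in 𝓝[>] 0, δ < 1 :=
    (tendsto_id.mono_left nhdsWithin_le_nhds).eventually_lt_const (by norm_num)
  obtain ⟨δ, hδ, hδ1, hδ0⟩ := (hsmall.and (hlt1.and self_mem_nhdsWithin)).exists
  have hδ0 : 0 < δ := hδ0
  set c : Fin d → ℝ := fun _ => δ
  have hc : 0 ≤ c := fun _ => hδ0.le
  have hL := h c (fun _ => hδ0) (fun _ => hδ1)
  have hFt : Tendsto (fun j => F (ν j) c) atTop (𝓝 (F ν₀ c)) := by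
    simp only [fun μ => hF μ c hc]
    exact ((Complex.continuous_ofReal.tendsto _).comp hL).add
      (tendsto_sum_log_proj (fun _ => hδ0) (fun _ => hδ1) h t)
  obtain ⟨N, hN⟩ := Metric.tendsto_atTop.1 hFt (ε / 4) (by positivity)
  obtain ⟨N', hN'⟩ := eventually_atTop.1 (hL.eventually_lt_const hδ)
  refine ⟨max N N', fun j hj => ?_⟩
  have h1 := hN j ((le_max_left _ _).trans hj)
  have h2 := hN' j ((le_max_right _ _).trans hj)
  have h3 := hdiff (ν j) c hc
  have h4 := hdiff ν₀ c hc
  rw [dist_eq_norm] at h1 ⊢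
  calc ‖(ν j).charExponent t - ν₀.charExponent t‖
      = ‖-(F (ν j) c - (ν j).charExponent t) + (F (ν j) c - F ν₀ c) +
          (F ν₀ c - ν₀.charExponent t)‖ := by congr 1; ring
    _ ≤ ‖F (ν j) c - (ν j).charExponent t‖ + ‖F (ν j) c - F ν₀ c‖ +
          ‖F ν₀ c - ν₀.charExponent t‖ := by
        refine (norm_add₃_le).trans_eq ?_
        rw [norm_neg]
    _ < ε := by linarith

end Atoms

/-! ### Uniform integrability of products of decaying factors -/

/-- Layer-cake form of summation by parts: a weighted sum is nonnegative as soon as the weights of all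
superlevel sets are. -/
theorem sum_mul_nonneg_of_superlevel {ι : Type*} [Fintype ι] (g y : ι → ℝ) (hy : ∀ i, 0 ≤ y i)
    (h : ∀ r : ℝ, 0 < r → 0 ≤ ∑ i, if r ≤ y i then g i else 0) : 0 ≤ ∑ i, g i * y i := by
  have hint : ∀ i, IntegrableOn (fun r : ℝ => if r ≤ y i then g i else 0)
      (Set.Ioc 0 (∑ i, y i)) := by
    intro i
    have : (fun r : ℝ => if r ≤ y i then g i else 0) = (Set.Iic (y i)).indicator fun _ => g i := by
      ext r; simp [Set.indicator_apply]
    rw [this]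
    exact (integrableOn_const (by simp)).indicator measurableSet_Iic
  have hval : ∀ i, ∫ r in Set.Ioc 0 (∑ i, y i), (if r ≤ y i then g i else 0) = g i * y i := by
    intro i
    have : (fun r : ℝ => if r ≤ y i then g i else 0) = (Set.Iic (y i)).indicator fun _ => g i := by
      ext r; simp [Set.indicator_apply]
    have hle : y i ≤ ∑ i, y i := Finset.single_le_sum (fun j _ => hy j) (Finset.mem_univ i)
    rw [this, integral_indicator measurableSet_Iic, Measure.restrict_restrict measurableSet_Iic,
      setIntegral_const]
    have : Set.Iic (y i) ∩ Set.Ioc 0 (∑ i, y i) = Set.Ioc 0 (y i) := by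
      ext r; simp only [Set.mem_inter_iff, Set.mem_Iic, Set.mem_Ioc]
      constructor
      · rintro ⟨h1, h2, -⟩; exact ⟨h2, h1⟩
      · rintro ⟨h1, h2⟩; exact ⟨h2, h1, h2.trans hle⟩
    rw [this, Real.volume_real_Ioc_of_le (hy i), smul_eq_mul]
    ring
  have : ∑ i, g i * y i = ∫ r in Set.Ioc 0 (∑ i, y i), ∑ i, (if r ≤ y i then g i else 0) := by
    rw [integral_finsetSum _ fun i _ => hint i]
    exact Finset.sum_congr rfl fun i _ => (hval i).symm
  rw [this]
  exact setIntegral_nonneg measurableSet_Ioc fun r hr => h r hr.1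

/-- Greedy bound. If for every subspace spanned by some of the vectors `p i` the weight `w` of the
vectors outside is at least `κ` times its codimension, then `∑ w i * y i` dominates `κ` times the sum of
`y` over a basis chosen among the `p i`: the one of minimal total `y`, which by exchange spans every
sublevel set with its own elements below that level. -/
theorem exists_linearIndependent_mul_sum_le {ι : Type*} [Fintype ι] (p : ι → Fin d → ℝ)
    (w y : ι → ℝ) (hw : ∀ i, 0 ≤ w i) (hy : ∀ i, 0 ≤ y i) {κ : ℝ} (hκ : 0 ≤ κ)
    (hspan : Submodule.span ℝ (Set.range p) = ⊤)
    (hJ : ∀ J : Set ι, κ * ((d : ℝ) - Module.finrank ℝ (Submodule.span ℝ (p '' J))) ≤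
      ∑ i, (Submodule.span ℝ (p '' J) : Set (Fin d → ℝ))ᶜ.indicator 1 (p i) * w i) :
    ∃ b : Fin d → ι, LinearIndependent ℝ (p ∘ b) ∧ κ * ∑ k, y (b k) ≤ ∑ i, w i * y i := by
  classical
  have hne : ∃ b : Fin d → ι, LinearIndependent ℝ (p ∘ b) := by
    obtain ⟨f, hf, -, hli⟩ := Submodule.exists_fun_fin_finrank_span_eq ℝ (Set.range p)
    have hd : Module.finrank ℝ (Submodule.span ℝ (Set.range p)) = d := by
      rw [hspan]; simp
    choose g hg using hf
    refine ⟨fun k => g (Fin.cast hd.symm k), ?_⟩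
    have : (p ∘ fun k => g (Fin.cast hd.symm k)) = f ∘ Fin.cast hd.symm := by
      ext k : 1; simp [hg]
    rw [this]
    exact hli.comp _ (Fin.cast_injective _)
  obtain ⟨b₀, hb₀⟩ := hne
  let S : Finset (Fin d → ι) := Finset.univ.filter fun b => LinearIndependent ℝ (p ∘ b)
  obtain ⟨b, hbS, hmin⟩ := S.exists_min_image (fun b => ∑ k, y (b k)) ⟨b₀, by simpa [S] using hb₀⟩
  have hb : LinearIndependent ℝ (p ∘ b) := by simpa [S] using hbS
  refine ⟨b, hb, ?_⟩
  have hcard : Fintype.card (Fin d) = Module.finrank ℝ (Fin d → ℝ) := by simp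
  let B := basisOfLinearIndependentOfCardEqFinrank' (p ∘ b) hb hcard
  have hBp : ∀ k, B k = p (b k) := fun k => by simp [B]
  -- the elements of the basis below a level span everything below that level
  have hexch : ∀ r : ℝ, ∀ i, y i < r →
      p i ∈ Submodule.span ℝ ((fun k => p (b k)) '' {k | y (b k) < r}) := by
    intro r i hi
    by_contra hcon
    have : ∃ k, B.repr (p i) k ≠ 0 ∧ r ≤ y (b k) := by
      by_contra! hall
      apply hcon
      rw [← B.sum_repr (p i)]
      refine Submodule.sum_mem _ fun k _ => ?_
      by_cases hk : B.repr (p i) k = 0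
      · rw [hk, zero_smul]; exact Submodule.zero_mem _
      · exact Submodule.smul_mem _ _ (Submodule.subset_span ⟨k, hall k hk, (hBp k).symm⟩)
    obtain ⟨k, hk0, hkr⟩ := this
    have hli : LinearIndependent ℝ (p ∘ Function.update b k i) := by
      rw [Function.comp_update]
      refine hb.update k (p i) ⟨1, one_mem _, B.repr (p i), mem_nonZeroDivisors_of_ne_zero hk0, ?_⟩
      have := B.linearCombination_repr (p i)
      rw [one_smul]
      conv_lhs => rw [← this]
      congr 2
      ext k : 1
      exact hBp k
    have h1 := hmin _ (by simpa [S] using hli)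
    have h2 : ∑ l, y (Function.update b k i l) = ∑ l, y (b l) - y (b k) + y i := by
      rw [← Finset.add_sum_erase _ _ (Finset.mem_univ k), ← Finset.add_sum_erase _ (fun l => y (b l))
        (Finset.mem_univ k)]
      have : ∑ l ∈ Finset.univ.erase k, y (Function.update b k i l) =
          ∑ l ∈ Finset.univ.erase k, y (b l) := Finset.sum_congr rfl fun l hl => by
        rw [Function.update_of_ne (Finset.ne_of_mem_erase hl)]
      rw [this, Function.update_self]
      ring
    simp only [h2] at h1
    linarith
  -- the hypothesis for the span of the vectors below level `r`, whose dimension is at most the number of basis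
  -- elements below that level
  have hlevel : ∀ r : ℝ, κ * (∑ k, if r ≤ y (b k) then (1 : ℝ) else 0) ≤
      ∑ i, if r ≤ y i then w i else 0 := by
    intro r
    have h1 := hJ {i | y i < r}
    set V := Submodule.span ℝ (p '' {i | y i < r}) with hV
    have h2 : Module.finrank ℝ V ≤ (Finset.univ.filter fun k => y (b k) < r).card := by
      have hle : V ≤ Submodule.span ℝ
          (((Finset.univ.filter fun k => y (b k) < r).image fun k => p (b k) : Finset (Fin d → ℝ)) :
            Set (Fin d → ℝ)) := by
        rw [hV, Submodule.span_le]
        rintro _ ⟨i, hi, rfl⟩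
        have := hexch r i hi
        simpa using this
      exact (Submodule.finrank_mono hle).trans
        ((finrank_span_finset_le_card _).trans Finset.card_image_le)
    have h3 : (∑ k, if r ≤ y (b k) then (1 : ℝ) else 0) =
        d - ((Finset.univ.filter fun k => y (b k) < r).card : ℝ) := by
      have h4 : ∀ k, (if r ≤ y (b k) then (1 : ℝ) else 0) = 1 - if y (b k) < r then 1 else 0 := by
        intro k
        by_cases hk : y (b k) < r
        · simp [hk, not_le.2 hk]
        · simp [hk, not_lt.1 hk]
      simp only [h4, Finset.sum_sub_distrib, Finset.sum_const, Finset.card_univ, Fintype.card_fin,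
        nsmul_eq_mul, mul_one, Finset.sum_boole]
    have h5 : (Module.finrank ℝ V : ℝ) ≤ ((Finset.univ.filter fun k => y (b k) < r).card : ℝ) := by
      exact_mod_cast h2
    calc κ * (∑ k, if r ≤ y (b k) then (1 : ℝ) else 0) ≤ κ * ((d : ℝ) - Module.finrank ℝ V) := by
          rw [h3]; exact mul_le_mul_of_nonneg_left (by linarith) hκ
      _ ≤ _ := h1
      _ ≤ _ := Finset.sum_le_sum fun i _ => by
          by_cases hi : r ≤ y i
          · rw [if_pos hi]
            refine mul_le_of_le_one_left (hw i) ?_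
            exact Set.indicator_apply_le' (fun _ => le_rfl) (fun _ => zero_le_one)
          · rw [if_neg hi, Set.indicator_of_notMem, zero_mul]
            rw [Set.notMem_compl_iff]
            exact Submodule.subset_span ⟨i, not_le.1 hi, rfl⟩
  have key := sum_mul_nonneg_of_superlevel
    (fun i => w i - κ * ∑ k, if b k = i then (1 : ℝ) else 0) y hy fun r _ => by
      have h1 := hlevel r
      have h2 : ∀ i, (if r ≤ y i then w i - κ * ∑ k, (if b k = i then (1 : ℝ) else 0) else 0) =
          (if r ≤ y i then w i else 0) - κ * ∑ k, if b k = i then (if r ≤ y i then 1 else 0) else 0 := by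
        intro i
        by_cases hi : r ≤ y i <;> simp [hi]
      simp only [h2, Finset.sum_sub_distrib, ← Finset.mul_sum]
      rw [Finset.sum_comm]
      simpa using h1
  have h6 : ∑ i, (w i - κ * ∑ k, if b k = i then (1 : ℝ) else 0) * y i =
      ∑ i, w i * y i - κ * ∑ k, y (b k) := by
    simp only [sub_mul, Finset.sum_sub_distrib, mul_assoc, ← Finset.mul_sum, Finset.sum_mul]
    rw [Finset.sum_comm]
    simp
  rw [h6] at key
  linarith

theorem tendsto_setLIntegral_norm_gt {E : Type*} [NormedAddCommGroup E] [MeasurableSpace E]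
    [OpensMeasurableSpace E] {μ : Measure E} {g : E → ℝ≥0∞} (hg : Measurable g)
    (hint : ∫⁻ x, g x ∂μ ≠ ⊤) :
    Tendsto (fun n : ℕ => ∫⁻ x in {x : E | (n : ℝ) < ‖x‖}, g x ∂μ) atTop (𝓝 0) := by
  have hms : ∀ n : ℕ, MeasurableSet {x : E | (n : ℝ) < ‖x‖} := fun n =>
    measurableSet_lt measurable_const measurable_norm
  simp only [← lintegral_indicator (hms _)]
  have := tendsto_lintegral_of_dominated_convergence (μ := μ)
    (F := fun n : ℕ => ({x : E | (n : ℝ) < ‖x‖}).indicator g)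
    (f := fun _ => 0) g (fun n => hg.indicator (hms n))
    (fun n => Eventually.of_forall fun x => Set.indicator_le_self _ _ _)
    hint (Eventually.of_forall fun x => by
      obtain ⟨N, hN⟩ := exists_nat_ge ‖x‖
      refine tendsto_const_nhds.congr' ?_
      filter_upwards [eventually_ge_atTop N] with n hn
      rw [Set.indicator_of_notMem]
      simp only [Set.mem_ofPred_eq, not_lt]
      exact hN.trans (by exact_mod_cast hn))
  simpa using this

/-- The tails of `∏ (1 + ⟨t, u k⟩²) ^ (-κ / 2)` are uniformly small for all `u` near a given basis: the linear
change of variables `t ↦ (⟨t, u k⟩)` has a bounded inverse there, and the exponent exceeds `1 / 2`. -/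
theorem exists_nhds_lintegral_prod_le {κ : ℝ} (hκ : 1 < κ) {b : Fin d → Fin d → ℝ}
    (hb : LinearIndependent ℝ b) :
    ∃ U ∈ 𝓝 b, ∀ η : ℝ≥0∞, η ≠ 0 → ∃ R : ℝ, ∀ u ∈ U,
      ∫⁻ t in {t : Fin d → ℝ | R < ‖t‖},
        ENNReal.ofReal (∏ k, (1 + (t ⬝ᵥ u k) ^ 2) ^ (-κ / 2)) ≤ η := by
  have hdet : (Matrix.of b).det ≠ 0 := by
    have := Matrix.linearIndependent_rows_iff_isUnit (A := Matrix.of b) |>.1 hb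
    exact ((Matrix.isUnit_iff_isUnit_det _).1 this).ne_zero
  set δ := |(Matrix.of b).det| / 2 with hδ
  have hδ0 : 0 < δ := by have := abs_pos.2 hdet; positivity
  have hof : Continuous fun u : Fin d → Fin d → ℝ => Matrix.of u := continuous_id
  let A : (Fin d → Fin d → ℝ) → ℝ := fun u => ∑ i, ∑ k, |(Matrix.of u).adjugate i k|
  have hA0 : ∀ u, 0 ≤ A u := fun u => Finset.sum_nonneg fun i _ => Finset.sum_nonneg fun k _ => abs_nonneg _
  have hAc : Continuous A := by
    refine continuous_finsetSum _ fun i _ => continuous_finsetSum _ fun k _ => ?_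
    exact (hof.matrix_adjugate.matrix_elem i k).abs
  set C := (A b + 1) / δ with hC
  have hC0 : 0 < C := div_pos (by linarith [hA0 b]) hδ0
  -- integrable majorant after the linear change of variables
  let h : (Fin d → ℝ) → ℝ := fun x => ∏ k, (1 + x k ^ 2) ^ (-κ / 2)
  have hint : Integrable h := by
    have h1 : Integrable fun x : ℝ => (1 + x ^ 2) ^ (-κ / 2) := by
      have := integrable_rpow_neg_one_add_norm_sq (E := ℝ) (μ := volume) (r := κ) (by simpa using hκ)
      simpa using this
    exact Integrable.fintype_prod fun _ => h1
  have hmeas : Measurable fun x => ENNReal.ofReal (h x) := by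
    refine ENNReal.measurable_ofReal.comp (Finset.measurable_fun_prod _ fun k _ => ?_)
    exact ((measurable_const.add ((measurable_pi_apply k).pow_const 2)).pow_const _)
  have htail := tendsto_setLIntegral_norm_gt hmeas hint.lintegral_lt_top.ne
  refine ⟨{u | δ < |(Matrix.of u).det|} ∩ {u | A u < A b + 1}, inter_mem ?_ ?_, ?_⟩
  · exact hof.matrix_det.abs.continuousAt.eventually_const_lt (by
      have := abs_pos.2 hdet; rw [hδ]; linarith)
  · exact hAc.continuousAt.eventually_lt_const (by linarith)
  intro η hη
  have hη' : ENNReal.ofReal δ * η ≠ 0 := mul_ne_zero (by simpa using hδ0) hη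
  obtain ⟨n, hn⟩ := ((tendsto_order.1 htail).2 _ (pos_iff_ne_zero.2 hη')).exists
  refine ⟨C * n, fun u hu => ?_⟩
  set M := Matrix.of u with hM
  have hMdet : M.det ≠ 0 := by
    intro h0
    have := hu.1
    simp only [Set.mem_ofPred_eq, ← hM, h0, abs_zero] at this
    linarith
  have hnorm : ∀ t : Fin d → ℝ, ‖t‖ ≤ C * ‖M *ᵥ t‖ := by
    intro t
    refine (pi_norm_le_iff_of_nonneg (by positivity)).2 fun i => ?_
    have h1 : M.det * t i = ∑ k, M.adjugate i k * (M *ᵥ t) k := by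
      have : M.adjugate *ᵥ (M *ᵥ t) = M.det • t := by
        rw [Matrix.mulVec_mulVec, Matrix.adjugate_mul, Matrix.smul_mulVec, Matrix.one_mulVec]
      have := congrFun this i
      simpa [Matrix.mulVec, dotProduct] using this.symm
    have h2 : δ * ‖t i‖ ≤ (A b + 1) * ‖M *ᵥ t‖ := by
      calc δ * ‖t i‖ ≤ |M.det| * ‖t i‖ := mul_le_mul_of_nonneg_right hu.1.le (norm_nonneg _)
        _ = |∑ k, M.adjugate i k * (M *ᵥ t) k| := by rw [← h1, abs_mul, Real.norm_eq_abs]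
        _ ≤ ∑ k, |M.adjugate i k| * ‖M *ᵥ t‖ := by
            refine (Finset.abs_sum_le_sum_abs _ _).trans (Finset.sum_le_sum fun k _ => ?_)
            rw [abs_mul]
            exact mul_le_mul_of_nonneg_left
              ((Real.norm_eq_abs _).symm.trans_le (norm_le_pi_norm _ k)) (abs_nonneg _)
        _ = (∑ k, |M.adjugate i k|) * ‖M *ᵥ t‖ := by rw [Finset.sum_mul]
        _ ≤ A u * ‖M *ᵥ t‖ := by
            refine mul_le_mul_of_nonneg_right ?_ (norm_nonneg _)
            exact Finset.single_le_sum (f := fun i => ∑ k, |M.adjugate i k|)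
              (fun i _ => Finset.sum_nonneg fun k _ => abs_nonneg _) (Finset.mem_univ i)
        _ ≤ _ := mul_le_mul_of_nonneg_right hu.2.le (norm_nonneg _)
    rw [hC, div_mul_eq_mul_div, le_div_iff₀ hδ0]
    linarith
  have hms : MeasurableSet {x : Fin d → ℝ | (n : ℝ) < ‖x‖} :=
    measurableSet_lt measurable_const measurable_norm
  have hMm : Measurable (Matrix.toLin' M) := (LinearMap.continuous_on_pi _).measurable
  calc ∫⁻ t in {t : Fin d → ℝ | C * n < ‖t‖}, ENNReal.ofReal (∏ k, (1 + (t ⬝ᵥ u k) ^ 2) ^ (-κ / 2))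
      ≤ ∫⁻ t in Matrix.toLin' M ⁻¹' {x : Fin d → ℝ | (n : ℝ) < ‖x‖},
          ENNReal.ofReal (h (Matrix.toLin' M t)) := by
        have hfun : ∀ t : Fin d → ℝ, h (Matrix.toLin' M t) =
            ∏ k, (1 + (t ⬝ᵥ u k) ^ 2) ^ (-κ / 2) := by
          intro t
          refine Finset.prod_congr rfl fun k _ => ?_
          rw [Matrix.toLin'_apply, Matrix.mulVec, dotProduct_comm]
          rfl
        simp only [hfun]
        refine lintegral_mono_set fun t ht => ?_
        have := hnorm t
        simp only [Set.mem_ofPred_eq, Set.mem_preimage, Matrix.toLin'_apply] at ht ⊢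
        exact lt_of_mul_lt_mul_left (ht.trans_le this) hC0.le
    _ = ∫⁻ x in {x : Fin d → ℝ | (n : ℝ) < ‖x‖}, ENNReal.ofReal (h x)
          ∂(Measure.map (Matrix.toLin' M) volume) := by
        rw [setLIntegral_map hms hmeas hMm]
    _ = ENNReal.ofReal |M.det⁻¹| * ∫⁻ x in {x : Fin d → ℝ | (n : ℝ) < ‖x‖}, ENNReal.ofReal (h x) := by
        rw [Real.map_matrix_volume_pi_eq_smul_volume_pi hMdet, Measure.restrict_smul,
          lintegral_smul_measure, smul_eq_mul]
    _ ≤ ENNReal.ofReal δ⁻¹ * (ENNReal.ofReal δ * η) := by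
        gcongr
        rw [abs_inv]
        exact inv_anti₀ hδ0 hu.1.le
    _ = η := by
        rw [← mul_assoc, ← ENNReal.ofReal_mul (by positivity), inv_mul_cancel₀ hδ0.ne',
          ENNReal.ofReal_one, one_mul]

/-- Jensen's inequality for a weighted mean in the exponent. -/
theorem exp_neg_mul_div_le {ι : Type*} (s : Finset ι) {β : ι → ℝ} (hβ : ∀ i, 0 ≤ β i)
    (hm : 0 < ∑ i ∈ s, β i) (κ : ℝ) (x : ι → ℝ) :
    Real.exp (-κ * ((∑ i ∈ s, β i * x i) / ∑ i ∈ s, β i)) ≤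
      ∑ i ∈ s, β i / (∑ i ∈ s, β i) * Real.exp (-κ * x i) := by
  have h := convexOn_exp.map_sum_le (t := s) (w := fun i => β i / ∑ i ∈ s, β i)
    (p := fun i => -κ * x i) (fun i _ => div_nonneg (hβ i) hm.le)
    (by rw [← Finset.sum_div, div_self hm.ne']) (fun _ _ => Set.mem_univ _)
  refine le_trans (le_of_eq ?_) h
  congr 1
  rw [Finset.sum_div, Finset.mul_sum]
  exact Finset.sum_congr rfl fun i _ => by rw [smul_eq_mul]; ring

/-- Uniform smallness of the tails of `exp (-∑ β_l log (1 + ⟨t, u_l⟩²))` for all weighted points `(β, u)`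
which have enough mass near each of the points `p i`. The points near `p i` form a cluster; the greedy bound is
applied to the means over the clusters, and Jensen's inequality turns the mean in each exponent into a
mixture of products over one point per cluster. -/
theorem exists_nhds_lintegral_exp_le {ι : Type*} [Fintype ι] {p : ι → Fin d → ℝ}
    (hp : Function.Injective p) {a : ι → ℝ} (ha : ∀ i, 0 < a i) {κ : ℝ} (hκ : 1 < κ)
    (hJ : ∀ J : Set ι, κ * ((d : ℝ) - Module.finrank ℝ (Submodule.span ℝ (p '' J))) ≤
      ∑ i, (Submodule.span ℝ (p '' J) : Set (Fin d → ℝ))ᶜ.indicator 1 (p i) * a i) :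
    ∃ U : ι → Set (Fin d → ℝ), (∀ i, U i ∈ 𝓝 (p i)) ∧ ∀ η : ℝ≥0∞, η ≠ 0 → ∃ R : ℝ,
      ∀ (n : ℕ) (β : Fin n → ℝ) (u : Fin n → Fin d → ℝ), (∀ l, 0 ≤ β l) →
        (∀ i, a i ≤ 2 * ∑ l, β l * (U i).indicator 1 (u l)) →
        ∫⁻ t in {t : Fin d → ℝ | R < ‖t‖},
          ENNReal.ofReal (Real.exp (-∑ l, β l * Real.log (1 + (t ⬝ᵥ u l) ^ 2))) ≤ η := by
  classical
  have hspan : Submodule.span ℝ (Set.range p) = ⊤ := by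
    have h := hJ Set.univ
    rw [Set.image_univ] at h
    have h0 : ∑ i, (Submodule.span ℝ (Set.range p) : Set (Fin d → ℝ))ᶜ.indicator 1 (p i) * a i = 0 :=
      Finset.sum_eq_zero fun i _ => by
        rw [Set.indicator_of_notMem, zero_mul]
        rw [Set.notMem_compl_iff]
        exact Submodule.subset_span ⟨i, rfl⟩
    rw [h0] at h
    apply Submodule.eq_top_of_finrank_eq
    refine le_antisymm (Submodule.finrank_le _) ?_
    have h1 : (d : ℝ) ≤ Module.finrank ℝ (Submodule.span ℝ (Set.range p)) := by nlinarith
    simpa using (by exact_mod_cast h1 : d ≤ Module.finrank ℝ (Submodule.span ℝ (Set.range p)))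
  let S : Finset (Fin d → ι) := Finset.univ.filter fun b => LinearIndependent ℝ (p ∘ b)
  have hS : ∀ b ∈ S, ∃ V ∈ 𝓝 (p ∘ b), ∀ η : ℝ≥0∞, η ≠ 0 → ∃ R : ℝ, ∀ u ∈ V,
      ∫⁻ t in {t : Fin d → ℝ | R < ‖t‖},
        ENNReal.ofReal (∏ k, (1 + (t ⬝ᵥ u k) ^ 2) ^ (-κ / 2)) ≤ η := fun b hb =>
    exists_nhds_lintegral_prod_le hκ (by simpa [S] using hb)
  choose! V hV hVη using hS
  -- one radius that works for all bases and separates the points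
  have e1 : ∀ᶠ δ : ℝ in 𝓝[>] 0, ∀ b ∈ S, Metric.ball (p ∘ b) δ ⊆ V b := by
    refine (Finset.eventually_all S).2 fun b hb => ?_
    obtain ⟨δ₀, hδ₀, h0⟩ := Metric.mem_nhds_iff.1 (hV b hb)
    filter_upwards [(tendsto_id.mono_left nhdsWithin_le_nhds).eventually_lt_const hδ₀] with δ hδ
    exact (Metric.ball_subset_ball (le_of_lt hδ)).trans h0
  have e2 : ∀ᶠ δ : ℝ in 𝓝[>] 0, ∀ i j, i ≠ j → δ < dist (p i) (p j) / 2 := by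
    refine eventually_all.2 fun i => eventually_all.2 fun j => ?_
    by_cases hij : i = j
    · exact Eventually.of_forall fun δ h => absurd hij h
    · have : 0 < dist (p i) (p j) / 2 := by
        have := dist_pos.2 (hp.ne hij); positivity
      filter_upwards [(tendsto_id.mono_left nhdsWithin_le_nhds).eventually_lt_const this] with δ hδ _
        using hδ
  obtain ⟨δ, hδV, hδsep, hδ0⟩ := (e1.and (e2.and self_mem_nhdsWithin)).exists
  have hδ0 : 0 < δ := hδ0
  refine ⟨fun i => Metric.ball (p i) δ, fun i => Metric.ball_mem_nhds _ hδ0, fun η hη => ?_⟩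
  set η' : ℝ≥0∞ := η / (S.card + 1) with hη'
  have hη'0 : η' ≠ 0 := ENNReal.div_ne_zero.2 ⟨hη, by simp⟩
  have hR : ∀ b ∈ S, ∃ R : ℝ, ∀ u ∈ V b, ∫⁻ t in {t : Fin d → ℝ | R < ‖t‖},
      ENNReal.ofReal (∏ k, (1 + (t ⬝ᵥ u k) ^ 2) ^ (-κ / 2)) ≤ η' := fun b hb => hVη b hb η' hη'0
  choose! R hR using hR
  obtain ⟨R₀, hR₀⟩ : ∃ R₀, ∀ b ∈ S, R b ≤ R₀ := by
    obtain ⟨R₀, h⟩ := (S.image R).exists_le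
    exact ⟨R₀, fun b hb => h _ (Finset.mem_image_of_mem _ hb)⟩
  refine ⟨R₀, fun n β u hβ hmass => ?_⟩
  let Cl : ι → Finset (Fin n) := fun i => Finset.univ.filter fun l => u l ∈ Metric.ball (p i) δ
  let m : ι → ℝ := fun i => ∑ l ∈ Cl i, β l
  have hm : ∀ i, a i ≤ 2 * m i := by
    intro i
    refine (hmass i).trans_eq ?_
    simp only [m, Cl, Finset.sum_filter, Set.indicator_apply, Pi.one_apply, mul_ite, mul_one, mul_zero]
  have hm0 : ∀ i, 0 < m i := fun i => by linarith [hm i, ha i]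
  have hdisj : ∀ i j, i ≠ j → Disjoint (Cl i) (Cl j) := by
    intro i j hij
    rw [Finset.disjoint_left]
    intro l hl hl'
    simp only [Cl, Finset.mem_filter, Finset.mem_univ, true_and, Metric.mem_ball] at hl hl'
    have := dist_triangle_left (p i) (p j) (u l)
    linarith [hδsep i j hij]
  let f : (Fin d → ℝ) → Fin n → ℝ := fun t l => 2⁻¹ * Real.log (1 + (t ⬝ᵥ u l) ^ 2)
  have hf0 : ∀ t l, 0 ≤ f t l := fun t l =>
    mul_nonneg (by norm_num) (Real.log_nonneg (by nlinarith [sq_nonneg (t ⬝ᵥ u l)]))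
  have hfexp : ∀ t l, Real.exp (-κ * f t l) = (1 + (t ⬝ᵥ u l) ^ 2) ^ (-κ / 2) := by
    intro t l
    rw [Real.rpow_def_of_pos (by positivity)]
    congr 1; simp only [f]; ring
  -- the mean over the cluster at `p i`
  let y : (Fin d → ℝ) → ι → ℝ := fun t i => (∑ l ∈ Cl i, β l * f t l) / m i
  have hy0 : ∀ t i, 0 ≤ y t i := fun t i =>
    div_nonneg (Finset.sum_nonneg fun l _ => mul_nonneg (hβ l) (hf0 t l)) (hm0 i).le
  have hsum : ∀ t, ∑ i, a i * y t i ≤ ∑ l, β l * Real.log (1 + (t ⬝ᵥ u l) ^ 2) := by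
    intro t
    calc ∑ i, a i * y t i ≤ ∑ i, 2 * m i * y t i :=
          Finset.sum_le_sum fun i _ => mul_le_mul_of_nonneg_right (hm i) (hy0 t i)
      _ = ∑ i, ∑ l ∈ Cl i, β l * Real.log (1 + (t ⬝ᵥ u l) ^ 2) := by
          refine Finset.sum_congr rfl fun i _ => ?_
          simp only [y]
          rw [mul_assoc, mul_div_cancel₀ _ (hm0 i).ne', Finset.mul_sum]
          exact Finset.sum_congr rfl fun l _ => by simp only [f]; ring
      _ = ∑ l ∈ Finset.univ.biUnion Cl, β l * Real.log (1 + (t ⬝ᵥ u l) ^ 2) :=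
          (Finset.sum_biUnion fun i _ j _ hij => hdisj i j hij).symm
      _ ≤ _ := Finset.sum_le_sum_of_subset_of_nonneg (Finset.subset_univ _) fun l _ _ =>
          mul_nonneg (hβ l) (Real.log_nonneg (by nlinarith [sq_nonneg (t ⬝ᵥ u l)]))
  -- weights of the choices of one point per cluster of the basis
  let W : (Fin d → ι) → (Fin d → Fin n) → ℝ := fun b x => ∏ k, β (x k) / m (b k)
  have hW0 : ∀ b x, 0 ≤ W b x := fun b x =>
    Finset.prod_nonneg fun k _ => div_nonneg (hβ _) (hm0 _).le
  have hWsum : ∀ b : Fin d → ι, ∑ x ∈ Fintype.piFinset fun k => Cl (b k), W b x = 1 := by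
    intro b
    rw [← Finset.prod_univ_sum (fun k => Cl (b k)) fun k l => β l / m (b k)]
    refine Finset.prod_eq_one fun k _ => ?_
    rw [← Finset.sum_div, div_self (hm0 _).ne']
  have hpt : ∀ t, Real.exp (-∑ l, β l * Real.log (1 + (t ⬝ᵥ u l) ^ 2)) ≤
      ∑ b ∈ S, ∑ x ∈ Fintype.piFinset fun k => Cl (b k),
        W b x * ∏ k, (1 + (t ⬝ᵥ u (x k)) ^ 2) ^ (-κ / 2) := by
    intro t
    obtain ⟨b, hb, hby⟩ := exists_linearIndependent_mul_sum_le p a (y t) (fun i => (ha i).le) (hy0 t)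
      (by linarith : (0 : ℝ) ≤ κ) hspan hJ
    have hbS : b ∈ S := by simpa [S] using hb
    calc Real.exp (-∑ l, β l * Real.log (1 + (t ⬝ᵥ u l) ^ 2))
        ≤ Real.exp (∑ k, -κ * y t (b k)) := by
          rw [Real.exp_le_exp, ← Finset.mul_sum]
          linarith [hsum t]
      _ = ∏ k, Real.exp (-κ * y t (b k)) := Real.exp_sum _ _
      _ ≤ ∏ k, ∑ l ∈ Cl (b k), β l / m (b k) * Real.exp (-κ * f t l) :=
          Finset.prod_le_prod (fun k _ => (Real.exp_pos _).le) fun k _ =>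
            exp_neg_mul_div_le _ hβ (hm0 _) κ _
      _ = ∑ x ∈ Fintype.piFinset fun k => Cl (b k),
            W b x * ∏ k, (1 + (t ⬝ᵥ u (x k)) ^ 2) ^ (-κ / 2) := by
          rw [Finset.prod_univ_sum]
          refine Finset.sum_congr rfl fun x _ => ?_
          rw [Finset.prod_mul_distrib]
          simp only [hfexp, W]
      _ ≤ _ := Finset.single_le_sum (f := fun b => ∑ x ∈ Fintype.piFinset fun k => Cl (b k),
            W b x * ∏ k, (1 + (t ⬝ᵥ u (x k)) ^ 2) ^ (-κ / 2))
          (fun b _ => Finset.sum_nonneg fun x _ => mul_nonneg (hW0 b x)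
            (Finset.prod_nonneg fun k _ => by positivity)) hbS
  have hmeas : ∀ x : Fin d → Fin n, Measurable fun t : Fin d → ℝ =>
      ENNReal.ofReal (∏ k, (1 + (t ⬝ᵥ u (x k)) ^ 2) ^ (-κ / 2)) := by
    intro x
    refine ENNReal.measurable_ofReal.comp (Finset.measurable_fun_prod _ fun k _ => ?_)
    have : Measurable fun t : Fin d → ℝ => t ⬝ᵥ u (x k) :=
      (Continuous.dotProduct continuous_id continuous_const).measurable
    exact (measurable_const.add (this.pow_const 2)).pow_const _
  calc ∫⁻ t in {t : Fin d → ℝ | R₀ < ‖t‖},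
        ENNReal.ofReal (Real.exp (-∑ l, β l * Real.log (1 + (t ⬝ᵥ u l) ^ 2)))
      ≤ ∫⁻ t in {t : Fin d → ℝ | R₀ < ‖t‖}, ∑ b ∈ S, ∑ x ∈ Fintype.piFinset fun k => Cl (b k),
          ENNReal.ofReal (W b x) *
            ENNReal.ofReal (∏ k, (1 + (t ⬝ᵥ u (x k)) ^ 2) ^ (-κ / 2)) := by
        refine lintegral_mono fun t => (ENNReal.ofReal_le_ofReal (hpt t)).trans_eq ?_
        rw [ENNReal.ofReal_sum_of_nonneg fun b _ => Finset.sum_nonneg fun x _ =>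
          mul_nonneg (hW0 b x) (Finset.prod_nonneg fun k _ => by positivity)]
        refine Finset.sum_congr rfl fun b _ => ?_
        rw [ENNReal.ofReal_sum_of_nonneg fun x _ =>
          mul_nonneg (hW0 b x) (Finset.prod_nonneg fun k _ => by positivity)]
        exact Finset.sum_congr rfl fun x _ => ENNReal.ofReal_mul (hW0 b x)
    _ = ∑ b ∈ S, ∑ x ∈ Fintype.piFinset fun k => Cl (b k), ENNReal.ofReal (W b x) *
          ∫⁻ t in {t : Fin d → ℝ | R₀ < ‖t‖},
            ENNReal.ofReal (∏ k, (1 + (t ⬝ᵥ u (x k)) ^ 2) ^ (-κ / 2)) := by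
        rw [lintegral_finsetSum _ fun b _ => Finset.measurable_fun_sum _ fun x _ =>
          (hmeas x).const_mul _]
        refine Finset.sum_congr rfl fun b _ => ?_
        rw [lintegral_finsetSum _ fun x _ => (hmeas x).const_mul _]
        exact Finset.sum_congr rfl fun x _ => lintegral_const_mul _ (hmeas x)
    _ ≤ ∑ b ∈ S, ∑ x ∈ Fintype.piFinset fun k => Cl (b k), ENNReal.ofReal (W b x) * η' := by
        refine Finset.sum_le_sum fun b hb => Finset.sum_le_sum fun x hx => ?_
        gcongr
        have hxV : (fun k => u (x k)) ∈ V b := by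
          refine hδV b hb ?_
          rw [Metric.mem_ball, dist_pi_lt_iff hδ0]
          intro k
          have := Fintype.mem_piFinset.1 hx k
          simpa [Cl] using this
        refine (lintegral_mono_set fun t ht => ?_).trans (hR b hb _ hxV)
        exact (hR₀ b hb).trans_lt ht
    _ = ∑ b ∈ S, η' := by
        refine Finset.sum_congr rfl fun b _ => ?_
        rw [← Finset.sum_mul, ← ENNReal.ofReal_sum_of_nonneg fun x _ => hW0 b x, hWsum b,
          ENNReal.ofReal_one, one_mul]
    _ = S.card * η' := by rw [Finset.sum_const, nsmul_eq_mul]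
    _ ≤ (S.card + 1) * η' := by gcongr; exact le_self_add
    _ = η := ENNReal.mul_div_cancel (by simp) (by finiteness)

/-! ### Plancherel's theorem for integrable functions -/

section Plancherel

open FourierTransform SchwartzMap

variable {V : Type*} [NormedAddCommGroup V] [InnerProductSpace ℝ V] [FiniteDimensional ℝ V]
  [MeasurableSpace V] [BorelSpace V]

theorem integral_fourier_schwartz_smul {h : V → ℂ} (hh : Integrable h) (ψ : 𝓢(V, ℂ)) :
    ∫ x, (𝓕 ψ) x • h x = ∫ x, ψ x • 𝓕 h x := by
  have := VectorFourier.integral_fourierIntegral_smul_eq_flip (L := innerₗ V)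
    (μ := (volume : Measure V)) (ν := (volume : Measure V)) Real.continuous_fourierChar
    continuous_inner (f := ψ) (g := h) ψ.integrable hh
  rw [flip_innerₗ] at this
  simp only [SchwartzMap.fourier_coe]
  exact this

theorem ae_eq_of_integral_schwartz_smul_eq {f g : V → ℂ} (hf : LocallyIntegrable f)
    (hg : LocallyIntegrable g) (h : ∀ ψ : 𝓢(V, ℂ), ∫ x, ψ x • f x = ∫ x, ψ x • g x) : f =ᵐ[volume] g := by
  refine ae_eq_of_integral_contDiff_smul_eq hf hg fun φ hφ hc => ?_
  have hc' : HasCompactSupport fun x => (φ x : ℂ) := hc.comp_left (g := Complex.ofReal) (by simp)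
  have hφ' : ContDiff ℝ (⊤ : ℕ∞) fun x => (φ x : ℂ) := Complex.ofRealCLM.contDiff.comp hφ
  simpa using h (hc'.toSchwartzMap hφ')

/-- For integrable `h`, square integrability of `h` and of its Fourier transform are equivalent, with equal
norms: the two `L²` extensions of the transform agree when tested against Schwartz functions. -/
theorem memLp_two_and_eLpNorm_fourier_eq {h : V → ℂ} (hh : Integrable h)
    (h2 : MemLp h 2 volume ∨ MemLp (𝓕 h) 2 volume) :
    MemLp h 2 volume ∧ MemLp (𝓕 h) 2 volume ∧
      eLpNorm (𝓕 h) 2 volume = eLpNorm h 2 volume := by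
  have hcont : Continuous (𝓕 h) := VectorFourier.fourierIntegral_continuous
    Real.continuous_fourierChar continuous_inner hh
  have key : ∀ H : Lp (α := V) ℂ 2, ((H : V → ℂ) =ᵐ[volume] h ∨
      ((𝓕 H : Lp (α := V) ℂ 2) : V → ℂ) =ᵐ[volume] 𝓕 h) →
      (H : V → ℂ) =ᵐ[volume] h ∧ ((𝓕 H : Lp (α := V) ℂ 2) : V → ℂ) =ᵐ[volume] 𝓕 h := by
    intro H hH
    have hdual : ∀ ψ : 𝓢(V, ℂ), ∫ x, (𝓕 ψ) x • H x =
        ∫ x, ψ x • ((𝓕 H : Lp (α := V) ℂ 2 volume) : V → ℂ) x := by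
      intro ψ
      have h1 := DFunLike.congr_fun (Lp.fourier_toTemperedDistribution_eq H) ψ
      rw [TemperedDistribution.fourier_apply, Lp.toTemperedDistribution_apply,
        Lp.toTemperedDistribution_apply] at h1
      exact h1
    rcases hH with hH | hH
    · refine ⟨hH, ae_eq_of_integral_schwartz_smul_eq
        ((Lp.memLp _).locallyIntegrable (by norm_num)) hcont.locallyIntegrable fun ψ => ?_⟩
      rw [← hdual, ← integral_fourier_schwartz_smul hh]
      exact integral_congr_ae (hH.mono fun x hx => by simp only [hx])
    · refine ⟨ae_eq_of_integral_schwartz_smul_eq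
        ((Lp.memLp _).locallyIntegrable (by norm_num)) hh.locallyIntegrable fun ψ => ?_, hH⟩
      obtain ⟨χ, rfl⟩ : ∃ χ : 𝓢(V, ℂ), 𝓕 χ = ψ := ⟨𝓕⁻ ψ, by simp⟩
      rw [hdual, integral_fourier_schwartz_smul hh]
      exact integral_congr_ae (hH.mono fun x hx => by simp only [hx])
  have hex : ∃ H : Lp (α := V) ℂ 2, (H : V → ℂ) =ᵐ[volume] h ∧
      ((𝓕 H : Lp (α := V) ℂ 2) : V → ℂ) =ᵐ[volume] 𝓕 h := by
    rcases h2 with h2 | h2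
    · exact ⟨h2.toLp h, key _ (Or.inl h2.coeFn_toLp)⟩
    · refine ⟨𝓕⁻ (h2.toLp (𝓕 h)), key _ (Or.inr ?_)⟩
      rw [fourier_fourierInv_eq]
      exact h2.coeFn_toLp
  obtain ⟨H, h1, h3⟩ := hex
  refine ⟨(memLp_congr_ae h1).1 (Lp.memLp H), (memLp_congr_ae h3).1 (Lp.memLp _), ?_⟩
  rw [← eLpNorm_congr_ae h1, ← eLpNorm_congr_ae h3]
  have := Lp.norm_fourier_eq H
  rw [Lp.norm_def, Lp.norm_def] at this
  exact (ENNReal.toReal_eq_toReal_iff' (Lp.eLpNorm_ne_top _) (Lp.eLpNorm_ne_top _)).1 this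

end Plancherel

/-- The characteristic function `t ↦ ∫ exp (i⟨t, x⟩) h(x) dx` of a density. -/
def charTransform (h : (Fin d → ℝ) → ℝ) (t : Fin d → ℝ) : ℂ :=
  ∫ x, Complex.exp (Complex.I * (t ⬝ᵥ x : ℝ)) * (h x : ℂ)

open FourierTransform in
/-- Plancherel's theorem for the sup-normed space `Fin d → ℝ` and characteristic functions without `2π` in the
exponent, by transport from `EuclideanSpace`. -/
theorem lintegral_charTransform_sq {h : (Fin d → ℝ) → ℝ} (hh : Integrable h)
    (h2 : MemLp h 2 volume ∨ ∫⁻ t, ‖charTransform h t‖ₑ ^ 2 ≠ ⊤) :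
    MemLp h 2 volume ∧ ∫⁻ t, ‖charTransform h t‖ₑ ^ 2 =
      ENNReal.ofReal ((2 * Real.pi) ^ d) * eLpNorm h 2 volume ^ 2 := by
  let e := MeasurableEquiv.toLp 2 (Fin d → ℝ)
  have he : MeasurePreserving e.symm := PiLp.volume_preserving_ofLp (Fin d)
  let H : EuclideanSpace ℝ (Fin d) → ℂ := fun x => (h (e.symm x) : ℂ)
  have hH : Integrable H := by
    have := (he.integrable_comp_emb e.symm.measurableEmbedding (g := h)).2 hh
    exact this.ofReal
  have hchar : ∀ t : Fin d → ℝ, charTransform h t = 𝓕 H (-(2 * Real.pi)⁻¹ • (WithLp.toLp 2 t)) := by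
    intro t
    rw [charTransform, Real.fourier_eq', ← he.integral_comp' (f := e.symm)]
    refine integral_congr_ae (Eventually.of_forall fun x => ?_)
    simp only [H, smul_eq_mul]
    congr 2
    have h1 : inner ℝ x (-(2 * Real.pi)⁻¹ • WithLp.toLp 2 t) =
        -(2 * Real.pi)⁻¹ * (t ⬝ᵥ (e.symm x)) := by
      rw [inner_smul_right]
      rfl
    rw [h1]
    have hpi : (Real.pi : ℂ) ≠ 0 := by exact_mod_cast Real.pi_ne_zero
    push_cast
    field_simp
  have hcont : Continuous (𝓕 H) := VectorFourier.fourierIntegral_continuous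
    Real.continuous_fourierChar continuous_inner hH
  have hsq : ∀ {α : Type} [MeasurableSpace α] (μ : Measure α) (F : α → ℂ),
      eLpNorm F 2 μ ^ 2 = ∫⁻ x, ‖F x‖ₑ ^ 2 ∂μ := by
    intro α _ μ F
    have := eLpNorm_nnreal_pow_eq_lintegral (f := F) (μ := μ) (p := 2) (by norm_num)
    simpa using this
  have hscale : ∫⁻ t, ‖charTransform h t‖ₑ ^ 2 =
      ENNReal.ofReal ((2 * Real.pi) ^ d) * eLpNorm (𝓕 H) 2 volume ^ 2 := by
    rw [hsq]
    have hr : -(2 * Real.pi)⁻¹ ≠ 0 := by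
      have := Real.pi_pos; simp [Real.pi_ne_zero]
    have hmeas : Measurable fun ξ => ‖𝓕 H ξ‖ₑ ^ 2 := by
      exact (hcont.enorm.measurable).pow_const 2
    simp only [hchar]
    have h1 := (PiLp.volume_preserving_toLp (Fin d)).lintegral_comp
      (f := fun x => ‖𝓕 H (-(2 * Real.pi)⁻¹ • x)‖ₑ ^ 2)
      (hmeas.comp (measurable_const_smul _))
    rw [h1]
    have h3 := lintegral_map (μ := (volume : Measure (EuclideanSpace ℝ (Fin d)))) hmeas
      (measurable_const_smul (-(2 * Real.pi)⁻¹))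
    rw [← h3, Measure.map_addHaar_smul _ hr, lintegral_smul_measure, smul_eq_mul]
    congr 2
    rw [finrank_euclideanSpace_fin, abs_inv, abs_pow, abs_neg, abs_inv,
      abs_of_pos (by positivity : 0 < 2 * Real.pi), inv_pow, inv_inv]
  have hnorm : eLpNorm H 2 volume = eLpNorm h 2 volume := by
    have h1 : eLpNorm H 2 volume = eLpNorm (fun x => h (e.symm x)) 2 volume :=
      eLpNorm_congr_norm_ae (Eventually.of_forall fun x => by simp [H])
    rw [h1]
    exact eLpNorm_comp_measurePreserving hh.aestronglyMeasurable he
  have hmem : MemLp h 2 volume ↔ MemLp H 2 volume := by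
    simp only [MemLp, hnorm, hh.aestronglyMeasurable, hH.aestronglyMeasurable, true_and]
  have hor : MemLp H 2 volume ∨ MemLp (𝓕 H) 2 volume := by
    rcases h2 with h2 | h2
    · exact Or.inl (hmem.1 h2)
    · refine Or.inr ⟨hcont.aestronglyMeasurable, lt_top_iff_ne_top.2 fun h0 => h2 ?_⟩
      rw [hscale, h0]
      have : ENNReal.ofReal ((2 * Real.pi) ^ d) ≠ 0 := by
        have := Real.pi_pos
        simp only [ne_eq, ENNReal.ofReal_eq_zero, not_le]; positivity
      simp [this]
  obtain ⟨ha, -, hb⟩ := memLp_two_and_eLpNorm_fourier_eq hH hor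
  exact ⟨hmem.2 ha, by rw [hscale, hb, hnorm]⟩

/-! ### Square integrability forces enough mass outside every subspace -/

/-- A basis adapted to `V` and a complement of it; `I` indexes the part in the complement. -/
theorem exists_basis_repr_eq_zero (V : Submodule ℝ (Fin d → ℝ)) :
    ∃ (e : Module.Basis (Fin d) ℝ (Fin d → ℝ)) (I : Finset (Fin d)),
      (I.card : ℝ) = d - Module.finrank ℝ V ∧ ∀ x ∈ V, ∀ j ∈ I, e.repr x j = 0 := by
  classical
  obtain ⟨W, hW⟩ := V.exists_isCompl
  have hdim := Submodule.finrank_add_eq_of_isCompl hW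
  rw [Module.finrank_fin_fun] at hdim
  let bV := Module.finBasis ℝ V
  let bW := Module.finBasis ℝ W
  let E := Submodule.prodEquivOfIsCompl V W hW
  let σ : Fin (Module.finrank ℝ V) ⊕ Fin (Module.finrank ℝ W) ≃ Fin d :=
    finSumFinEquiv.trans (finCongr hdim)
  let e := ((bV.prod bW).map E).reindex σ
  refine ⟨e, Finset.univ.image (σ ∘ Sum.inr), ?_, ?_⟩
  · rw [Finset.card_image_of_injective _ (σ.injective.comp Sum.inr_injective), Finset.card_univ,
      Fintype.card_fin]
    have h1 : ((Module.finrank ℝ V : ℕ) : ℝ) + (Module.finrank ℝ W : ℕ) = d := by exact_mod_cast hdim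
    linarith
  · intro x hx j hj
    obtain ⟨l, -, rfl⟩ := Finset.mem_image.1 hj
    have h1 : E.symm x = (⟨x, hx⟩, 0) := Submodule.prodEquivOfIsCompl_symm_apply_left V W hW ⟨x, hx⟩
    simp [e, h1]

/-- If `∏ (1 + ⟨t, p i⟩²) ^ (-a i)` is integrable, then the weights outside a proper subspace `V` exceed half
its codimension: otherwise the integral over boxes of side `R` in the directions dual to a complement
of `V`, at distance `R` from the origin, would not tend to `0` as `R → ∞`. -/
theorem codim_lt_of_lintegral_exp_ne_top {ι : Type*} [Fintype ι] {p : ι → Fin d → ℝ} {a : ι → ℝ}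
    (ha : ∀ i, 0 ≤ a i)
    (hint : ∫⁻ t : Fin d → ℝ,
      ENNReal.ofReal (Real.exp (-∑ i, a i * Real.log (1 + (t ⬝ᵥ p i) ^ 2))) ≠ ⊤)
    {V : Submodule ℝ (Fin d → ℝ)} (hV : V ≠ ⊤) :
    (d : ℝ) - Module.finrank ℝ V < 2 * ∑ i, (V : Set (Fin d → ℝ))ᶜ.indicator 1 (p i) * a i := by
  classical
  by_contra! hcon
  obtain ⟨e, I, hI, hrepr⟩ := exists_basis_repr_eq_zero V
  set m := ∑ i, (V : Set (Fin d → ℝ))ᶜ.indicator 1 (p i) * a i with hm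
  have hInon : I.Nonempty := by
    rw [← Finset.card_pos]
    have h1 : Module.finrank ℝ V < d := by
      have := Submodule.finrank_lt (lt_top_iff_ne_top.2 hV).ne
      simpa using this
    have h2 : (0 : ℝ) < I.card := by
      rw [hI]; have : (Module.finrank ℝ V : ℝ) < d := by exact_mod_cast h1
      linarith
    exact_mod_cast h2
  obtain ⟨j₀, hj₀⟩ := hInon
  let M : Matrix (Fin d) (Fin d) ℝ := Matrix.of fun j => e j
  have hMdet : M.det ≠ 0 := by
    have := Matrix.linearIndependent_rows_iff_isUnit (A := M) |>.1 e.linearIndependent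
    exact ((Matrix.isUnit_iff_isUnit_det _).1 this).ne_zero
  have hMm : Measurable (Matrix.toLin' M) := (LinearMap.continuous_on_pi _).measurable
  -- the coefficients of the `p i` in the basis are bounded by `C`
  obtain ⟨C, hC1, hC⟩ : ∃ C : ℝ, 1 ≤ C ∧ ∀ i, ∑ j, |e.repr (p i) j| ≤ C := by
    refine ⟨1 + ∑ i, ∑ j, |e.repr (p i) j|, ?_, fun i => ?_⟩
    · have : 0 ≤ ∑ i, ∑ j, |e.repr (p i) j| :=
        Finset.sum_nonneg fun i _ => Finset.sum_nonneg fun j _ => abs_nonneg _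
      linarith
    · have := Finset.single_le_sum (f := fun i => ∑ j, |e.repr (p i) j|)
        (fun i _ => Finset.sum_nonneg fun j _ => abs_nonneg _) (Finset.mem_univ i)
      linarith
  have hdot : ∀ (t : Fin d → ℝ) i, t ⬝ᵥ p i = ∑ j, e.repr (p i) j * (M *ᵥ t) j := by
    intro t i
    conv_lhs => rw [← e.sum_repr (p i)]
    rw [dotProduct_sum]
    refine Finset.sum_congr rfl fun j _ => ?_
    rw [dotProduct_smul, smul_eq_mul, dotProduct_comm]
    rfl
  let box : ℝ → Set (Fin d → ℝ) := fun R =>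
    Set.univ.pi fun j => if j ∈ I then Set.Icc R (2 * R) else Set.Icc 0 1
  have hboxm : ∀ R, MeasurableSet (box R) := fun R => MeasurableSet.univ_pi fun j => by
    split_ifs <;> exact measurableSet_Icc
  have hvol : ∀ R : ℝ, 0 ≤ R → volume (Matrix.toLin' M ⁻¹' box R) =
      ENNReal.ofReal (|M.det⁻¹| * R ^ I.card) := by
    intro R hR
    rw [← Measure.map_apply hMm (hboxm R), Real.map_matrix_volume_pi_eq_smul_volume_pi hMdet,
      Measure.smul_apply, smul_eq_mul, ENNReal.ofReal_mul (abs_nonneg _)]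
    congr 1
    rw [volume_pi_pi]
    have : ∀ j, volume (if j ∈ I then Set.Icc R (2 * R) else Set.Icc (0 : ℝ) 1) =
        if j ∈ I then ENNReal.ofReal R else 1 := by
      intro j
      split_ifs
      · rw [Real.volume_Icc]; congr 1; ring
      · simp
    simp only [this]
    rw [Finset.prod_ite_mem, Finset.univ_inter, Finset.prod_const, ENNReal.ofReal_pow hR]
  set K := ∑ i, a i * Real.log (5 * C ^ 2) with hK
  have hlow : ∀ R : ℝ, 1 ≤ R → ∀ t ∈ Matrix.toLin' M ⁻¹' box R,
      Real.exp (-K) * R ^ (-(2 * m)) ≤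
        Real.exp (-∑ i, a i * Real.log (1 + (t ⬝ᵥ p i) ^ 2)) := by
    intro R hR t ht
    have hR0 : 0 < R := by linarith
    have hbox : ∀ j, if j ∈ I then R ≤ (M *ᵥ t) j ∧ (M *ᵥ t) j ≤ 2 * R
        else 0 ≤ (M *ᵥ t) j ∧ (M *ᵥ t) j ≤ 1 := by
      intro j
      have := ht j trivial
      rw [Matrix.toLin'_apply] at this
      by_cases hj : j ∈ I
      · simpa [hj] using this
      · simpa [hj] using this
    rw [Real.rpow_def_of_pos hR0, ← Real.exp_add, Real.exp_le_exp]
    have hterm : ∀ i, a i * Real.log (1 + (t ⬝ᵥ p i) ^ 2) ≤ a i * Real.log (5 * C ^ 2) +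
        (V : Set (Fin d → ℝ))ᶜ.indicator 1 (p i) * a i * (2 * Real.log R) := by
      intro i
      by_cases hi : p i ∈ V
      · rw [Set.indicator_of_notMem (by simpa using hi), zero_mul, zero_mul, add_zero]
        refine mul_le_mul_of_nonneg_left (Real.log_le_log (by positivity) ?_) (ha i)
        have h1 : |t ⬝ᵥ p i| ≤ C := by
          rw [hdot]
          refine (Finset.abs_sum_le_sum_abs _ _).trans (le_trans (Finset.sum_le_sum fun j _ => ?_) (hC i))
          rw [abs_mul]
          have hb := hbox j
          by_cases hj : j ∈ I
          · rw [hrepr _ hi j hj]; simp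
          · rw [if_neg hj] at hb
            refine mul_le_of_le_one_right (abs_nonneg _) ?_
            rw [abs_of_nonneg hb.1]; exact hb.2
        have h2 : (t ⬝ᵥ p i) ^ 2 ≤ C ^ 2 := sq_le_sq' (abs_le.1 h1).1 (abs_le.1 h1).2
        nlinarith
      · rw [Set.indicator_of_mem (by simpa using hi), Pi.one_apply, one_mul, ← mul_add]
        refine mul_le_mul_of_nonneg_left ?_ (ha i)
        have h1 : |t ⬝ᵥ p i| ≤ C * (2 * R) := by
          rw [hdot]
          refine (Finset.abs_sum_le_sum_abs _ _).trans ?_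
          calc ∑ j, |e.repr (p i) j * (M *ᵥ t) j| ≤ ∑ j, |e.repr (p i) j| * (2 * R) := by
                refine Finset.sum_le_sum fun j _ => ?_
                rw [abs_mul]
                refine mul_le_mul_of_nonneg_left ?_ (abs_nonneg _)
                have hb := hbox j
                by_cases hj : j ∈ I
                · rw [if_pos hj] at hb
                  rw [abs_of_nonneg (by linarith [hb.1])]; exact hb.2
                · rw [if_neg hj] at hb
                  rw [abs_of_nonneg hb.1]; linarith [hb.2]
            _ ≤ C * (2 * R) := by
                rw [← Finset.sum_mul]
                exact mul_le_mul_of_nonneg_right (hC i) (by linarith)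
        have h2 : (t ⬝ᵥ p i) ^ 2 ≤ (C * (2 * R)) ^ 2 := sq_le_sq' (abs_le.1 h1).1 (abs_le.1 h1).2
        have h3 : 1 ≤ C ^ 2 * R ^ 2 := by
          rw [← mul_pow]; exact one_le_pow₀ (by nlinarith)
        have h4 : 1 + (t ⬝ᵥ p i) ^ 2 ≤ 5 * C ^ 2 * R ^ 2 := by nlinarith
        refine (Real.log_le_log (by positivity) h4).trans_eq ?_
        rw [Real.log_mul (by positivity) (by positivity), Real.log_pow]
        push_cast; ring
    have := Finset.sum_le_sum fun i (_ : i ∈ Finset.univ) => hterm i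
    rw [Finset.sum_add_distrib, ← hK, ← Finset.sum_mul, ← hm] at this
    linarith
  have hmeas : Measurable fun t : Fin d → ℝ =>
      ENNReal.ofReal (Real.exp (-∑ i, a i * Real.log (1 + (t ⬝ᵥ p i) ^ 2))) := by
    have h1 : ∀ i, Measurable fun t : Fin d → ℝ => t ⬝ᵥ p i := fun i =>
      (Continuous.dotProduct continuous_id continuous_const).measurable
    have h2 : ∀ i, Measurable fun t : Fin d → ℝ => Real.log (1 + (t ⬝ᵥ p i) ^ 2) := fun i =>
      ((measurable_const.add ((h1 i).pow_const 2))).log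
    exact ENNReal.measurable_ofReal.comp (Real.measurable_exp.comp
      (Finset.measurable_fun_sum _ fun i _ => (h2 i).const_mul _).neg)
  have htail := tendsto_setLIntegral_norm_gt hmeas hint
  set c := |M.det⁻¹| * Real.exp (-K) with hc
  have hc0 : 0 < c := mul_pos (abs_pos.2 (inv_ne_zero hMdet)) (Real.exp_pos _)
  obtain ⟨n, hn⟩ := ((tendsto_order.1 htail).2 _ (ENNReal.ofReal_pos.2 hc0)).exists
  -- the box of side `R` lies in the tail region
  set D := ∑ l, |e j₀ l| with hD
  have hD0 : 0 ≤ D := Finset.sum_nonneg fun l _ => abs_nonneg _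
  set R : ℝ := 1 + D * n with hR
  have hR1 : 1 ≤ R := by rw [hR]; have : 0 ≤ D * n := by positivity
                         linarith
  have hsub : Matrix.toLin' M ⁻¹' box R ⊆ {t : Fin d → ℝ | (n : ℝ) < ‖t‖} := by
    intro t ht
    have h1 := ht j₀ trivial
    simp only [if_pos hj₀, Matrix.toLin'_apply, Set.mem_Icc] at h1
    have h2 : (M *ᵥ t) j₀ ≤ D * ‖t‖ := by
      calc (M *ᵥ t) j₀ = ∑ l, e j₀ l * t l := rfl
        _ ≤ ∑ l, |e j₀ l| * ‖t‖ := Finset.sum_le_sum fun l _ => by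
            refine (le_abs_self _).trans ?_
            rw [abs_mul]
            exact mul_le_mul_of_nonneg_left (norm_le_pi_norm t l) (abs_nonneg _)
        _ = D * ‖t‖ := by rw [← Finset.sum_mul]
    simp only [Set.mem_ofPred_eq]
    by_contra! hle
    have := mul_le_mul_of_nonneg_left hle hD0
    linarith [h1.1]
  refine absurd hn (not_lt.2 ?_)
  calc ENNReal.ofReal c ≤ ENNReal.ofReal (Real.exp (-K) * R ^ (-(2 * m))) *
        volume (Matrix.toLin' M ⁻¹' box R) := by
        rw [hvol R (by linarith), ← ENNReal.ofReal_mul (by positivity)]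
        refine ENNReal.ofReal_le_ofReal ?_
        have h1 : 1 ≤ R ^ (-(2 * m)) * R ^ I.card := by
          rw [← Real.rpow_natCast R, ← Real.rpow_add (by linarith)]
          refine Real.one_le_rpow hR1 ?_
          rw [hI]; linarith
        calc c = c * 1 := (mul_one c).symm
          _ ≤ c * (R ^ (-(2 * m)) * R ^ I.card) := mul_le_mul_of_nonneg_left h1 hc0.le
          _ = _ := by rw [hc]; ring
    _ = ∫⁻ t in Matrix.toLin' M ⁻¹' box R, ENNReal.ofReal (Real.exp (-K) * R ^ (-(2 * m))) := by
        rw [setLIntegral_const]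
    _ ≤ ∫⁻ t in Matrix.toLin' M ⁻¹' box R,
          ENNReal.ofReal (Real.exp (-∑ i, a i * Real.log (1 + (t ⬝ᵥ p i) ^ 2))) :=
        setLIntegral_mono' (hMm (hboxm R)) fun t ht => ENNReal.ofReal_le_ofReal (hlow R hR1 t ht)
    _ ≤ _ := lintegral_mono_set hsub

/-- The strict inequalities of `codim_lt_of_lintegral_exp_ne_top` leave room, uniformly in the finitely
many subspaces, to lose a fraction of the mass. -/
theorem exists_slack_of_lintegral_exp_ne_top {ι : Type*} [Fintype ι] {p : ι → Fin d → ℝ} {a : ι → ℝ}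
    (ha : ∀ i, 0 ≤ a i)
    (hint : ∫⁻ t : Fin d → ℝ,
      ENNReal.ofReal (Real.exp (-∑ i, a i * Real.log (1 + (t ⬝ᵥ p i) ^ 2))) ≠ ⊤) :
    ∃ κ θ : ℝ, 1 < κ ∧ 0 < θ ∧ θ < 1 ∧ ∀ J : Set ι,
      κ * ((d : ℝ) - Module.finrank ℝ (Submodule.span ℝ (p '' J))) ≤
        ∑ i, (Submodule.span ℝ (p '' J) : Set (Fin d → ℝ))ᶜ.indicator 1 (p i) * (2 * θ * a i) := by
  classical
  have h1 : ∀ᶠ ε : ℝ in 𝓝[>] 0, ∀ J : Set ι,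
      (1 + ε) * ((d : ℝ) - Module.finrank ℝ (Submodule.span ℝ (p '' J))) ≤
        (1 - ε) * (2 * ∑ i, (Submodule.span ℝ (p '' J) : Set (Fin d → ℝ))ᶜ.indicator 1 (p i) * a i) := by
    refine eventually_all.2 fun J => ?_
    by_cases hV : Submodule.span ℝ (p '' J) = ⊤
    · have h2 : ∀ i, (Submodule.span ℝ (p '' J) : Set (Fin d → ℝ))ᶜ.indicator (1 : (Fin d → ℝ) → ℝ) (p i) = 0 :=
        fun i => Set.indicator_of_notMem (by rw [hV]; simp) _
      refine Eventually.of_forall fun ε => ?_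
      simp only [h2, zero_mul, Finset.sum_const_zero, mul_zero]
      rw [hV]; simp
    · have h2 := codim_lt_of_lintegral_exp_ne_top ha hint hV
      set x := (d : ℝ) - Module.finrank ℝ (Submodule.span ℝ (p '' J))
      set y := 2 * ∑ i, (Submodule.span ℝ (p '' J) : Set (Fin d → ℝ))ᶜ.indicator 1 (p i) * a i
      have t1 : Tendsto (fun ε : ℝ => (1 - ε) * y - (1 + ε) * x) (𝓝[>] 0) (𝓝 (y - x)) :=
        (Continuous.tendsto' (by fun_prop) _ _ (by ring)).mono_left nhdsWithin_le_nhds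
      filter_upwards [t1.eventually_const_lt (sub_pos.2 h2)] with ε hε
      linarith
  have h2 : ∀ᶠ ε : ℝ in 𝓝[>] 0, ε < 1 :=
    (tendsto_id.mono_left nhdsWithin_le_nhds).eventually_lt_const (by norm_num)
  obtain ⟨ε, hε, hε1, hε0⟩ := (h1.and (h2.and self_mem_nhdsWithin)).exists
  have hε0 : 0 < ε := hε0
  refine ⟨1 + ε, 1 - ε, by linarith, by linarith, by linarith, fun J => (hε J).trans_eq ?_⟩
  rw [Finset.mul_sum, Finset.mul_sum]
  exact Finset.sum_congr rfl fun i _ => by ring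

/-! ### Existence of the density of a finite Gamma convolution -/

theorem integral_gammaMeasure {a : ℝ} (ha : 0 < a) (F : ℝ → ℝ) :
    ∫ x, F x ∂(gammaMeasure a 1) =
      ∫ x in Set.Ioi 0, (Real.Gamma a)⁻¹ * (x ^ (a - 1) * Real.exp (-x)) * F x := by
  rw [gammaMeasure]
  have h1 : gammaPDF a 1 = fun x => ENNReal.ofReal (gammaPDFReal a 1 x) := rfl
  rw [h1, integral_withDensity_eq_integral_toReal_smul
    (measurable_gammaPDFReal a 1).ennreal_ofReal (Eventually.of_forall fun x => ENNReal.ofReal_lt_top)]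
  simp only [ENNReal.toReal_ofReal (gammaPDFReal_nonneg ha one_pos _), smul_eq_mul]
  rw [← integral_Ici_eq_integral_Ioi, ← integral_indicator measurableSet_Ici]
  refine integral_congr_ae (Eventually.of_forall fun x => ?_)
  by_cases hx : 0 ≤ x
  · rw [Set.indicator_of_mem (Set.mem_Ici.2 hx)]
    simp [gammaPDFReal, hx, mul_assoc]
  · rw [Set.indicator_of_notMem (by simpa using hx)]
    simp [gammaPDFReal, hx]

theorem mgf_gammaMeasure {a : ℝ} (ha : 0 < a) {t : ℝ} (ht : t < 1) :
    mgf id (gammaMeasure a 1) t = Real.exp (-a * Real.log (1 - t)) := by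
  have h1t : 0 < 1 - t := by linarith
  rw [mgf, integral_gammaMeasure ha]
  have h1 : ∀ x : ℝ, (Real.Gamma a)⁻¹ * (x ^ (a - 1) * Real.exp (-x)) * Real.exp (t * id x) =
      (Real.Gamma a)⁻¹ * (x ^ (a - 1) * Real.exp (-((1 - t) * x))) := by
    intro x
    rw [mul_assoc, mul_assoc, ← Real.exp_add]
    congr 3; simp only [id]; ring
  simp only [h1]
  rw [integral_const_mul, Real.integral_rpow_mul_exp_neg_mul_Ioi ha h1t, one_div,
    Real.inv_rpow h1t.le, mul_comm, mul_assoc, mul_inv_cancel₀ (Real.Gamma_pos_of_pos ha).ne', mul_one,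
    Real.rpow_def_of_pos h1t, ← Real.exp_neg]
  congr 1; ring

/-- A nonzero value of the integral certifies integrability, the junk value being `0`. -/
theorem Iio_one_subset_integrableExpSet {a : ℝ} (ha : 0 < a) :
    Set.Iio 1 ⊆ integrableExpSet id (gammaMeasure a 1) := by
  intro t ht
  by_contra hcon
  have h1 := mgf_gammaMeasure ha ht
  rw [mgf, integral_undef hcon] at h1
  exact (Real.exp_pos _).ne h1

/-- The complex moment generating function `(1 - z) ^ (-a)` of the Gamma distribution, continued from the
real axis by analyticity. -/
theorem complexMGF_gammaMeasure {a : ℝ} (ha : 0 < a) {z : ℂ} (hz : z.re < 1) :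
    complexMGF id (gammaMeasure a 1) z = Complex.exp (-a * Complex.log (1 - z)) := by
  let S : Set ℂ := {z | z.re < 1}
  have hint : ∀ w ∈ S, w.re ∈ interior (integrableExpSet id (gammaMeasure a 1)) := fun w hw =>
    interior_mono (Iio_one_subset_integrableExpSet ha) (by rw [interior_Iio]; exact hw)
  have hS : IsOpen S := isOpen_lt Complex.continuous_re continuous_const
  have h1 : AnalyticOnNhd ℂ (complexMGF id (gammaMeasure a 1)) S := fun w hw =>
    analyticAt_complexMGF (hint w hw)
  have h2 : AnalyticOnNhd ℂ (fun w => Complex.exp (-a * Complex.log (1 - w))) S := by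
    refine DifferentiableOn.analyticOnNhd (fun w hw => ?_) hS
    have hs : 1 - w ∈ Complex.slitPlane := by
      left; simp only [Complex.sub_re, Complex.one_re]; linarith [show w.re < 1 from hw]
    exact ((((differentiableAt_const 1).sub differentiableAt_id).clog hs).const_mul
      (-(a : ℂ))).cexp.differentiableWithinAt
  have hpre : IsPreconnected S := (convex_halfSpace_re_lt 1).isPreconnected
  have h0 : (0 : ℂ) ∈ S := by simp [S]
  refine h1.eqOn_of_preconnected_of_frequently_eq h2 hpre h0 ?_ hz
  have ht : Tendsto (fun x : ℝ => (x : ℂ)) (𝓝[≠] 0) (𝓝[≠] 0) := by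
    refine tendsto_nhdsWithin_iff.2 ⟨?_, ?_⟩
    · exact (Complex.continuous_ofReal.tendsto' 0 0 rfl).mono_left nhdsWithin_le_nhds
    · filter_upwards [self_mem_nhdsWithin] with x hx
      simpa using hx
  refine ht.frequently (Eventually.frequently ?_)
  filter_upwards [mem_nhdsWithin_of_mem_nhds (Iio_mem_nhds (zero_lt_one' ℝ))] with x hx
  have hx1 : (0 : ℝ) ≤ 1 - x := by have : x < 1 := hx; linarith
  rw [complexMGF_ofReal, mgf_gammaMeasure ha hx]
  have : (1 : ℂ) - x = ((1 - x : ℝ) : ℂ) := by push_cast; ring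
  rw [this, ← Complex.ofReal_log hx1]
  push_cast
  rfl

theorem pi_absolutelyContinuous_volume {n : ℕ} (μ : Fin n → Measure ℝ) [∀ i, SigmaFinite (μ i)]
    (h : ∀ i, μ i ≪ volume) : Measure.pi μ ≪ volume := by
  induction n with
  | zero =>
    rw [volume_pi]
    have : μ = fun _ => volume := funext fun i => i.elim0
    rw [this]
  | succ n ih =>
    have e1 := (measurePreserving_piFinSuccAbove μ 0).symm.map_eq
    have e2 := (measurePreserving_piFinSuccAbove (fun _ : Fin (n + 1) => (volume : Measure ℝ)) 0).symm.map_eq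
    rw [volume_pi, ← e1, ← e2]
    refine Measure.AbsolutelyContinuous.map (Measure.AbsolutelyContinuous.prod (h 0) ?_)
      (MeasurableEquiv.measurable _)
    have := ih (fun i => μ (Fin.succAbove 0 i)) fun i => h _
    rwa [volume_pi] at this

/-- The law of `∑ i, γ i • s i` with independent `γ i ∼ Γ(α i, 1)`. -/
def Atoms.law (ν : Atoms d) : Measure (Fin d → ℝ) :=
  (Measure.pi fun i => gammaMeasure (ν.α i) 1).map fun y => ∑ i, y i • ν.s i

theorem Atoms.isGGC_law (ν : Atoms d) : IsGGC ν.law ν.toMeasure := by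
  have hprob : ∀ i, IsProbabilityMeasure (gammaMeasure (ν.α i) 1) := fun i =>
    isProbabilityMeasure_gammaMeasure (ν.α_pos i) one_pos
  have hm : Measurable fun y : Fin ν.n → ℝ => ∑ i, y i • ν.s i := by fun_prop
  refine ⟨?_, ?_, ?_, ?_, ?_⟩
  · exact Measure.isProbabilityMeasure_map hm.aemeasurable
  · have hnn : ∀ i, ∀ᵐ y ∂(gammaMeasure (ν.α i) 1), 0 ≤ y := by
      intro i
      have hmeas : Measurable (gammaPDF (ν.α i) 1) := (measurable_gammaPDFReal _ _).ennreal_ofReal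
      rw [gammaMeasure, ae_withDensity_iff hmeas]
      refine Eventually.of_forall fun x hx => ?_
      by_contra! hcon
      exact hx (gammaPDF_of_neg hcon)
    rw [Atoms.law, ae_map_iff hm.aemeasurable measurableSet_Ici]
    have : ∀ᵐ y ∂(Measure.pi fun i => gammaMeasure (ν.α i) 1), ∀ i, 0 ≤ y i :=
      ae_all_iff.2 fun i => (Measure.quasiMeasurePreserving_eval _ i).ae (hnn i)
    filter_upwards [this] with y hy
    exact Finset.sum_nonneg fun i _ => smul_nonneg (hy i) (ν.s_nonneg i)
  · rw [ae_iff, Atoms.toMeasure, Measure.finsetSum_apply]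
    refine Finset.sum_eq_zero fun i _ => ?_
    simp [Measure.dirac_apply, ν.s_nonneg i]
  · exact fun t _ => ν.integrable_toMeasure _
  · intro t ht
    have hF : Continuous fun x : Fin d → ℝ => Complex.exp (∑ j, t j * (x j : ℂ)) := by fun_prop
    rw [Atoms.law, integral_map hm.aemeasurable hF.aestronglyMeasurable, ν.integral_toMeasure]
    have h1 : ∀ y : Fin ν.n → ℝ, Complex.exp (∑ j, t j * (((∑ i, y i • ν.s i) j : ℝ) : ℂ)) =
        ∏ i, Complex.exp ((∑ j, t j * (ν.s i j : ℂ)) * y i) := by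
      intro y
      rw [← Complex.exp_sum]
      congr 1
      simp only [Finset.sum_apply, Pi.smul_apply, smul_eq_mul, Complex.ofReal_sum, Complex.ofReal_mul,
        Finset.mul_sum, Finset.sum_mul]
      rw [Finset.sum_comm]
      exact Finset.sum_congr rfl fun i _ => Finset.sum_congr rfl fun j _ => by ring
    simp only [h1]
    rw [integral_fintype_prod_eq_prod (𝕜 := ℂ)
      (fun i (y : ℝ) => Complex.exp ((∑ j, t j * (ν.s i j : ℂ)) * y))]
    have h2 : ∀ i, ∫ y : ℝ, Complex.exp ((∑ j, t j * (ν.s i j : ℂ)) * y) ∂(gammaMeasure (ν.α i) 1) =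
        Complex.exp (-ν.α i * Complex.log (1 - ∑ j, t j * (ν.s i j : ℂ))) := by
      intro i
      refine complexMGF_gammaMeasure (ν.α_pos i) ?_
      rw [Complex.re_sum]
      refine lt_of_le_of_lt (Finset.sum_nonpos fun j _ => ?_) one_pos
      simp only [Complex.mul_re, Complex.ofReal_re, Complex.ofReal_im, mul_zero, sub_zero]
      exact mul_nonpos_of_nonpos_of_nonneg (ht j) (ν.s_nonneg i j)
    simp only [h2]
    rw [← Complex.exp_sum, Atoms.sum, ← Finset.sum_neg_distrib]
    congr 1
    exact Finset.sum_congr rfl fun i _ => by rw [Complex.real_smul]; ring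

/-- The image of a density under a surjective linear map is a density. -/
theorem Atoms.law_absolutelyContinuous (ν : Atoms d) (h : Submodule.span ℝ (Set.range ν.s) = ⊤) :
    ν.law ≪ volume := by
  have hprob : ∀ i, IsProbabilityMeasure (gammaMeasure (ν.α i) 1) := fun i =>
    isProbabilityMeasure_gammaMeasure (ν.α_pos i) one_pos
  let T : (Fin ν.n → ℝ) →ₗ[ℝ] (Fin d → ℝ) := Fintype.linearCombination ℝ ν.s
  have hT : Function.Surjective T := by
    rw [← LinearMap.range_eq_top, Fintype.range_linearCombination, h]
  have hTm : Measurable T := (LinearMap.continuous_on_pi _).measurable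
  have h1 : (Measure.pi fun i => gammaMeasure (ν.α i) 1) ≪ volume :=
    pi_absolutelyContinuous_volume _ fun i => withDensity_absolutelyContinuous _ _
  have h2 : ν.law = (Measure.pi fun i => gammaMeasure (ν.α i) 1).map T := by
    rw [Atoms.law]
    congr 1
  rw [h2]
  refine (h1.map hTm).trans ?_
  obtain ⟨c, -, hc⟩ := T.exists_map_addHaar_eq_smul_addHaar volume volume hT
  rw [hc]
  exact Measure.smul_absolutelyContinuous

theorem Atoms.exists_isGGCDensity (ν : Atoms d) (h : Submodule.span ℝ (Set.range ν.s) = ⊤) :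
    ∃ g, IsGGCDensity ν.toMeasure g := by
  have := ν.isGGC_law.isProb
  refine ⟨fun x => (ν.law.rnDeriv volume x).toReal, ?_, ?_, ?_⟩
  · exact (Measure.measurable_rnDeriv _ _).ennreal_toReal.aemeasurable
  · exact Eventually.of_forall fun x => ENNReal.toReal_nonneg
  · have h1 : lawOfDensity (fun x => (ν.law.rnDeriv volume x).toReal) = ν.law := by
      rw [lawOfDensity, withDensity_congr_ae (g := ν.law.rnDeriv volume)]
      · exact Measure.withDensity_rnDeriv_eq _ _ (ν.law_absolutelyContinuous h)
      · filter_upwards [Measure.rnDeriv_lt_top ν.law volume] with x hx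
        exact ENNReal.ofReal_toReal hx.ne
    rw [h1]
    exact ν.isGGC_law

/-! ### Convergence of the densities in `L²` -/

theorem IsGGCDensity.integrable {ν : Measure (Fin d → ℝ)} {g : (Fin d → ℝ) → ℝ}
    (hg : IsGGCDensity ν g) : Integrable g := by
  refine ⟨hg.aemeasurable.aestronglyMeasurable, ?_⟩
  rw [hasFiniteIntegral_iff_ofReal hg.nonneg]
  have h1 := hg.isGGC.isProb.measure_univ
  rw [lawOfDensity, withDensity_apply _ MeasurableSet.univ, Measure.restrict_univ] at h1
  rw [h1]; exact ENNReal.one_lt_top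

theorem IsGGCDensity.integral_lawOfDensity {ν : Measure (Fin d → ℝ)} {g : (Fin d → ℝ) → ℝ}
    (hg : IsGGCDensity ν g) {E : Type*} [NormedAddCommGroup E] [NormedSpace ℝ E]
    (F : (Fin d → ℝ) → E) : ∫ x, F x ∂(lawOfDensity g) = ∫ x, g x • F x := by
  rw [lawOfDensity, integral_withDensity_eq_integral_toReal_smul₀ hg.aemeasurable.ennreal_ofReal
    (Eventually.of_forall fun x => ENNReal.ofReal_lt_top)]
  refine integral_congr_ae ?_
  filter_upwards [hg.nonneg] with x hx
  rw [ENNReal.toReal_ofReal hx]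

theorem IsGGCDensity.charTransform_eq {ν : Atoms d} {g : (Fin d → ℝ) → ℝ}
    (hg : IsGGCDensity ν.toMeasure g) (t : Fin d → ℝ) :
    charTransform g t = Complex.exp (-ν.charExponent t) := by
  have h1 := hg.isGGC.mgf_eq (fun j => Complex.I * t j) (fun j => by simp)
  have h2 : ∀ x : Fin d → ℝ, ∑ j, Complex.I * (t j : ℂ) * (x j : ℂ) =
      Complex.I * ((t ⬝ᵥ x : ℝ) : ℂ) := by
    intro x
    simp only [dotProduct, Complex.ofReal_sum, Complex.ofReal_mul, Finset.mul_sum, mul_assoc]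
  simp only [h2] at h1
  rw [ν.integral_toMeasure, hg.integral_lawOfDensity] at h1
  rw [charTransform, Atoms.charExponent, ← h1]
  refine integral_congr_ae (Eventually.of_forall fun x => ?_)
  simp only [Complex.real_smul]; ring

theorem re_log_one_sub_I_mul (y : ℝ) :
    (Complex.log (1 - Complex.I * y)).re = 1 / 2 * Real.log (1 + y ^ 2) := by
  rw [Complex.log_re, Complex.norm_def, Real.log_sqrt (Complex.normSq_nonneg _)]
  have : Complex.normSq (1 - Complex.I * y) = 1 + y ^ 2 := by
    simp [Complex.normSq_apply]; ring
  rw [this]; ring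

theorem Atoms.enorm_exp_neg_charExponent_sq (ν : Atoms d) (t : Fin d → ℝ) :
    ‖Complex.exp (-ν.charExponent t)‖ₑ ^ 2 =
      ENNReal.ofReal (Real.exp (-∑ i, ν.α i * Real.log (1 + (t ⬝ᵥ ν.s i) ^ 2))) := by
  rw [← ofReal_norm, ← ENNReal.ofReal_pow (norm_nonneg _), Complex.norm_exp, ← Real.exp_nat_mul,
    Complex.neg_re, Atoms.charExponent, Atoms.sum_re]
  congr 2
  simp only [re_log_one_sub_I_mul, Atoms.sum, smul_eq_mul]
  rw [mul_neg, Finset.mul_sum]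
  congr 1
  refine Finset.sum_congr rfl fun i _ => ?_
  push_cast; ring

theorem Atoms.norm_exp_neg_charExponent_le_one (ν : Atoms d) (t : Fin d → ℝ) :
    ‖Complex.exp (-ν.charExponent t)‖ ≤ 1 := by
  rw [Complex.norm_exp, Real.exp_le_one_iff, Complex.neg_re, Atoms.charExponent, Atoms.sum_re,
    neg_nonpos]
  refine ν.sum_nonneg fun s _ => ?_
  rw [re_log_one_sub_I_mul]
  have : 0 ≤ Real.log (1 + (t ⬝ᵥ s) ^ 2) := Real.log_nonneg (by nlinarith [sq_nonneg (t ⬝ᵥ s)])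
  linarith

theorem Atoms.measurable_charExponent (ν : Atoms d) : Measurable ν.charExponent := by
  unfold Atoms.charExponent Atoms.sum
  refine Finset.measurable_sum _ fun i _ => Measurable.const_smul (Complex.measurable_log.comp ?_) _
  have : Continuous fun t : Fin d → ℝ => (1 : ℂ) - Complex.I * (t ⬝ᵥ ν.s i : ℝ) := by
    refine continuous_const.sub (continuous_const.mul (Complex.continuous_ofReal.comp ?_))
    exact continuous_id.dotProduct continuous_const
  exact this.measurable

theorem injOn_proj {c : Fin d → ℝ} (hc : 0 ≤ c) : Set.InjOn (proj c) (Set.Ici 0) := by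
  intro x hx y hy hxy
  have h1 := one_add_dotProduct_pos hc hx
  have h2 := one_add_dotProduct_pos hc hy
  have h3 : c ⬝ᵥ proj c x = c ⬝ᵥ proj c y := by rw [hxy]
  rw [dotProduct_proj, dotProduct_proj, div_eq_div_iff h1.ne' h2.ne'] at h3
  have h4 : c ⬝ᵥ x = c ⬝ᵥ y := by linarith
  rw [proj, proj, ← h4] at hxy
  exact smul_right_injective _ (inv_ne_zero h1.ne') hxy

/-- The tails of the squared characteristic functions are small uniformly along a sequence whose
log-Laplace transforms converge to that of a generalized Gamma convolution with square integrable
characteristic function: the limiting atoms attract enough mass in all directions. -/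
theorem exists_forall_eventually_setLIntegral_le {ν₀ : Atoms d} (hs0 : ∀ i, ν₀.s i ≠ 0)
    (hint : ∫⁻ t, ‖Complex.exp (-ν₀.charExponent t)‖ₑ ^ 2 ≠ ⊤) {η : ℝ≥0∞} (hη : η ≠ 0) :
    ∃ R : ℝ, ∀ ν : ℕ → Atoms d, (∀ c : Fin d → ℝ, (∀ i, 0 < c i) → (∀ i, c i < 1) →
        Tendsto (fun j => (ν j).logLaplace c) atTop (𝓝 (ν₀.logLaplace c))) →
      ∀ᶠ j in atTop, ∫⁻ t in {t : Fin d → ℝ | R < ‖t‖},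
        ‖Complex.exp (-(ν j).charExponent t)‖ₑ ^ 2 ≤ η := by
  classical
  let c : Fin d → ℝ := fun _ => 1 / 2
  have hc0 : ∀ i, 0 < c i := fun i => by simp [c]
  have hc1 : ∀ i, c i < 1 := fun i => by simp only [c]; norm_num
  have hc : 0 ≤ c := fun i => (hc0 i).le
  -- the distinct atoms, with their total masses `m`
  let T : Finset (Fin d → ℝ) := Finset.univ.image ν₀.s
  have hT : ∀ x : T, 0 ≤ (x : Fin d → ℝ) ∧ (x : Fin d → ℝ) ≠ 0 := by
    rintro ⟨x, hx⟩
    obtain ⟨i, -, rfl⟩ := Finset.mem_image.1 hx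
    exact ⟨ν₀.s_nonneg i, hs0 i⟩
  let m : T → ℝ := fun x => ν₀.sum (Set.indicator {(x : Fin d → ℝ)} 1)
  have hm : ∀ x, 0 < m x := by
    rintro ⟨x, hx⟩
    obtain ⟨i, -, rfl⟩ := Finset.mem_image.1 hx
    refine (ν₀.α_pos i).trans_le ?_
    have := Finset.single_le_sum (f := fun l => ν₀.α l • Set.indicator {ν₀.s i} (1 : (Fin d → ℝ) → ℝ) (ν₀.s l))
      (fun l _ => smul_nonneg (ν₀.α_pos l).le (Set.indicator_nonneg (fun _ _ => zero_le_one) _))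
      (Finset.mem_univ i)
    rwa [Set.indicator_of_mem (Set.mem_singleton _), Pi.one_apply, smul_eq_mul, mul_one] at this
  have hsum : ∀ F : (Fin d → ℝ) → ℝ, ∑ x : T, m x * F x = ∑ i, ν₀.α i * F (ν₀.s i) := by
    intro F
    simp only [m, Atoms.sum, Finset.sum_mul]
    rw [Finset.sum_comm]
    refine Finset.sum_congr rfl fun i _ => ?_
    have hi : ν₀.s i ∈ T := Finset.mem_image_of_mem _ (Finset.mem_univ i)
    rw [Finset.sum_eq_single (⟨ν₀.s i, hi⟩ : T)]
    · simp
    · intro y _ hy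
      have : ν₀.s i ∉ ({(y : Fin d → ℝ)} : Set (Fin d → ℝ)) := fun hcon => hy (Subtype.ext hcon.symm)
      simp [Set.indicator_of_notMem this]
    · simp
  have hint' : ∫⁻ t, ENNReal.ofReal (Real.exp (-∑ x : T, m x *
      Real.log (1 + (t ⬝ᵥ (x : Fin d → ℝ)) ^ 2))) ≠ ⊤ := by
    simp only [Atoms.enorm_exp_neg_charExponent_sq] at hint
    convert hint using 6 with t
    exact hsum fun x => Real.log (1 + (t ⬝ᵥ x) ^ 2)
  obtain ⟨κ, θ, hκ, hθ0, hθ1, hJ⟩ := exists_slack_of_lintegral_exp_ne_top (fun x => (hm x).le) hint'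
  -- `proj c x` is a positive multiple of `x`, so that the condition on spans carries over
  let p : T → Fin d → ℝ := fun x => proj c x
  have hp : Function.Injective p := fun x y hxy =>
    Subtype.ext (injOn_proj hc (hT x).1 (hT y).1 hxy)
  have hmem : ∀ (x : T) (W : Submodule ℝ (Fin d → ℝ)), p x ∈ W ↔ (x : Fin d → ℝ) ∈ W := fun x W =>
    W.smul_mem_iff (inv_ne_zero (one_add_dotProduct_pos hc (hT x).1).ne')
  have hspan : ∀ J : Set T, Submodule.span ℝ (p '' J) =
      Submodule.span ℝ ((fun x : T => (x : Fin d → ℝ)) '' J) := by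
    intro J
    refine le_antisymm (Submodule.span_le.2 ?_) (Submodule.span_le.2 ?_)
    · rintro _ ⟨x, hx, rfl⟩
      exact (hmem x _).2 (Submodule.subset_span ⟨x, hx, rfl⟩)
    · rintro _ ⟨x, hx, rfl⟩
      exact (hmem x _).1 (Submodule.subset_span ⟨x, hx, rfl⟩)
  obtain ⟨U, hU, hR⟩ := exists_nhds_lintegral_exp_le hp (a := fun x => 2 * θ * m x)
    (fun x => by have := hm x; positivity) hκ (fun J => by
      rw [hspan]
      refine (hJ J).trans_eq (Finset.sum_congr rfl fun x _ => ?_)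
      congr 1
      by_cases hx : (x : Fin d → ℝ) ∈ Submodule.span ℝ ((fun x : T => (x : Fin d → ℝ)) '' J)
      · rw [Set.indicator_of_notMem (Set.notMem_compl_iff.2 hx),
          Set.indicator_of_notMem (Set.notMem_compl_iff.2 ((hmem x _).2 hx))]
      · rw [Set.indicator_of_mem (Set.mem_compl hx),
          Set.indicator_of_mem (Set.mem_compl fun hcon => hx ((hmem x _).1 hcon))]
        rfl)
  obtain ⟨R, hR⟩ := hR η hη
  refine ⟨R, fun ν h => ?_⟩
  have hev : ∀ᶠ j in atTop, ∀ x : T, θ * m x < (ν j).sum fun s => (U x).indicator 1 (proj c s) := by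
    refine eventually_all.2 fun x => ?_
    exact Atoms.eventually_le_sum_indicator hc0 hc1 h (hT x).1 (hT x).2 (hU x)
      (by have := hm x; change θ * m x < m x; nlinarith)
  filter_upwards [hev] with j hj
  refine le_trans (lintegral_mono fun t => ?_) (hR (ν j).n (ν j).α (fun l => proj c ((ν j).s l))
    (fun l => ((ν j).α_pos l).le) fun x => ?_)
  · rw [Atoms.enorm_exp_neg_charExponent_sq]
    refine ENNReal.ofReal_le_ofReal (Real.exp_le_exp.2 (neg_le_neg ?_))
    refine Finset.sum_le_sum fun l _ => mul_le_mul_of_nonneg_left ?_ ((ν j).α_pos l).le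
    refine Real.log_le_log (by positivity) ?_
    have h1 : 1 ≤ 1 + c ⬝ᵥ (ν j).s l := by
      have := dotProduct_nonneg_of_nonneg hc ((ν j).s_nonneg l)
      linarith
    rw [dotProduct_proj, div_pow]
    have : (t ⬝ᵥ (ν j).s l) ^ 2 / (1 + c ⬝ᵥ (ν j).s l) ^ 2 ≤ (t ⬝ᵥ (ν j).s l) ^ 2 :=
      div_le_self (sq_nonneg _) (one_le_pow₀ h1)
    linarith
  · have := (hj x).le
    simp only [Atoms.sum, smul_eq_mul] at this
    change 2 * θ * m x ≤ _
    linarith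

/-- The uniform tail bound outside a ball, dominated convergence inside. -/
theorem tendsto_lintegral_exp_neg_charExponent_sub {ν₀ : Atoms d} {ν : ℕ → Atoms d} (hs0 : ∀ i, ν₀.s i ≠ 0)
    (hint : ∫⁻ t, ‖Complex.exp (-ν₀.charExponent t)‖ₑ ^ 2 ≠ ⊤)
    (h : ∀ c : Fin d → ℝ, (∀ i, 0 < c i) → (∀ i, c i < 1) →
      Tendsto (fun j => (ν j).logLaplace c) atTop (𝓝 (ν₀.logLaplace c))) :
    Tendsto (fun j => ∫⁻ t, ‖Complex.exp (-ν₀.charExponent t) -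
      Complex.exp (-(ν j).charExponent t)‖ₑ ^ 2) atTop (𝓝 0) := by
  rw [ENNReal.tendsto_nhds_zero]
  intro ε hε
  obtain ⟨R, hR⟩ := exists_forall_eventually_setLIntegral_le hs0 hint (η := ε / 8)
    (ENNReal.div_ne_zero.2 ⟨hε.ne', by simp⟩)
  have hA : MeasurableSet {t : Fin d → ℝ | R < ‖t‖} := measurableSet_lt measurable_const measurable_norm
  have hm : ∀ μ : Atoms d, Measurable fun t => Complex.exp (-μ.charExponent t) := fun μ =>
    Complex.measurable_exp.comp μ.measurable_charExponent.neg
  have h1 : Tendsto (fun j => ∫⁻ t in {t : Fin d → ℝ | R < ‖t‖}ᶜ, ‖Complex.exp (-ν₀.charExponent t) -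
      Complex.exp (-(ν j).charExponent t)‖ₑ ^ 2) atTop (𝓝 (∫⁻ t in {t : Fin d → ℝ | R < ‖t‖}ᶜ, 0)) := by
    refine tendsto_lintegral_of_dominated_convergence (fun _ => 4) (fun j => ?_) (fun j => ?_) ?_ ?_
    · exact (((hm ν₀).sub (hm (ν j))).enorm.pow_const 2)
    · refine Eventually.of_forall fun t => ?_
      have h2 : ‖Complex.exp (-ν₀.charExponent t) - Complex.exp (-(ν j).charExponent t)‖ₑ ≤ 2 := by
        refine (enorm_sub_le).trans ?_
        have h3 : ∀ μ : Atoms d, ‖Complex.exp (-μ.charExponent t)‖ₑ ≤ 1 := fun μ => by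
          rw [← ofReal_norm]
          exact ENNReal.ofReal_le_one.2 (μ.norm_exp_neg_charExponent_le_one t)
        exact (add_le_add (h3 _) (h3 _)).trans_eq one_add_one_eq_two
      calc _ ≤ (2 : ℝ≥0∞) ^ 2 := pow_le_pow_left₀ zero_le h2 2
        _ = 4 := by norm_num
    · rw [setLIntegral_const]
      refine ENNReal.mul_ne_top (by simp) ?_
      refine ((measure_mono (t := Metric.closedBall 0 R) fun t ht => ?_).trans_lt
        measure_closedBall_lt_top).ne
      simpa using ht
    · refine Eventually.of_forall fun t => ?_
      have h2 : Tendsto (fun j => ‖Complex.exp (-ν₀.charExponent t) -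
          Complex.exp (-(ν j).charExponent t)‖ₑ ^ 2) atTop (𝓝 (‖Complex.exp (-ν₀.charExponent t) -
          Complex.exp (-ν₀.charExponent t)‖ₑ ^ 2)) := by
        have := (Complex.continuous_exp.tendsto _).comp (Atoms.tendsto_charExponent h t).neg
        exact (((ENNReal.continuous_pow 2).comp continuous_enorm).tendsto _).comp (tendsto_const_nhds.sub this)
      simpa using h2
  rw [lintegral_zero, ENNReal.tendsto_nhds_zero] at h1
  filter_upwards [h1 (ε / 2) (ENNReal.half_pos hε.ne'), hR ν h,
    (hR (fun _ => ν₀) fun _ _ _ => tendsto_const_nhds).exists.elim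
      (fun _ hx => Eventually.of_forall fun _ => hx)]
    with j hj1 hj2 hj3
  rw [← lintegral_add_compl _ hA]
  have h3 : ∫⁻ t in {t : Fin d → ℝ | R < ‖t‖}, ‖Complex.exp (-ν₀.charExponent t) -
      Complex.exp (-(ν j).charExponent t)‖ₑ ^ 2 ≤ ε / 2 := by
    calc _ ≤ ∫⁻ t in {t : Fin d → ℝ | R < ‖t‖}, (2 * ‖Complex.exp (-ν₀.charExponent t)‖ₑ ^ 2 +
          2 * ‖Complex.exp (-(ν j).charExponent t)‖ₑ ^ 2) := by
          refine lintegral_mono fun t => ?_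
          refine (pow_le_pow_left₀ zero_le enorm_sub_le 2).trans ?_
          have := ENNReal.rpow_add_le_mul_rpow_add_rpow ‖Complex.exp (-ν₀.charExponent t)‖ₑ
            ‖Complex.exp (-(ν j).charExponent t)‖ₑ one_le_two
          have h21 : (2 : ℝ) - 1 = 1 := by norm_num
          rw [h21, ENNReal.rpow_one, mul_add] at this
          exact_mod_cast this
      _ ≤ 2 * (ε / 8) + 2 * (ε / 8) := by
          rw [lintegral_add_left (((hm ν₀).enorm.pow_const 2).const_mul 2),
            lintegral_const_mul _ ((hm ν₀).enorm.pow_const 2),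
            lintegral_const_mul _ ((hm (ν j)).enorm.pow_const 2)]
          gcongr
      _ = ε / 2 := by
          rw [← two_mul, ← mul_assoc, div_eq_mul_inv, div_eq_mul_inv, mul_left_comm]
          congr 1
          rw [show (8 : ℝ≥0∞) = 2 * 2 * 2 by norm_num, ENNReal.mul_inv (by simp) (by simp), ← mul_assoc,
            ENNReal.mul_inv_cancel (by simp) (by finiteness), one_mul]
  calc _ ≤ ε / 2 + ε / 2 := add_le_add h3 hj1
    _ = ε := ENNReal.add_halves ε

theorem integrable_charTransform_integrand {h : (Fin d → ℝ) → ℝ} (hh : Integrable h) (t : Fin d → ℝ) :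
    Integrable fun x => Complex.exp (Complex.I * (t ⬝ᵥ x : ℝ)) * (h x : ℂ) := by
  refine hh.ofReal.bdd_mul (c := 1) ?_ (Eventually.of_forall fun x => ?_)
  · refine Continuous.aestronglyMeasurable (Complex.continuous_exp.comp (continuous_const.mul
      (Complex.continuous_ofReal.comp ?_)))
    exact continuous_const.dotProduct continuous_id
  · rw [mul_comm, Complex.norm_exp_ofReal_mul_I]

/-- If the log-Laplace transforms converge, so do the densities in `L²`. -/
theorem tendsto_eLpNorm_sub_density {ν₀ : Atoms d} {ν : ℕ → Atoms d} (hs0 : ∀ i, ν₀.s i ≠ 0)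
    {f : (Fin d → ℝ) → ℝ} (hf : IsGGCDensity ν₀.toMeasure f) (hf2 : MemLp f 2 volume)
    {g : ℕ → (Fin d → ℝ) → ℝ} (hg : ∀ j, IsGGCDensity (ν j).toMeasure (g j))
    (h : ∀ c : Fin d → ℝ, (∀ i, 0 < c i) → (∀ i, c i < 1) →
      Tendsto (fun j => (ν j).logLaplace c) atTop (𝓝 (ν₀.logLaplace c))) :
    Tendsto (fun j => eLpNorm (fun x => f x - g j x) 2 volume ^ 2) atTop (𝓝 0) := by
  have hpi : ENNReal.ofReal ((2 * Real.pi) ^ d) ≠ 0 := by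
    have := Real.pi_pos
    simpa using by positivity
  have hint : ∫⁻ t, ‖Complex.exp (-ν₀.charExponent t)‖ₑ ^ 2 ≠ ⊤ := by
    have h1 := (lintegral_charTransform_sq hf.integrable (Or.inl hf2)).2
    simp only [hf.charTransform_eq] at h1
    rw [h1]
    exact ENNReal.mul_ne_top ENNReal.ofReal_ne_top (ENNReal.pow_ne_top hf2.eLpNorm_ne_top)
  have h1 := tendsto_lintegral_exp_neg_charExponent_sub hs0 hint h
  have hsub : ∀ j t, charTransform (fun x => f x - g j x) t =
      Complex.exp (-ν₀.charExponent t) - Complex.exp (-(ν j).charExponent t) := by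
    intro j t
    rw [← hf.charTransform_eq, ← (hg j).charTransform_eq, charTransform, charTransform, charTransform,
      ← integral_sub]
    · refine integral_congr_ae (Eventually.of_forall fun x => ?_)
      simp only; push_cast; ring
    · exact integrable_charTransform_integrand hf.integrable t
    · exact integrable_charTransform_integrand (hg j).integrable t
  have h2 : ∀ᶠ j in atTop, ∫⁻ t, ‖Complex.exp (-ν₀.charExponent t) -
      Complex.exp (-(ν j).charExponent t)‖ₑ ^ 2 = ENNReal.ofReal ((2 * Real.pi) ^ d) *
        eLpNorm (fun x => f x - g j x) 2 volume ^ 2 := by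
    filter_upwards [(ENNReal.tendsto_nhds_zero.1 h1) 1 one_pos] with j hj
    have := (lintegral_charTransform_sq (hf.integrable.sub (hg j).integrable) (Or.inr (by
      change ∫⁻ t, ‖charTransform (fun x => f x - g j x) t‖ₑ ^ 2 ≠ ⊤
      simp only [hsub]
      exact (hj.trans_lt ENNReal.one_lt_top).ne))).2
    change ∫⁻ t, ‖charTransform (fun x => f x - g j x) t‖ₑ ^ 2 = _ at this
    simp only [hsub] at this
    exact this
  have h3 := (h1.congr' h2)
  have h4 := ENNReal.Tendsto.const_mul (a := (ENNReal.ofReal ((2 * Real.pi) ^ d))⁻¹) h3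
    (Or.inr (ENNReal.inv_ne_top.2 hpi))
  rw [mul_zero] at h4
  refine h4.congr fun j => ?_
  rw [← mul_assoc, ENNReal.inv_mul_cancel hpi ENNReal.ofReal_ne_top, one_mul]

/-! ### Thorin moments and shifted moments of the projections -/

theorem map_dotProduct_integral (ν : Atoms d) (c : Fin d → ℝ) (t : ℝ) :
    ∫ y, Real.log (1 - t * y) ∂(ν.toMeasure.map fun s => c ⬝ᵥ s) =
      ν.sum fun s => Real.log (1 - t * (c ⬝ᵥ s)) := by
  rw [integral_map, ν.integral_toMeasure]
  · exact (continuous_const.dotProduct continuous_id).aemeasurable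
  · exact (Real.measurable_log.comp (by fun_prop)).aestronglyMeasurable

theorem one_sub_mul_pos {t y : ℝ} (ht : t < 0) (hy : 0 ≤ y) : 0 < 1 - t * y := by nlinarith

theorem Atoms.iteratedDeriv_cumulant (ν : Atoms d) {c : Fin d → ℝ} (hc : 0 ≤ c) (k : ℕ) {t : ℝ} (ht : t < 0) :
    iteratedDeriv (k + 1) (fun t : ℝ => -ν.sum fun s => Real.log (1 - t * (c ⬝ᵥ s))) t =
      (k.factorial : ℝ) * ν.sum fun s => (c ⬝ᵥ s / (1 - t * (c ⬝ᵥ s))) ^ (k + 1) := by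
  induction k generalizing t with
  | zero =>
    rw [zero_add, iteratedDeriv_one]
    have h1 : HasDerivAt (fun t : ℝ => -ν.sum fun s => Real.log (1 - t * (c ⬝ᵥ s)))
        (-∑ i, ν.α i * (-(c ⬝ᵥ ν.s i) / (1 - t * (c ⬝ᵥ ν.s i)))) t := by
      refine (HasDerivAt.fun_sum fun i _ => ?_).fun_neg
      have hp := one_sub_mul_pos ht (dotProduct_nonneg_of_nonneg hc (ν.s_nonneg i))
      have h2 : HasDerivAt (fun t : ℝ => 1 - t * (c ⬝ᵥ ν.s i)) (-(c ⬝ᵥ ν.s i)) t := by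
        simpa using ((hasDerivAt_id t).mul_const (c ⬝ᵥ ν.s i)).const_sub 1
      exact (h2.log hp.ne').const_mul _
    rw [h1.deriv]
    simp [Atoms.sum, neg_div]
  | succ k ih =>
    rw [iteratedDeriv_succ]
    have h0 : iteratedDeriv (k + 1) (fun t : ℝ => -ν.sum fun s => Real.log (1 - t * (c ⬝ᵥ s))) =ᶠ[𝓝 t]
        fun t => (k.factorial : ℝ) * ν.sum fun s => (c ⬝ᵥ s / (1 - t * (c ⬝ᵥ s))) ^ (k + 1) := by
      filter_upwards [Iio_mem_nhds ht] with u hu using ih hu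
    rw [h0.deriv_eq]
    have h1 : HasDerivAt (fun t : ℝ => (k.factorial : ℝ) * ν.sum fun s =>
        (c ⬝ᵥ s / (1 - t * (c ⬝ᵥ s))) ^ (k + 1))
        ((k.factorial : ℝ) * ∑ i, ν.α i * ((k + 1 : ℝ) *
          (c ⬝ᵥ ν.s i / (1 - t * (c ⬝ᵥ ν.s i))) ^ (k + 2))) t := by
      refine (HasDerivAt.fun_sum fun i _ => HasDerivAt.const_mul _ ?_).const_mul _
      have hp := one_sub_mul_pos ht (dotProduct_nonneg_of_nonneg hc (ν.s_nonneg i))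
      have h2 : HasDerivAt (fun t : ℝ => 1 - t * (c ⬝ᵥ ν.s i)) (-(c ⬝ᵥ ν.s i)) t := by
        simpa using ((hasDerivAt_id t).mul_const (c ⬝ᵥ ν.s i)).const_sub 1
      have h3 := (((hasDerivAt_const t (c ⬝ᵥ ν.s i)).fun_div h2 hp.ne').fun_pow (k + 1))
      convert h3 using 1
      have h4 : (0 * (1 - t * (c ⬝ᵥ ν.s i)) - c ⬝ᵥ ν.s i * -(c ⬝ᵥ ν.s i)) /
          (1 - t * (c ⬝ᵥ ν.s i)) ^ 2 = (c ⬝ᵥ ν.s i / (1 - t * (c ⬝ᵥ ν.s i))) ^ 2 := by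
        rw [div_pow]; ring
      rw [h4, Nat.add_sub_cancel]
      push_cast
      ring
    rw [h1.deriv, Nat.factorial_succ]
    simp only [Atoms.sum, Finset.mul_sum, smul_eq_mul]
    refine Finset.sum_congr rfl fun i _ => ?_
    push_cast; ring

theorem thorinMoment_zero (ν : Atoms d) (c : Fin d → ℝ) :
    thorinMoment (ν.toMeasure.map fun s => c ⬝ᵥ s) 0 = -ν.logLaplace c := by
  simp only [thorinMoment, map_dotProduct_integral, iteratedDeriv_zero]
  simp [Atoms.logLaplace]

theorem thorinMoment_succ (ν : Atoms d) {c : Fin d → ℝ} (hc : 0 ≤ c) (k : ℕ) :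
    thorinMoment (ν.toMeasure.map fun s => c ⬝ᵥ s) (k + 1) =
      ν.sum fun s => (c ⬝ᵥ s / (1 + c ⬝ᵥ s)) ^ (k + 1) := by
  simp only [thorinMoment, map_dotProduct_integral]
  rw [ν.iteratedDeriv_cumulant hc k (by norm_num)]
  have h2 : (k.factorial : ℝ) ≠ 0 := by exact_mod_cast k.factorial_ne_zero
  simp only [Nat.add_sub_cancel, neg_mul, one_mul, sub_neg_eq_add]
  field_simp

theorem continuousOn_thorinMoment (ν : Atoms d) (k : ℕ) :
    ContinuousOn (fun c : Fin d → ℝ => thorinMoment (ν.toMeasure.map fun s => c ⬝ᵥ s) k)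
      (Set.Ici 0) := by
  cases k with
  | zero =>
    simp only [thorinMoment_zero]
    exact ν.continuousOn_logLaplace.neg
  | succ k =>
    refine ContinuousOn.congr ?_ fun c hc => thorinMoment_succ ν hc k
    simp only [Atoms.sum, smul_eq_mul]
    refine continuousOn_finsetSum _ fun i _ => continuousOn_const.mul (ContinuousOn.pow ?_ _)
    have h1 : Continuous fun c : Fin d → ℝ => c ⬝ᵥ ν.s i := continuous_id.dotProduct continuous_const
    exact h1.continuousOn.div (continuous_const.add h1).continuousOn fun c hc =>
      (one_add_dotProduct_pos hc (ν.s_nonneg i)).ne'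

/-- The shifted moment `E ⟨c, X⟩ ^ k e ^ (-⟨c, X⟩)` of the projection on `c`. -/
def shiftedMoment (μ : Measure (Fin d → ℝ)) (c : Fin d → ℝ) (k : ℕ) : ℝ :=
  ∫ x, (c ⬝ᵥ x) ^ k * Real.exp (-(c ⬝ᵥ x)) ∂μ

theorem integral_exp_mul_dotProduct {μ : Measure (Fin d → ℝ)} {ν : Atoms d} (h : IsGGC μ ν.toMeasure)
    {c : Fin d → ℝ} (hc : 0 ≤ c) {t : ℝ} (ht : t < 0) :
    ∫ x, Real.exp (t * (c ⬝ᵥ x)) ∂μ = Real.exp (-ν.sum fun s => Real.log (1 - t * (c ⬝ᵥ s))) := by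
  have h1 := h.mgf_eq (fun j => ((t * c j : ℝ) : ℂ)) (fun j => by
    rw [Complex.ofReal_re]; exact mul_nonpos_of_nonpos_of_nonneg ht.le (hc j))
  have h2 : ∀ x : Fin d → ℝ, ∑ j, ((t * c j : ℝ) : ℂ) * (x j : ℂ) = ((t * (c ⬝ᵥ x) : ℝ) : ℂ) := by
    intro x
    simp only [dotProduct, Finset.mul_sum, Complex.ofReal_sum, Complex.ofReal_mul, mul_assoc]
  simp only [h2] at h1
  rw [ν.integral_toMeasure] at h1
  have h3 : (ν.sum fun s => Complex.log (1 - ((t * (c ⬝ᵥ s) : ℝ) : ℂ))) =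
      ((ν.sum fun s => Real.log (1 - t * (c ⬝ᵥ s)) : ℝ) : ℂ) := by
    simp only [Atoms.sum, Complex.ofReal_sum, smul_eq_mul, Complex.ofReal_mul, Complex.real_smul]
    refine Finset.sum_congr rfl fun i _ => ?_
    rw [Complex.ofReal_log (one_sub_mul_pos ht (dotProduct_nonneg_of_nonneg hc (ν.s_nonneg i))).le]
    push_cast; rfl
  rw [h3, ← Complex.ofReal_neg, ← Complex.ofReal_exp] at h1
  rw [← Complex.ofReal_inj, ← h1, ← integral_complex_ofReal]
  simp only [Complex.ofReal_exp]

/-- The shifted moments of the projections are `B` of the Thorin moments. -/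
theorem bell_thorinMoment {μ : Measure (Fin d → ℝ)} {ν : Atoms d} (h : IsGGC μ ν.toMeasure)
    {c : Fin d → ℝ} (hc : 0 ≤ c) :
    bell (thorinMoment (ν.toMeasure.map fun s => c ⬝ᵥ s)) = shiftedMoment μ c := by
  have := h.isProb
  funext k
  have hsm : ContDiffAt ℝ (⊤ : ℕ∞) (fun t : ℝ => -ν.sum fun s => Real.log (1 - t * (c ⬝ᵥ s))) (-1) := by
    simp only [Atoms.sum, smul_eq_mul]
    refine ContDiffAt.neg (ContDiffAt.sum fun i _ => contDiffAt_const.mul (ContDiffAt.log ?_ ?_))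
    · exact contDiffAt_const.sub (contDiffAt_id.mul contDiffAt_const)
    · exact (one_sub_mul_pos (by norm_num) (dotProduct_nonneg_of_nonneg hc (ν.s_nonneg i))).ne'
  have h1 := iteratedDeriv_exp_comp hsm k
  have h2 : (fun t => Real.exp (-ν.sum fun s => Real.log (1 - t * (c ⬝ᵥ s)))) =ᶠ[𝓝 (-1)]
      mgf (fun x => c ⬝ᵥ x) μ := by
    filter_upwards [Iio_mem_nhds (show (-1 : ℝ) < 0 by norm_num)] with t ht
    exact (integral_exp_mul_dotProduct h hc ht).symm
  have h3 : (-1 : ℝ) ∈ interior (integrableExpSet (fun x => c ⬝ᵥ x) μ) := by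
    refine interior_mono (s := Set.Iio 0) (fun t ht => ?_) (by rw [interior_Iio]; norm_num)
    -- the junk value of a divergent integral would be `0`
    by_contra hcon
    have h4 := integral_exp_mul_dotProduct h hc ht
    rw [integral_undef hcon] at h4
    exact (Real.exp_pos _).ne h4
  rw [h2.iteratedDeriv_eq, iteratedDeriv_mgf h3] at h1
  rw [shiftedMoment]
  simp only [neg_mul, one_mul] at h1
  rw [h1]
  congr 1
  funext j
  rw [thorinMoment]
  simp only [map_dotProduct_integral]

/-! ### Continuity of the loss -/

theorem continuousOn_bellInv (k : ℕ) :
    ContinuousOn (fun μ : ℕ → ℝ => bellInv μ k) {μ | 0 < μ 0} := by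
  induction k using Nat.strong_induction_on with
  | _ k ih =>
    cases k with
    | zero =>
      simp only [bellInv]
      exact (continuous_apply 0).continuousOn.log fun μ hμ => (show 0 < μ 0 from hμ).ne'
    | succ k =>
      simp only [bellInv]
      refine ContinuousOn.div ?_ (continuous_const.mul (continuous_apply 0)).continuousOn fun μ hμ => ?_
      · refine (continuous_apply _).continuousOn.sub (continuousOn_finsetSum _ fun l _ => ?_)
        exact (continuousOn_const.mul (continuousOn_const.mul (ih _ (by omega)))).mul
          (continuous_apply _).continuousOn
      · have h2 : (k.factorial : ℝ) ≠ 0 := by exact_mod_cast k.factorial_ne_zero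
        exact mul_ne_zero h2 (show 0 < μ 0 from hμ).ne'

theorem contDiff_bell_extendZero (m k : ℕ) :
    ContDiff ℝ 1 fun τ : Fin (m + 1) → ℝ => bell (extendZero τ) k := by
  have h0 : ∀ j, ContDiff ℝ 1 fun τ : Fin (m + 1) → ℝ => extendZero τ j := by
    intro j
    unfold extendZero
    split_ifs with h
    · exact contDiff_apply ℝ ℝ _
    · exact contDiff_const
  induction k using Nat.strong_induction_on with
  | _ k ih =>
    cases k with
    | zero =>
      simp only [bell]
      exact (h0 0).exp
    | succ k =>
      simp only [bell]
      exact ContDiff.sum fun l _ => (contDiff_const.mul (contDiff_const.mul (h0 _))).mul (ih _ l.2)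

theorem contDiff_laguerreOfThorin (m : ℕ) : ContDiff ℝ 1 (laguerreOfThorin m) := by
  refine contDiff_pi.2 fun k => ?_
  simp only [laguerreOfThorin, Matrix.mulVec, dotProduct]
  exact ContDiff.sum fun l _ => contDiff_const.mul (contDiff_bell_extendZero m l)

/-- The quadratic form `‖∇(τ) v‖²`. -/
def lossForm (m : ℕ) (τ v : Fin (m + 1) → ℝ) : ℝ :=
  ∑ k, (fderiv ℝ (laguerreOfThorin m) τ v k) ^ 2

theorem continuous_lossForm (m : ℕ) :
    Continuous fun p : (Fin (m + 1) → ℝ) × (Fin (m + 1) → ℝ) => lossForm m p.1 p.2 := by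
  refine continuous_finsetSum _ fun k _ => Continuous.pow ?_ 2
  exact (continuous_apply k).comp
    ((contDiff_laguerreOfThorin m).continuous_fderiv_apply (by simp))

/-- The zeroth Laguerre coefficient is `√2 e ^ τ 0`, so that the first row of `∇` alone controls the
zeroth Thorin moment. -/
theorem le_lossForm (m : ℕ) (τ v : Fin (m + 1) → ℝ) :
    2 * Real.exp (τ 0) ^ 2 * v 0 ^ 2 ≤ lossForm m τ v := by
  have h0 : ∀ τ : Fin (m + 1) → ℝ, laguerreOfThorin m τ 0 = √2 * Real.exp (τ 0) := by
    intro τ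
    simp only [laguerreOfThorin, Matrix.mulVec, dotProduct]
    rw [Finset.sum_eq_single 0]
    · simp [laguerreMatrix, bell, extendZero]
    · intro l _ hl
      have : 0 < (l : ℕ) := Nat.pos_of_ne_zero fun hcon => hl (Fin.ext hcon)
      simp [laguerreMatrix, Nat.choose_eq_zero_of_lt this]
    · simp
  have hd := (((contDiff_laguerreOfThorin m).differentiable (by simp)) τ).hasFDerivAt
  have h1 := (hasFDerivAt_pi'.1 hd 0)
  have h2 : HasFDerivAt (fun τ : Fin (m + 1) → ℝ => √2 * Real.exp (τ 0))
      (√2 • Real.exp (τ 0) • (ContinuousLinearMap.proj 0 : (Fin (m + 1) → ℝ) →L[ℝ] ℝ)) τ :=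
    ((hasFDerivAt_apply 0 τ).exp).const_mul _
  simp only [h0] at h1
  have h3 := congrArg (fun L : (Fin (m + 1) → ℝ) →L[ℝ] ℝ => L v) (h1.unique h2)
  simp only [ContinuousLinearMap.comp_apply, ContinuousLinearMap.proj_apply,
    smul_apply, smul_eq_mul] at h3
  have h4 : (fderiv ℝ (laguerreOfThorin m) τ v 0) ^ 2 ≤ lossForm m τ v :=
    Finset.single_le_sum (f := fun k => (fderiv ℝ (laguerreOfThorin m) τ v k) ^ 2)
      (fun _ _ => sq_nonneg _) (Finset.mem_univ 0)
  refine le_trans (le_of_eq ?_) h4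
  rw [h3, mul_pow, mul_pow, Real.sq_sqrt (by norm_num)]
  ring

/-- The integrand of the random-projection loss, as a function of the shifted moments `μ` and of the
projection `c`. -/
def projLoss (m : ℕ) (ν : Atoms d) (μ : ℕ → ℝ) (c : Fin d → ℝ) : ℝ :=
  lossForm m (fun k => bellInv μ k)
    (fun k => bellInv μ k - thorinMoment (ν.toMeasure.map fun s => c ⬝ᵥ s) k)

theorem projectionLoss_eq (m N : ℕ) (x : ℕ → Fin d → ℝ) (ν : Atoms d) :
    projectionLoss m N x ν.toMeasure = ∫ c in Set.Icc (0 : Fin d → ℝ) 1,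
      projLoss m ν (empShiftedMoment N fun i => c ⬝ᵥ x i) c := rfl

theorem continuousOn_projLoss (m : ℕ) (ν : Atoms d) :
    ContinuousOn (fun p : (ℕ → ℝ) × (Fin d → ℝ) => projLoss m ν p.1 p.2)
      ({μ | 0 < μ 0} ×ˢ Set.Ici 0) := by
  have h1 : ∀ k, ContinuousOn (fun p : (ℕ → ℝ) × (Fin d → ℝ) => bellInv p.1 k)
      ({μ | 0 < μ 0} ×ˢ Set.Ici 0) := fun k =>
    (continuousOn_bellInv k).comp continuousOn_fst fun p hp => hp.1
  have h2 : ∀ k, ContinuousOn (fun p : (ℕ → ℝ) × (Fin d → ℝ) =>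
      thorinMoment (ν.toMeasure.map fun s => p.2 ⬝ᵥ s) k) ({μ | 0 < μ 0} ×ˢ Set.Ici 0) := fun k =>
    (continuousOn_thorinMoment ν k).comp continuousOn_snd fun p hp => hp.2
  have h3 : ContinuousOn (fun p : (ℕ → ℝ) × (Fin d → ℝ) => ((fun k : Fin (m + 1) => bellInv p.1 k),
      fun k : Fin (m + 1) => bellInv p.1 k - thorinMoment (ν.toMeasure.map fun s => p.2 ⬝ᵥ s) k))
      ({μ | 0 < μ 0} ×ˢ Set.Ici 0) :=
    ContinuousOn.prodMk (continuousOn_pi.2 fun k => h1 k) (continuousOn_pi.2 fun k => (h1 k).sub (h2 k))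
  have h4 := (continuous_lossForm m).comp_continuousOn h3
  unfold projLoss
  exact h4

theorem le_projLoss (m : ℕ) (ν : Atoms d) {μ : ℕ → ℝ} (hμ : 0 < μ 0) (c : Fin d → ℝ) :
    2 * μ 0 ^ 2 * (Real.log (μ 0) + ν.logLaplace c) ^ 2 ≤ projLoss m ν μ c := by
  have h := le_lossForm m (fun k => bellInv μ k)
    (fun k => bellInv μ k - thorinMoment (ν.toMeasure.map fun s => c ⬝ᵥ s) k)
  simp only [Fin.val_zero, thorinMoment_zero, sub_neg_eq_add] at h
  rw [bellInv, Real.exp_log hμ] at h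
  exact h

/-- The loss vanishes at the true moments. -/
theorem projLoss_shiftedMoment (m : ℕ) {μ : Measure (Fin d → ℝ)} {ν : Atoms d}
    (h : IsGGC μ ν.toMeasure) {c : Fin d → ℝ} (hc : 0 ≤ c) :
    projLoss m ν (shiftedMoment μ c) c = 0 := by
  rw [projLoss, ← bell_thorinMoment h hc, bellInv_bell]
  have : (fun k : Fin (m + 1) => thorinMoment (ν.toMeasure.map fun s => c ⬝ᵥ s) k -
      thorinMoment (ν.toMeasure.map fun s => c ⬝ᵥ s) k) = 0 := by funext; simp
  rw [this]; simp [lossForm]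

/-! ### Convergence of the empirical loss -/

theorem pow_mul_exp_neg_le {y : ℝ} (hy : 0 ≤ y) (k : ℕ) : y ^ k * Real.exp (-y) ≤ k.factorial := by
  have h := Real.pow_div_factorial_le_exp y hy k
  rw [div_le_iff₀ (by positivity)] at h
  rw [Real.exp_neg, ← div_eq_mul_inv, div_le_iff₀ (Real.exp_pos _)]
  linarith

/-- The strong law of large numbers for the empirical shifted moments, simultaneously for all projections:
it is applied to random elements of the Banach space of continuous functions of `c`. -/
theorem ae_tendsto_empShiftedMoment {Ω : Type*} [MeasurableSpace Ω] {P : Measure Ω}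
    [IsProbabilityMeasure P] {μ : Measure (Fin d → ℝ)} (hμ : ∀ᵐ x ∂μ, 0 ≤ x)
    {X : ℕ → Ω → Fin d → ℝ} (hX : ∀ i, AEMeasurable (X i) P) (hindep : iIndepFun X P)
    (hlaw : ∀ i, P.map (X i) = μ) (k : ℕ) :
    ∀ᵐ ω ∂P, ∀ c ∈ Set.Icc (0 : Fin d → ℝ) 1,
      Tendsto (fun N => empShiftedMoment N (fun i => c ⬝ᵥ X i ω) k) atTop
        (𝓝 (shiftedMoment μ c k)) := by
  let K := Set.Icc (0 : Fin d → ℝ) 1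
  let _ : MeasurableSpace C(K, ℝ) := borel _
  have _ : BorelSpace C(K, ℝ) := ⟨rfl⟩
  have hc2 : Continuous fun p : (Fin d → ℝ) × K =>
      ((p.2 : Fin d → ℝ) ⬝ᵥ p.1) ^ k * Real.exp (-((p.2 : Fin d → ℝ) ⬝ᵥ p.1)) := by
    have h1 : Continuous fun p : (Fin d → ℝ) × K => (p.2 : Fin d → ℝ) ⬝ᵥ p.1 :=
      (continuous_subtype_val.comp continuous_snd).dotProduct continuous_fst
    exact (h1.pow k).mul (Real.continuous_exp.comp h1.neg)
  let F : (Fin d → ℝ) → C(K, ℝ) := fun x =>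
    ⟨fun c => ((c : Fin d → ℝ) ⬝ᵥ x) ^ k * Real.exp (-((c : Fin d → ℝ) ⬝ᵥ x)),
      hc2.comp (Continuous.prodMk_right x)⟩
  have hF : Continuous F := ContinuousMap.continuous_of_continuous_uncurry F hc2
  have hFm : Measurable F := hF.measurable
  have hnn : ∀ᵐ ω ∂P, 0 ≤ X 0 ω := by
    rw [← hlaw 0] at hμ
    exact ae_of_ae_map (hX 0) hμ
  have hint : Integrable (fun ω => F (X 0 ω)) P := by
    refine Integrable.of_bound (hF.comp_aestronglyMeasurable (hX 0).aestronglyMeasurable)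
      (k.factorial : ℝ) ?_
    filter_upwards [hnn] with ω hω
    refine (ContinuousMap.norm_le _ (by positivity)).2 fun c => ?_
    have h0 := dotProduct_nonneg_of_nonneg c.2.1 hω
    change ‖((c : Fin d → ℝ) ⬝ᵥ X 0 ω) ^ k * Real.exp (-((c : Fin d → ℝ) ⬝ᵥ X 0 ω))‖ ≤ _
    rw [Real.norm_of_nonneg (by positivity)]
    exact pow_mul_exp_neg_le h0 k
  have hslln := strong_law_ae (μ := P) (fun i ω => F (X i ω)) hint
    (fun i j hij => (hindep.indepFun hij).comp hFm hFm) fun i => by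
      have h1 : IdentDistrib (X i) (X 0) P P := ⟨hX i, hX 0, by rw [hlaw, hlaw]⟩
      exact h1.comp hFm
  filter_upwards [hslln] with ω hω c hc
  have h1 := ((ContinuousMap.evalCLM ℝ (⟨c, hc⟩ : K)).continuous.tendsto _).comp hω
  have h2 : (ContinuousMap.evalCLM ℝ (⟨c, hc⟩ : K)) (∫ ω, F (X 0 ω) ∂P) = shiftedMoment μ c k := by
    rw [← ContinuousLinearMap.integral_comp_comm _ hint, shiftedMoment, ← hlaw 0, integral_map (hX 0)]
    · rfl
    · have h1 : Continuous fun x : Fin d → ℝ => c ⬝ᵥ x := continuous_const.dotProduct continuous_id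
      exact ((h1.pow k).mul (Real.continuous_exp.comp h1.neg)).aestronglyMeasurable
  rw [h2] at h1
  refine h1.congr fun N => ?_
  simp only [Function.comp, map_smul, map_sum, smul_eq_mul, empShiftedMoment, one_div]
  rfl

theorem continuous_empShiftedMoment (N : ℕ) (x : ℕ → Fin d → ℝ) :
    Continuous fun c : Fin d → ℝ => empShiftedMoment N fun i => c ⬝ᵥ x i := by
  refine continuous_pi fun k => continuous_const.mul (continuous_finsetSum _ fun i _ => ?_)
  have h1 : Continuous fun c : Fin d → ℝ => c ⬝ᵥ x i := continuous_id.dotProduct continuous_const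
  exact (h1.pow k).mul (Real.continuous_exp.comp h1.neg)

theorem empShiftedMoment_zero_pos {N : ℕ} (hN : N ≠ 0) (x : ℕ → ℝ) : 0 < empShiftedMoment N x 0 := by
  have h1 : 0 < (N : ℝ) := by positivity
  refine mul_pos (by positivity) (Finset.sum_pos (fun i _ => by simp [Real.exp_pos]) ?_)
  simpa using hN

theorem empShiftedMoment_mem_Icc (N : ℕ) {x : ℕ → ℝ} (hx : ∀ i, 0 ≤ x i) (k : ℕ) :
    empShiftedMoment N x k ∈ Set.Icc (0 : ℝ) k.factorial := by
  refine ⟨mul_nonneg (by positivity) (Finset.sum_nonneg fun i _ =>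
    mul_nonneg (pow_nonneg (hx i) k) (Real.exp_pos _).le), ?_⟩
  have h1 : ∑ i ∈ Finset.range N, x i ^ k * Real.exp (-x i) ≤ N * (k.factorial : ℝ) :=
    (Finset.sum_le_card_nsmul _ _ _ fun i _ => pow_mul_exp_neg_le (hx i) k).trans_eq (by simp)
  rw [empShiftedMoment, one_div, inv_mul_eq_div]
  exact div_le_of_le_mul₀ (by positivity) (by positivity) (by linarith)

theorem empShiftedMoment_zero_anti (N : ℕ) {x y : ℕ → ℝ} (hxy : ∀ i, x i ≤ y i) :
    empShiftedMoment N y 0 ≤ empShiftedMoment N x 0 := by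
  simp only [empShiftedMoment, pow_zero, one_mul]
  refine mul_le_mul_of_nonneg_left (Finset.sum_le_sum fun i _ => ?_) (by positivity)
  exact Real.exp_le_exp.2 (neg_le_neg (hxy i))

theorem continuousOn_projLoss_emp {N : ℕ} (hN : N ≠ 0) (m : ℕ) (ν : Atoms d) (x : ℕ → Fin d → ℝ) :
    ContinuousOn (fun c => projLoss m ν (empShiftedMoment N fun i => c ⬝ᵥ x i) c)
      (Set.Icc 0 1) :=
  (continuousOn_projLoss m ν).comp (f := fun c => (empShiftedMoment N (fun i => c ⬝ᵥ x i), c))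
    ((continuous_empShiftedMoment N x).prodMk continuous_id).continuousOn
    fun _ hc => ⟨empShiftedMoment_zero_pos hN _, hc.1⟩

theorem integrableOn_projLoss_emp {N : ℕ} (hN : N ≠ 0) (m : ℕ) (ν : Atoms d) (x : ℕ → Fin d → ℝ) :
    IntegrableOn (fun c => projLoss m ν (empShiftedMoment N fun i => c ⬝ᵥ x i) c) (Set.Icc 0 1) :=
  (continuousOn_projLoss_emp hN m ν x).integrableOn_compact isCompact_Icc

/-- The empirical loss of the true Thorin measure tends to zero. -/
theorem tendsto_projectionLoss {μ : Measure (Fin d → ℝ)} {ν₀ : Atoms d} (hμ : IsGGC μ ν₀.toMeasure)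
    (m : ℕ) {x : ℕ → Fin d → ℝ} (hx : ∀ i, 0 ≤ x i)
    {b : ℝ} (hb : 0 < b) (hxb : ∀ᶠ N in atTop, b ≤ empShiftedMoment N (fun i => 1 ⬝ᵥ x i) 0)
    (hconv : ∀ k, ∀ c ∈ Set.Icc (0 : Fin d → ℝ) 1,
      Tendsto (fun N => empShiftedMoment N (fun i => c ⬝ᵥ x i) k) atTop (𝓝 (shiftedMoment μ c k))) :
    Tendsto (fun N => projectionLoss m N x ν₀.toMeasure) atTop (𝓝 0) := by
  simp only [projectionLoss_eq]
  -- a compact set (by Tychonoff's theorem) that contains all empirical moments and keeps `μ 0` away from `0`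
  let Q : Set (ℕ → ℝ) := Set.univ.pi fun k => Set.Icc (if k = 0 then b else 0) (k.factorial : ℝ)
  have hQ : IsCompact Q := isCompact_univ_pi fun k => isCompact_Icc
  have hQ0 : Q ⊆ {μ | 0 < μ 0} := fun μ hμ => by
    have := (hμ 0 (Set.mem_univ _)).1
    simp only [if_true] at this
    exact hb.trans_le this
  obtain ⟨C, hC⟩ := ((hQ.prod (isCompact_Icc (a := (0 : Fin d → ℝ)) (b := 1))).exists_bound_of_continuousOn
    ((continuousOn_projLoss m ν₀).mono (Set.prod_mono hQ0 Set.Icc_subset_Ici_self)))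
  have hlim : Tendsto (fun N => ∫ c in Set.Icc (0 : Fin d → ℝ) 1,
      projLoss m ν₀ (empShiftedMoment N fun i => c ⬝ᵥ x i) c) atTop
      (𝓝 (∫ c in Set.Icc (0 : Fin d → ℝ) 1, 0)) := by
    refine tendsto_integral_filter_of_dominated_convergence (fun _ => C) ?_ ?_ ?_ ?_
    · filter_upwards [eventually_ne_atTop 0] with N hN
      exact (integrableOn_projLoss_emp hN m ν₀ x).aestronglyMeasurable
    · filter_upwards [hxb] with N hN
      filter_upwards [ae_restrict_mem measurableSet_Icc] with c hc
      refine hC (empShiftedMoment N (fun i => c ⬝ᵥ x i), c) ⟨fun k _ => ?_, hc⟩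
      have h1 := empShiftedMoment_mem_Icc N (x := fun i => c ⬝ᵥ x i)
        (fun i => dotProduct_nonneg_of_nonneg hc.1 (hx i)) k
      refine ⟨?_, h1.2⟩
      split_ifs with hk
      · subst hk
        refine hN.trans (empShiftedMoment_zero_anti N fun i => ?_)
        exact dotProduct_le_dotProduct_of_nonneg_right hc.2 (hx i)
      · exact h1.1
    · have : IsFiniteMeasure (volume.restrict (Set.Icc (0 : Fin d → ℝ) 1)) :=
        ⟨by rw [Measure.restrict_apply_univ]; exact isCompact_Icc.measure_lt_top⟩
      exact integrable_const C
    · filter_upwards [ae_restrict_mem measurableSet_Icc] with c hc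
      have h1 : (shiftedMoment μ c, c) ∈ {μ : ℕ → ℝ | 0 < μ 0} ×ˢ Set.Ici (0 : Fin d → ℝ) := by
        refine ⟨?_, hc.1⟩
        rw [← bell_thorinMoment hμ hc.1]
        exact bell_pos_zero _
      have h2 : Tendsto (fun N => (empShiftedMoment N (fun i => c ⬝ᵥ x i), c)) atTop
          (𝓝[{μ : ℕ → ℝ | 0 < μ 0} ×ˢ Set.Ici (0 : Fin d → ℝ)] (shiftedMoment μ c, c)) := by
        refine tendsto_nhdsWithin_iff.2 ⟨?_, ?_⟩
        · exact (tendsto_pi_nhds.2 fun k => hconv k c hc).prodMk_nhds tendsto_const_nhds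
        · filter_upwards [eventually_ne_atTop 0] with N hN
          exact ⟨empShiftedMoment_zero_pos hN _, hc.1⟩
      have h3 := ((continuousOn_projLoss m ν₀) _ h1).tendsto
      have h4 := h3.comp h2
      simp only [projLoss_shiftedMoment m hμ hc.1] at h4
      exact h4
  simpa using hlim

/-- The empirical losses of two Thorin measures control the distance of their log-Laplace transforms
on the cube. -/
theorem integral_logLaplace_sub_sq_le {m N : ℕ} (hN : N ≠ 0) {x : ℕ → Fin d → ℝ} (hx : ∀ i, 0 ≤ x i)
    {b : ℝ} (hb : 0 < b) (hxb : b ≤ empShiftedMoment N (fun i => 1 ⬝ᵥ x i) 0) (ν ν₀ : Atoms d) :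
    ∫ c in Set.Icc (0 : Fin d → ℝ) 1, (ν.logLaplace c - ν₀.logLaplace c) ^ 2 ≤
      (b ^ 2)⁻¹ * (projectionLoss m N x ν.toMeasure + projectionLoss m N x ν₀.toMeasure) := by
  rw [projectionLoss_eq, projectionLoss_eq, ← integral_add (integrableOn_projLoss_emp hN m ν x)
    (integrableOn_projLoss_emp hN m ν₀ x), ← integral_const_mul]
  refine setIntegral_mono_on ?_ ?_ measurableSet_Icc fun c hc => ?_
  · refine ContinuousOn.integrableOn_compact isCompact_Icc ?_
    exact ((ν.continuousOn_logLaplace.sub ν₀.continuousOn_logLaplace).pow 2).mono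
      Set.Icc_subset_Ici_self
  · exact ((integrableOn_projLoss_emp hN m ν x).add
      (integrableOn_projLoss_emp hN m ν₀ x)).const_mul _
  · set q := empShiftedMoment N (fun i => c ⬝ᵥ x i) with hq
    have hbq : b ≤ q 0 := hxb.trans (empShiftedMoment_zero_anti N fun i =>
      dotProduct_le_dotProduct_of_nonneg_right hc.2 (hx i))
    have hq0 : 0 < q 0 := hb.trans_le hbq
    have h1 := le_projLoss m ν hq0 c
    have h2 := le_projLoss m ν₀ hq0 c
    rw [inv_mul_eq_div, le_div_iff₀ (by positivity)]
    have hb2 : b ^ 2 ≤ q 0 ^ 2 := pow_le_pow_left₀ hb.le hbq 2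
    have h3 : (ν.logLaplace c - ν₀.logLaplace c) ^ 2 ≤ 2 * (Real.log (q 0) + ν.logLaplace c) ^ 2 +
        2 * (Real.log (q 0) + ν₀.logLaplace c) ^ 2 := by
      nlinarith [sq_nonneg (2 * Real.log (q 0) + ν.logLaplace c + ν₀.logLaplace c)]
    calc _ ≤ (2 * (Real.log (q 0) + ν.logLaplace c) ^ 2 +
        2 * (Real.log (q 0) + ν₀.logLaplace c) ^ 2) * q 0 ^ 2 := by gcongr
      _ ≤ _ := by linarith

/-! ### From the loss to the density -/

/-- A well-behaved Thorin measure whose log-Laplace transform is close to that of `ν₀` on the unit cube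
has its density close to that of `ν₀`. -/
theorem exists_forall_exists_density_close {ν₀ : Atoms d} (hs0 : ∀ i, ν₀.s i ≠ 0)
    {f : (Fin d → ℝ) → ℝ} (hf : IsGGCDensity ν₀.toMeasure f) (hf2 : MemLp f 2 volume)
    {ε : ℝ} (hε : 0 < ε) :
    ∃ δ > 0, ∀ ν : Atoms d, Submodule.span ℝ (Set.range ν.s) = ⊤ →
      ∫ c in Set.Icc (0 : Fin d → ℝ) 1, (ν.logLaplace c - ν₀.logLaplace c) ^ 2 ≤ δ →
      ∃ g, IsGGCDensity ν.toMeasure g ∧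
        eLpNorm (fun x => f x - g x) 2 volume ^ 2 ≤ ENNReal.ofReal ε := by
  by_contra! hcon
  -- a sequence of counterexamples, with a subsequence along which `L` converges almost everywhere
  choose ν hspan hν hbad using fun j : ℕ => hcon (1 / ((j : ℝ) + 1)) Nat.one_div_pos_of_nat
  let D : ℕ → (Fin d → ℝ) → ℝ := fun j c => ((ν j).logLaplace c - ν₀.logLaplace c) ^ 2
  have hD : ∀ j, ContinuousOn (D j) (Set.Icc 0 1) := fun j =>
    (((ν j).continuousOn_logLaplace.sub ν₀.continuousOn_logLaplace).pow 2).mono Set.Icc_subset_Ici_self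
  have hDi : ∀ j, IntegrableOn (D j) (Set.Icc 0 1) := fun j => (hD j).integrableOn_compact isCompact_Icc
  have hD1 : Tendsto (fun j => eLpNorm (D j - 0) 1 (volume.restrict (Set.Icc 0 1))) atTop (𝓝 0) := by
    have h1 : ∀ j, eLpNorm (D j - 0) 1 (volume.restrict (Set.Icc 0 1)) ≤
        ENNReal.ofReal (1 / ((j : ℝ) + 1)) := by
      intro j
      rw [sub_zero, eLpNorm_one_eq_lintegral_enorm, ← ofReal_integral_norm_eq_lintegral_enorm (hDi j)]
      refine ENNReal.ofReal_le_ofReal (le_trans (le_of_eq ?_) (hν j))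
      refine integral_congr_ae (Eventually.of_forall fun c => ?_)
      exact Real.norm_of_nonneg (sq_nonneg _)
    refine tendsto_of_tendsto_of_tendsto_of_le_of_le tendsto_const_nhds ?_ (fun _ => zero_le) h1
    rw [← ENNReal.ofReal_zero]
    exact ENNReal.tendsto_ofReal tendsto_one_div_add_atTop_nhds_zero_nat
  obtain ⟨σ, -, hσ⟩ := (tendstoInMeasure_of_tendsto_eLpNorm one_ne_zero
    (fun j => (hDi j).aestronglyMeasurable) aestronglyMeasurable_zero hD1).exists_seq_tendsto_ae
  have hae : ∀ᵐ c ∂(volume.restrict (Set.Icc (0 : Fin d → ℝ) 1)),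
      Tendsto (fun j => (ν (σ j)).logLaplace c) atTop (𝓝 (ν₀.logLaplace c)) := by
    filter_upwards [hσ] with c hc
    have h1 : Tendsto (fun j => (ν (σ j)).logLaplace c - ν₀.logLaplace c) atTop (𝓝 0) := by
      have h2 := (Real.continuous_sqrt.tendsto _).comp hc
      rw [Pi.zero_apply, Real.sqrt_zero] at h2
      refine (tendsto_zero_iff_abs_tendsto_zero _).2 (h2.congr fun j => ?_)
      exact Real.sqrt_sq_eq_abs _
    simpa using h1.add_const (ν₀.logLaplace c)
  have hlog := fun (c : Fin d → ℝ) (hc0 : ∀ i, 0 < c i) (hc1 : ∀ i, c i < 1) =>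
    Atoms.tendsto_logLaplace_of_ae hae hc0 hc1
  choose g hg using fun j => (ν j).exists_isGGCDensity (hspan j)
  have hlim := tendsto_eLpNorm_sub_density hs0 hf hf2 (fun j => hg (σ j)) hlog
  obtain ⟨j, hj⟩ := ((ENNReal.tendsto_nhds_zero.1 hlim) (ENNReal.ofReal ε) (ENNReal.ofReal_pos.2 hε)).exists
  exact (hbad (σ j) _ (hg (σ j))).not_ge hj

end GammaConv

end

open GammaConv in
theorem mainTheorem1 {d : ℕ} {Ω : Type*} [MeasurableSpace Ω] (P : Measure Ω)
    [IsProbabilityMeasure P]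
    (ν₀ : Measure (Fin d → ℝ)) (hν₀ : GammaConv.WellBehaved ν₀)
    (f : (Fin d → ℝ) → ℝ) (hf : GammaConv.IsGGCDensity ν₀ f)
    (hf2 : MemLp f 2 (volume : Measure (Fin d → ℝ)))
    (X : ℕ → Ω → Fin d → ℝ) (hX : ∀ i, AEMeasurable (X i) P) (hindep : iIndepFun X P)
    (hlaw : ∀ i, P.map (X i) = GammaConv.lawOfDensity f) :
    ∀ᵐ ω ∂P, ∀ ε : ℝ, 0 < ε → ∀ᶠ m : ℕ in atTop, ∀ᶠ N : ℕ in atTop,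
      ∀ ν : Measure (Fin d → ℝ),
        GammaConv.IsProjectionMinimizer m N (fun i => X i ω) ν →
          ∃ g : (Fin d → ℝ) → ℝ, GammaConv.IsGGCDensity ν g ∧
            eLpNorm (fun x => f x - g x) 2 (volume : Measure (Fin d → ℝ)) ^ 2
              ≤ ENNReal.ofReal ε := by
  obtain ⟨a₀, rfl, hs0, -⟩ := hν₀.exists_atoms
  have hnn : ∀ᵐ ω ∂P, ∀ i, 0 ≤ X i ω := ae_all_iff.2 fun i => by
    have h1 := hf.isGGC.law_orthant
    rw [← hlaw i] at h1
    exact ae_of_ae_map (hX i) h1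
  filter_upwards [hnn, ae_all_iff.2 (ae_tendsto_empShiftedMoment hf.isGGC.law_orthant hX hindep hlaw)]
    with ω hω hconv ε hε
  obtain ⟨δ, hδ, hclose⟩ := exists_forall_exists_density_close hs0 hf hf2 hε
  have hone : (1 : Fin d → ℝ) ∈ Set.Icc (0 : Fin d → ℝ) 1 := ⟨zero_le_one, le_rfl⟩
  have hμ1 : 0 < shiftedMoment (lawOfDensity f) 1 0 := by
    rw [← bell_thorinMoment hf.isGGC hone.1]
    exact bell_pos_zero _
  -- `μ̂ 0` is smallest at the corner `c = 1` of the cube, so that `b` bounds it from below everywhere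
  obtain ⟨b, hb, hb1⟩ := exists_between hμ1
  have hxb : ∀ᶠ N in atTop, b ≤ empShiftedMoment N (fun i => 1 ⬝ᵥ X i ω) 0 :=
    ((hconv 0 1 hone).eventually_const_lt hb1).mono fun _ h => h.le
  refine Eventually.of_forall fun m => ?_
  have hloss := tendsto_projectionLoss hf.isGGC m hω hb hxb hconv
  have hsmall : ∀ᶠ N in atTop, (b ^ 2)⁻¹ * (2 * projectionLoss m N (fun i => X i ω) a₀.toMeasure) < δ := by
    have := (hloss.const_mul 2).const_mul (b ^ 2)⁻¹
    simp only [mul_zero] at this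
    exact this.eventually_lt_const hδ
  filter_upwards [hxb, hsmall, eventually_ne_atTop 0] with N hN1 hN2 hN0 ν hν
  obtain ⟨a, rfl, -, hspan⟩ := hν.1.exists_atoms
  refine hclose a hspan ((integral_logLaplace_sub_sq_le hN0 hω hb hN1 a a₀ (m := m)).trans
    (le_trans ?_ hN2.le))
  refine mul_le_mul_of_nonneg_left ?_ (by positivity)
  have := hν.2 _ hν₀
  linarith
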